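/- Let $k$ be a field of characteristic zero, and let $\mathcal T_k$ be the free $k$-linear tensor category on one object $X$: its objects are the finitely supported families $(V_n)_{n\ge 0}$ of finite-dimensional representations $V_n$ of the symmetric groups $S_n$ over $k$, and the tensor product of a representation $V$ of $S_m$ and a representation $W$ of $S_n$ is the representation $\mathrm{Ind}_{S_m\times S_n}^{S_{m+n}}(V\otimes W)$ of $S_{m+n}$. Its Grothendieck ring $$K_0(\mathcal T_k)=\bigoplus_{n\ge 0}K_0(k[S_n]\text{-mod})$$ is a commutative ring graded by $n$. Let $x=[X]$ be the class of the trivial representation of $S_1$, and let $\lambda^n x$ be the class of the sign representation of $S_n$. The simple objects of $\mathcal T_k$ are the irreducible representations of the groups $S_n$; up to isomorphism they are the objects $S^\mu X$ labelled by the partitions $\mu$, and $s^\mu x=[S^\mu X]$ denotes their classes. Let $f:K_0(\mathcal T_k)\to K_0(\mathcal T_k)$ be a graded ring homomorphism (it maps the degree $n$ part to the degree $n$ part for every $n$) such that $f(x)=x$, $f(\lambda^2x)=\lambda^2x$, and for every partition $\mu$ $$f(s^\mu x)=\sum_\nu n_{\mu,\nu}\,s^\nu x$$ is a finite linear combination of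 the classes of simple objects with integers $n_{\mu,\nu}\ge 0$. Then $f$ is the identity. -/

import Mathlib

universe u

noncomputable section

namespace FreeTensor

open Representation
open scoped TensorProduct

section Induction

variable {k G H : Type*} [Field k] [Group G] [Group H] (φ : G →* H)
  {A B : Type*} [AddCommGroup A] [Module k A] (ρ : Representation k G A)
  [AddCommGroup B] [Module k B] (τ : Representation k H B)

theorem ind_mk_one (g : G) (a : A) :
    ind φ ρ (φ g) (IndV.mk φ ρ 1 a) = IndV.mk φ ρ 1 (ρ g a) := by
  rw [ind_mk, one_mul]
  have h := Coinvariants.mk_self_apply (ρ := Representation.tprod ((leftRegular k H).comp φ) ρ) g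
    ((MonoidAlgebra.single (φ g)⁻¹ (1 : k)) ⊗ₜ[k] a)
  rw [Representation.tprod_apply, TensorProduct.map_tmul] at h
  simp only [MonoidHom.coe_comp, Function.comp_apply] at h
  simpa using h.symm

theorem ind_induction {P : IndV φ ρ → Prop} (h0 : P 0) (hadd : ∀ x y, P x → P y → P (x + y))
    (h1 : ∀ h a, P (ind φ ρ h (IndV.mk φ ρ 1 a))) (z : IndV φ ρ) : P z := by
  induction z using Coinvariants.induction_on with
  | h v =>
    induction v using TensorProduct.induction_on with
    | zero => simpa using h0
    | add x y hx hy => rw [map_add]; exact hadd _ _ hx hy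
    | tmul x a =>
      induction x using MonoidAlgebra.induction_linear with
      | zero => simpa using h0
      | add x y hx hy => rw [TensorProduct.add_tmul, map_add]; exact hadd _ _ hx hy
      | single h r =>
        have := h1 h⁻¹ (r • a)
        rw [ind_mk, one_mul, inv_inv] at this
        have e : MonoidAlgebra.single h r ⊗ₜ[k] a
            = MonoidAlgebra.single h (1 : k) ⊗ₜ[k] (r • a) := by
          rw [← TensorProduct.smul_tmul]; simp
        rw [e]; exact this

/-- The universal property of induction. -/
def indLift (b : A →ₗ[k] B) (hb : ∀ g a, b (ρ g a) = τ (φ g) (b a)) : IndV φ ρ →ₗ[k] B :=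
  Coinvariants.lift _
    (TensorProduct.lift <| (Finsupp.lift _ _ _ fun h => τ h⁻¹ ∘ₗ b) ∘ₗ
      (MonoidAlgebra.coeffLinearEquiv k).toLinearMap)
    fun g ↦ by
      ext h x
      simp [ofMulAction_single, mul_inv_rev, hb]

theorem indLift_ind (b : A →ₗ[k] B) (hb : ∀ g a, b (ρ g a) = τ (φ g) (b a)) (h : H) (a : A) :
    indLift φ ρ τ b hb (ind φ ρ h (IndV.mk φ ρ 1 a)) = τ h (b a) := by
  rw [ind_mk]
  simp [indLift]

theorem indLift_one (b : A →ₗ[k] B) (hb : ∀ g a, b (ρ g a) = τ (φ g) (b a)) (a : A) :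
    indLift φ ρ τ b hb (IndV.mk φ ρ 1 a) = b a := by
  simp [indLift]

theorem indLift_equivariant (b : A →ₗ[k] B) (hb : ∀ g a, b (ρ g a) = τ (φ g) (b a)) (h : H)
    (z : IndV φ ρ) : indLift φ ρ τ b hb (ind φ ρ h z) = τ h (indLift φ ρ τ b hb z) := by
  induction z using ind_induction with
  | h0 => simp
  | hadd x y hx hy => simp only [map_add, hx, hy]
  | h1 h' a => rw [← Module.End.mul_apply, ← map_mul, indLift_ind, indLift_ind]; simp

end Induction

section Product

variable {k : Type*} [Field k]

/-- The outer tensor product of representations of `G` and `H`, a representation of `G × H`. -/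
def outer {G H A B : Type*} [Group G] [Group H] [AddCommGroup A] [Module k A] [AddCommGroup B]
    [Module k B] (ρ : Representation k G A) (σ : Representation k H B) :
    Representation k (G × H) (A ⊗[k] B) :=
  Representation.tprod (ρ.comp (MonoidHom.fst G H)) (σ.comp (MonoidHom.snd G H))

section

variable {G H K A B X : Type*} [Group G] [Group H] [Group K] [AddCommGroup A] [Module k A]
  [AddCommGroup B] [Module k B] [AddCommGroup X] [Module k X]
  (φ : G × H →* K) (ρ : Representation k G A) (σ : Representation k H B)
  (τ : Representation k K X)

theorem outer_tmul (g : G × H) (a : A) (b : B) :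
    outer ρ σ g (a ⊗ₜ b) = ρ g.1 a ⊗ₜ σ g.2 b := rfl

/-- The module underlying the induction along `φ` of an outer tensor product. -/
def IndProd : Type _ := IndV φ (outer ρ σ)

instance : AddCommGroup (IndProd φ ρ σ) := inferInstanceAs (AddCommGroup (IndV φ (outer ρ σ)))

instance : Module k (IndProd φ ρ σ) := inferInstanceAs (Module k (IndV φ (outer ρ σ)))

instance [Finite K] [Module.Finite k A] [Module.Finite k B] : Module.Finite k (IndProd φ ρ σ) :=
  inferInstanceAs (Module.Finite k (IndV φ (outer ρ σ)))

/-- The representation of `K` induced along `φ : G × H → K` from the outer tensor product of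
a representation of `G` and a representation of `H`. -/
def indProd : Representation k K (IndProd φ ρ σ) := ind φ (outer ρ σ)

/-- The universal bilinear map to the induction of an outer tensor product. -/
def indPair : A →ₗ[k] B →ₗ[k] IndProd φ ρ σ :=
  (TensorProduct.mk k A B).compr₂ (IndV.mk φ (outer ρ σ) 1)

theorem ind_indPair (g : G) (h : H) (a : A) (b : B) :
    indProd φ ρ σ (φ (g, h)) (indPair φ ρ σ a b) = indPair φ ρ σ (ρ g a) (σ h b) :=
  ind_mk_one φ (outer ρ σ) (g, h) (a ⊗ₜ b)

theorem indPair_induction {P : IndProd φ ρ σ → Prop} (h0 : P 0)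
    (hadd : ∀ x y, P x → P y → P (x + y))
    (h1 : ∀ h a b, P (indProd φ ρ σ h (indPair φ ρ σ a b))) (z : IndProd φ ρ σ) :
    P z := by
  induction z using ind_induction with
  | h0 => exact h0
  | hadd x y hx hy => exact hadd x y hx hy
  | h1 h t =>
    induction t using TensorProduct.induction_on with
    | zero => rw [map_zero, map_zero]; exact h0
    | add x y hx hy => rw [map_add, map_add]; exact hadd _ _ hx hy
    | tmul a b => exact h1 h a b

/-- The universal property of the induction of an outer tensor product. -/
def pairLift (f : A →ₗ[k] B →ₗ[k] X)
    (hf : ∀ g h a b, f (ρ g a) (σ h b) = τ (φ (g, h)) (f a b)) :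
    IndProd φ ρ σ →ₗ[k] X :=
  indLift φ (outer ρ σ) τ (TensorProduct.lift f) (by
    intro g t
    induction t using TensorProduct.induction_on with
    | zero => simp
    | add x y hx hy => simp only [map_add, hx, hy]
    | tmul a b => rw [outer_tmul, TensorProduct.lift.tmul, TensorProduct.lift.tmul, hf])

variable {f : A →ₗ[k] B →ₗ[k] X}
    (hf : ∀ g h a b, f (ρ g a) (σ h b) = τ (φ (g, h)) (f a b))

theorem pairLift_indPair (a : A) (b : B) :
    pairLift φ ρ σ τ f hf (indPair φ ρ σ a b) = f a b :=
  indLift_one φ (outer ρ σ) τ _ _ (a ⊗ₜ b)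

theorem pairLift_equivariant (h : K) (z : IndProd φ ρ σ) :
    pairLift φ ρ σ τ f hf (indProd φ ρ σ h z) = τ h (pairLift φ ρ σ τ f hf z) :=
  indLift_equivariant ..

end

section Additivity

variable {G H K A A' A'' B : Type*} [Group G] [Group H] [Group K] [AddCommGroup A] [Module k A]
  [AddCommGroup A'] [Module k A'] [AddCommGroup A''] [Module k A'']
  [AddCommGroup B] [Module k B]
  (φ : G × H →* K) (ρ : Representation k G A) (ρ' : Representation k G A')
  (ρ'' : Representation k G A'') (σ : Representation k H B)

/-- Functoriality of the induction product in the first variable. -/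
def mapLeft (f : A →ₗ[k] A') (hf : ∀ g a, f (ρ g a) = ρ' g (f a)) :
    IndProd φ ρ σ →ₗ[k] IndProd φ ρ' σ :=
  pairLift φ ρ σ (indProd φ ρ' σ) (indPair φ ρ' σ ∘ₗ f) (by
    intro g h a b
    simp only [LinearMap.comp_apply]
    rw [ind_indPair, hf])

theorem mapLeft_equivariant (f : A →ₗ[k] A') (hf : ∀ g a, f (ρ g a) = ρ' g (f a)) (h : K)
    (z : IndProd φ ρ σ) :
    mapLeft φ ρ ρ' σ f hf (indProd φ _ _ h z) = indProd φ _ _ h (mapLeft φ ρ ρ' σ f hf z) :=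
  pairLift_equivariant ..

theorem mapLeft_indPair (f : A →ₗ[k] A') (hf : ∀ g a, f (ρ g a) = ρ' g (f a)) (a : A) (b : B) :
    mapLeft φ ρ ρ' σ f hf (indPair φ ρ σ a b) = indPair φ ρ' σ (f a) b :=
  pairLift_indPair ..

theorem mapLeft_mapLeft (f : A →ₗ[k] A') (hf : ∀ g a, f (ρ g a) = ρ' g (f a))
    (f' : A' →ₗ[k] A'') (hf' : ∀ g a, f' (ρ' g a) = ρ'' g (f' a)) (z : IndProd φ ρ σ) :
    mapLeft φ ρ' ρ'' σ f' hf' (mapLeft φ ρ ρ' σ f hf z) =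
      mapLeft φ ρ ρ'' σ (f' ∘ₗ f) (by simp [hf, hf']) z := by
  induction z using indPair_induction with
  | h0 => simp
  | hadd x y hx hy => simp only [map_add, hx, hy]
  | h1 h a b => simp only [mapLeft_equivariant, mapLeft_indPair, LinearMap.comp_apply]

theorem mapLeft_id (z : IndProd φ ρ σ) :
    mapLeft φ ρ ρ σ LinearMap.id (by simp) z = z := by
  induction z using indPair_induction with
  | h0 => simp
  | hadd x y hx hy => simp only [map_add, hx, hy]
  | h1 h a b => simp only [mapLeft_equivariant, mapLeft_indPair, LinearMap.id_apply]

theorem mapLeft_add (f f' : A →ₗ[k] A') (hf : ∀ g a, f (ρ g a) = ρ' g (f a))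
    (hf' : ∀ g a, f' (ρ g a) = ρ' g (f' a)) (z : IndProd φ ρ σ) :
    mapLeft φ ρ ρ' σ (f + f') (by simp [hf, hf']) z
      = mapLeft φ ρ ρ' σ f hf z + mapLeft φ ρ ρ' σ f' hf' z := by
  induction z using indPair_induction with
  | h0 => simp
  | hadd x y hx hy => simp only [map_add, hx, hy]; abel
  | h1 h a b =>
    simp only [mapLeft_equivariant, mapLeft_indPair, LinearMap.add_apply, map_add]

theorem mapLeft_zero (z : IndProd φ ρ σ) :
    mapLeft φ ρ ρ' σ 0 (by simp) z = 0 := by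
  induction z using indPair_induction with
  | h0 => simp
  | hadd x y hx hy => simp only [map_add, hx, hy, add_zero]
  | h1 h a b =>
    simp only [mapLeft_equivariant, mapLeft_indPair, LinearMap.zero_apply, map_zero]

end Additivity

section Assoc

/-- The trilinear map `(a, b, d) ↦ P a (Q b d)`. -/
def bilinComp {A B C D X : Type*} [AddCommGroup A] [Module k A] [AddCommGroup B] [Module k B]
    [AddCommGroup C] [Module k C] [AddCommGroup D] [Module k D] [AddCommGroup X] [Module k X]
    (P : A →ₗ[k] D →ₗ[k] X) (Q : B →ₗ[k] C →ₗ[k] D) : A →ₗ[k] B →ₗ[k] C →ₗ[k] X where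
  toFun a := Q.compr₂ (P a)
  map_add' _ _ := by ext; simp
  map_smul' _ _ := by ext; simp

variable {G₁ G₂ G₃ G₁₂ G₂₃ L L' A B C X : Type*} [Group G₁] [Group G₂] [Group G₃] [Group G₁₂]
  [Group G₂₃] [Group L] [Group L'] [AddCommGroup A] [Module k A] [AddCommGroup B] [Module k B]
  [AddCommGroup C] [Module k C] [AddCommGroup X] [Module k X]
  (φ : G₁ × G₂ →* G₁₂) (φ' : G₁₂ × G₃ →* L) (ψ : G₂ × G₃ →* G₂₃) (ψ' : G₁ × G₂₃ →* L')
  (c : L ≃* L') (hc : ∀ x y z, c (φ' (φ (x, y), z)) = ψ' (x, ψ (y, z)))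
  (ρ : Representation k G₁ A) (σ : Representation k G₂ B) (τ : Representation k G₃ C)

theorem exists_tripleLift (κ : Representation k L X) (t : A →ₗ[k] B →ₗ[k] C →ₗ[k] X)
    (ht : ∀ x y z a b d, t (ρ x a) (σ y b) (τ z d) = κ (φ' (φ (x, y), z)) (t a b d)) :
    ∃ F : IndProd φ' (indProd φ ρ σ) τ →ₗ[k] X,
      (∀ g z, F (indProd φ' _ _ g z) = κ g (F z)) ∧
      ∀ a b d, F (indPair φ' _ τ (indPair φ ρ σ a b) d) = t a b d := by
  let ν : Representation k G₁₂ (C →ₗ[k] X) :=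
    linHom (Representation.trivial k G₁₂ C) (κ.comp (φ'.comp (MonoidHom.inl G₁₂ G₃)))
  have hν : ∀ g f d, ν g f d = κ (φ' (g, 1)) (f d) := by
    intro g f d
    simp [ν, linHom_apply]
  have ht' : ∀ g h a b, t (ρ g a) (σ h b) = ν (φ (g, h)) (t a b) := by
    intro g h a b
    ext d
    rw [hν, ← ht]
    simp
  have key : ∀ g h (x : X), κ (φ' (1, h)) (κ (φ' (g, 1)) x) = κ (φ' (g, h)) x := by
    intro g h x
    rw [← Module.End.mul_apply, ← map_mul, ← map_mul]
    simp
  have key' : ∀ g h (x : X), κ (φ' (g, 1)) (κ (φ' (1, h)) x) = κ (φ' (g, h)) x := by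
    intro g h x
    rw [← Module.End.mul_apply, ← map_mul, ← map_mul]
    simp
  obtain ⟨s, hs1, hs2⟩ : ∃ s : IndProd φ ρ σ →ₗ[k] C →ₗ[k] X,
      (∀ g z, s (indProd φ ρ σ g z) = ν g (s z)) ∧
      ∀ a b, s (indPair φ ρ σ a b) = t a b :=
    ⟨pairLift φ ρ σ ν t ht', pairLift_equivariant φ ρ σ ν ht', pairLift_indPair φ ρ σ ν ht'⟩
  have h1 : ∀ h z d, s z (τ h d) = κ (φ' (1, h)) (s z d) := by
    intro h z d
    induction z using indPair_induction with
    | h0 => simp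
    | hadd x y hx hy => simp only [map_add, LinearMap.add_apply, hx, hy]
    | h1 l a b =>
      rw [hs1, hν, hν, hs2, key, ← key' l h]
      congr 1
      have := ht 1 1 h a b d
      simpa [show ((1 : G₁), (1 : G₂)) = 1 from rfl] using this
  have hs : ∀ g h z d, s (indProd φ ρ σ g z) (τ h d) = κ (φ' (g, h)) (s z d) := by
    intro g h z d
    rw [h1, hs1, hν, key]
  exact ⟨pairLift φ' _ τ κ s hs, pairLift_equivariant φ' _ τ κ hs, fun a b d => by
    rw [pairLift_indPair, hs2]⟩

theorem exists_tripleLift' (κ : Representation k L' X) (t : A →ₗ[k] B →ₗ[k] C →ₗ[k] X)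
    (ht : ∀ x y z a b d, t (ρ x a) (σ y b) (τ z d) = κ (ψ' (x, ψ (y, z))) (t a b d)) :
    ∃ F : IndProd ψ' ρ (indProd ψ σ τ) →ₗ[k] X,
      (∀ g z, F (indProd ψ' _ _ g z) = κ g (F z)) ∧
      ∀ a b d, F (indPair ψ' ρ _ a (indPair ψ σ τ b d)) = t a b d := by
  let ν : Representation k G₂₃ (A →ₗ[k] X) :=
    linHom (Representation.trivial k G₂₃ A) (κ.comp (ψ'.comp (MonoidHom.inr G₁ G₂₃)))
  have hν : ∀ g f a, ν g f a = κ (ψ' (1, g)) (f a) := by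
    intro g f d
    simp [ν, linHom_apply]
  let t' : B →ₗ[k] C →ₗ[k] A →ₗ[k] X :=
    { toFun := fun b => (t.flip b).flip
      map_add' := by intros; ext; simp
      map_smul' := by intros; ext; simp }
  have htt : ∀ a b d, t' b d a = t a b d := fun _ _ _ => rfl
  have ht' : ∀ g h b d, t' (σ g b) (τ h d) = ν (ψ (g, h)) (t' b d) := by
    intro g h b d
    ext a
    rw [hν, htt, htt, ← ht]
    simp
  have key : ∀ g h (x : X), κ (ψ' (1, h)) (κ (ψ' (g, 1)) x) = κ (ψ' (g, h)) x := by
    intro g h x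
    rw [← Module.End.mul_apply, ← map_mul, ← map_mul]
    simp
  have key' : ∀ g h (x : X), κ (ψ' (g, 1)) (κ (ψ' (1, h)) x) = κ (ψ' (g, h)) x := by
    intro g h x
    rw [← Module.End.mul_apply, ← map_mul, ← map_mul]
    simp
  obtain ⟨s, hs1, hs2⟩ : ∃ s : IndProd ψ σ τ →ₗ[k] A →ₗ[k] X,
      (∀ g z, s (indProd ψ σ τ g z) = ν g (s z)) ∧
      ∀ b d, s (indPair ψ σ τ b d) = t' b d :=
    ⟨pairLift ψ σ τ ν t' ht', pairLift_equivariant ψ σ τ ν ht', pairLift_indPair ψ σ τ ν ht'⟩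
  have h1 : ∀ g z a, s z (ρ g a) = κ (ψ' (g, 1)) (s z a) := by
    intro g z a
    induction z using indPair_induction with
    | h0 => simp
    | hadd x y hx hy => simp only [map_add, LinearMap.add_apply, hx, hy]
    | h1 l b d =>
      rw [hs1, hν, hν, hs2, key', ← key g l, htt, htt]
      congr 1
      have := ht g 1 1 a b d
      simpa [show ((1 : G₂), (1 : G₃)) = 1 from rfl] using this
  have hs : ∀ g h a z, s.flip (ρ g a) (indProd ψ σ τ h z) = κ (ψ' (g, h)) (s.flip a z) := by
    intro g h a z
    rw [LinearMap.flip_apply, LinearMap.flip_apply, h1, hs1, hν, key']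
  exact ⟨pairLift ψ' ρ _ κ s.flip hs, pairLift_equivariant ψ' ρ _ κ hs, fun a b d => by
    rw [pairLift_indPair, LinearMap.flip_apply, hs2, htt]⟩

theorem triple_induction {P : IndProd φ' (indProd φ ρ σ) τ → Prop} (h0 : P 0)
    (hadd : ∀ x y, P x → P y → P (x + y))
    (h1 : ∀ h a b d, P (indProd φ' _ _ h (indPair φ' _ τ (indPair φ ρ σ a b) d)))
    (z : IndProd φ' (indProd φ ρ σ) τ) : P z := by
  induction z using indPair_induction with
  | h0 => exact h0
  | hadd x y hx hy => exact hadd x y hx hy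
  | h1 h w d =>
    induction w using indPair_induction with
    | h0 => simpa using h0
    | hadd x y hx hy => simpa only [map_add, LinearMap.add_apply] using hadd _ _ hx hy
    | h1 l a b =>
      have := h1 (h * φ' (l, 1)) a b d
      rw [map_mul, Module.End.mul_apply, ind_indPair] at this
      simpa using this

theorem triple_induction' {P : IndProd ψ' ρ (indProd ψ σ τ) → Prop} (h0 : P 0)
    (hadd : ∀ x y, P x → P y → P (x + y))
    (h1 : ∀ h a b d, P (indProd ψ' _ _ h (indPair ψ' ρ _ a (indPair ψ σ τ b d))))
    (z : IndProd ψ' ρ (indProd ψ σ τ)) : P z := by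
  induction z using indPair_induction with
  | h0 => exact h0
  | hadd x y hx hy => exact hadd x y hx hy
  | h1 h a w =>
    induction w using indPair_induction with
    | h0 => simpa using h0
    | hadd x y hx hy => simpa only [map_add, LinearMap.add_apply] using hadd _ _ hx hy
    | h1 l b d =>
      have := h1 (h * ψ' (1, l)) a b d
      rw [map_mul, Module.End.mul_apply, ind_indPair] at this
      simpa using this

/-- A trilinear form of the universal bilinear maps, bracketed to the left. -/
def triL : A →ₗ[k] B →ₗ[k] C →ₗ[k] IndProd φ' (indProd φ ρ σ) τ :=
  (indPair φ ρ σ).compr₂ (indPair φ' _ τ)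

/-- A trilinear form of the universal bilinear maps, bracketed to the right. -/
def triR : A →ₗ[k] B →ₗ[k] C →ₗ[k] IndProd ψ' ρ (indProd ψ σ τ) :=
  bilinComp (indPair ψ' ρ _) (indPair ψ σ τ)

theorem triL_apply (a : A) (b : B) (d : C) :
    triL φ φ' ρ σ τ a b d = indPair φ' _ τ (indPair φ ρ σ a b) d := rfl

theorem triR_apply (a : A) (b : B) (d : C) :
    triR ψ ψ' ρ σ τ a b d = indPair ψ' ρ _ a (indPair ψ σ τ b d) := rfl

theorem exists_assocEquiv (hc : ∀ x y z, c (φ' (φ (x, y), z)) = ψ' (x, ψ (y, z))) :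
    ∃ e : IndProd φ' (indProd φ ρ σ) τ ≃ₗ[k] IndProd ψ' ρ (indProd ψ σ τ),
      ∀ g z, e (indProd φ' _ _ g z) = indProd ψ' _ _ (c g) (e z) := by
  let κ : Representation k L (IndProd ψ' ρ (indProd ψ σ τ)) :=
    (indProd ψ' ρ (indProd ψ σ τ)).comp c.toMonoidHom
  have hκ : ∀ g z, κ g z = indProd ψ' ρ (indProd ψ σ τ) (c g) z := fun _ _ => rfl
  let κ' : Representation k L' (IndProd φ' (indProd φ ρ σ) τ) :=
    (indProd φ' (indProd φ ρ σ) τ).comp c.symm.toMonoidHom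
  have hκ' : ∀ g z, κ' g z = indProd φ' (indProd φ ρ σ) τ (c.symm g) z :=
    fun _ _ => rfl
  have hR : ∀ x y z a b d, triR ψ ψ' ρ σ τ (ρ x a) (σ y b) (τ z d)
      = κ (φ' (φ (x, y), z)) (triR ψ ψ' ρ σ τ a b d) := by
    intro x y z a b d
    rw [hκ, hc, triR_apply, triR_apply, ind_indPair, ind_indPair]
  have hL : ∀ x y z a b d, triL φ φ' ρ σ τ (ρ x a) (σ y b) (τ z d)
      = κ' (ψ' (x, ψ (y, z))) (triL φ φ' ρ σ τ a b d) := by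
    intro x y z a b d
    rw [hκ', ← hc, MulEquiv.symm_apply_apply, triL_apply, triL_apply, ind_indPair, ind_indPair]
  obtain ⟨F, hF, hF'⟩ := exists_tripleLift φ φ' ρ σ τ κ (triR ψ ψ' ρ σ τ) hR
  obtain ⟨F', hG, hG'⟩ := exists_tripleLift' ψ ψ' ρ σ τ κ' (triL φ φ' ρ σ τ) hL
  have hF2 : ∀ g z, F (indProd φ' _ _ g z) = indProd ψ' _ _ (c g) (F z) := hF
  have hG2 : ∀ g z, F' (indProd ψ' _ _ g z) = indProd φ' _ _ (c.symm g) (F' z) := hG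
  refine ⟨LinearEquiv.ofLinearMap F F' ?_ ?_, hF2⟩
  · refine LinearMap.ext fun z => ?_
    induction z using triple_induction' with
    | h0 => simp
    | hadd x y hx hy => simp only [map_add, hx, hy]
    | h1 h a b d =>
      rw [LinearMap.comp_apply, hG2, hG', triL_apply, hF2, hF', triR_apply]
      simp
  · refine LinearMap.ext fun z => ?_
    induction z using triple_induction with
    | h0 => simp
    | hadd x y hx hy => simp only [map_add, hx, hy]
    | h1 h a b d =>
      rw [LinearMap.comp_apply, hF2, hF', triR_apply, hG2, hG', triL_apply]
      simp

end Assoc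

section CommUnit

variable {G₁ G₂ L L' A B : Type*} [Group G₁] [Group G₂] [Group L] [Group L']
  [AddCommGroup A] [Module k A] [AddCommGroup B] [Module k B]
  (φ : G₁ × G₂ →* L) (ψ : G₂ × G₁ →* L') (c : L ≃* L') (w : L')
  (ρ : Representation k G₁ A) (σ : Representation k G₂ B)

theorem exists_commEquiv (hc : ∀ x y, c (φ (x, y)) * w = w * ψ (y, x)) :
    ∃ e : IndProd φ ρ σ ≃ₗ[k] IndProd ψ σ ρ,
      ∀ g z, e (indProd φ _ _ g z) = indProd ψ _ _ (c g) (e z) := by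
  let κ : Representation k L (IndProd ψ σ ρ) := (indProd ψ σ ρ).comp c.toMonoidHom
  let κ' : Representation k L' (IndProd φ ρ σ) := (indProd φ ρ σ).comp c.symm.toMonoidHom
  have hκ : ∀ g z, κ g z = indProd ψ σ ρ (c g) z := fun _ _ => rfl
  have hκ' : ∀ g z, κ' g z = indProd φ ρ σ (c.symm g) z := fun _ _ => rfl
  let f : A →ₗ[k] B →ₗ[k] IndProd ψ σ ρ :=
    (indPair ψ σ ρ).flip.compr₂ (indProd ψ σ ρ w)
  have f_apply : ∀ a b, f a b = indProd ψ σ ρ w (indPair ψ σ ρ b a) := fun _ _ => rfl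
  let f' : B →ₗ[k] A →ₗ[k] IndProd φ ρ σ :=
    (indPair φ ρ σ).flip.compr₂ (indProd φ ρ σ (c.symm w⁻¹))
  have f'_apply : ∀ a b, f' b a = indProd φ ρ σ (c.symm w⁻¹) (indPair φ ρ σ a b) :=
    fun _ _ => rfl
  have hf : ∀ x y a b, f (ρ x a) (σ y b) = κ (φ (x, y)) (f a b) := by
    intro x y a b
    rw [f_apply, f_apply, hκ, ← ind_indPair, ← Module.End.mul_apply, ← Module.End.mul_apply,
      ← map_mul, ← map_mul, hc]
  have hc' : ∀ x y, c.symm w⁻¹ * φ (x, y) = c.symm (ψ (y, x)) * c.symm w⁻¹ := by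
    intro x y
    apply c.injective
    rw [map_mul, map_mul, c.apply_symm_apply, c.apply_symm_apply, eq_mul_inv_iff_mul_eq,
      mul_assoc, hc, inv_mul_cancel_left]
  have hf' : ∀ y x b a, f' (σ y b) (ρ x a) = κ' (ψ (y, x)) (f' b a) := by
    intro y x b a
    rw [f'_apply, f'_apply, hκ', ← ind_indPair, ← Module.End.mul_apply, ← Module.End.mul_apply,
      ← map_mul, ← map_mul, hc']
  obtain ⟨F, hF, hF'⟩ : ∃ F : IndProd φ ρ σ →ₗ[k] IndProd ψ σ ρ,
      (∀ g z, F (indProd φ _ _ g z) = indProd ψ _ _ (c g) (F z)) ∧ ∀ a b, F (indPair φ ρ σ a b) = f a b :=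
    ⟨pairLift φ ρ σ κ f hf, pairLift_equivariant φ ρ σ κ hf, pairLift_indPair φ ρ σ κ hf⟩
  obtain ⟨F', hG, hG'⟩ : ∃ F' : IndProd ψ σ ρ →ₗ[k] IndProd φ ρ σ,
      (∀ g z, F' (indProd ψ _ _ g z) = indProd φ _ _ (c.symm g) (F' z)) ∧
        ∀ b a, F' (indPair ψ σ ρ b a) = f' b a :=
    ⟨pairLift ψ σ ρ κ' f' hf', pairLift_equivariant ψ σ ρ κ' hf', pairLift_indPair ψ σ ρ κ' hf'⟩
  refine ⟨LinearEquiv.ofLinearMap F F' ?_ ?_, hF⟩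
  · refine LinearMap.ext fun z => ?_
    induction z using indPair_induction with
    | h0 => simp
    | hadd x y hx hy => simp only [map_add, hx, hy]
    | h1 h b a =>
      rw [LinearMap.comp_apply, hG, hG', f'_apply, hF, hF, hF', f_apply, c.apply_symm_apply,
        c.apply_symm_apply, ← Module.End.mul_apply (indProd ψ _ _ w⁻¹), ← map_mul]
      simp
  · refine LinearMap.ext fun z => ?_
    induction z using indPair_induction with
    | h0 => simp
    | hadd x y hx hy => simp only [map_add, hx, hy]
    | h1 h a b =>
      rw [LinearMap.comp_apply, hF, hF', f_apply, hG, hG, hG', f'_apply, c.symm_apply_apply,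
        ← Module.End.mul_apply (indProd φ _ _ (c.symm w)), ← map_mul, ← map_mul]
      simp

/-- Inducing along an isomorphism does nothing; here the second factor is the trivial
representation of a trivial group. -/
theorem exists_unitEquiv [Subsingleton G₂] (φ : G₁ × G₂ →* L) (c : L ≃* G₁)
    (hc : ∀ x y, c (φ (x, y)) = x) :
    ∃ e : IndProd φ ρ (Representation.trivial k G₂ k) ≃ₗ[k] A,
      ∀ g z, e (indProd φ _ _ g z) = ρ (c g) (e z) := by
  let σ := Representation.trivial k G₂ k
  have hφ : ∀ l, φ (c l, 1) = l := fun l => c.injective (hc _ _)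
  let f : A →ₗ[k] k →ₗ[k] A := (LinearMap.lsmul k A).flip
  have f_apply : ∀ a r, f a r = r • a := fun _ _ => rfl
  let κ : Representation k L A := ρ.comp c.toMonoidHom
  have hκ : ∀ g z, κ g z = ρ (c g) z := fun _ _ => rfl
  have hf : ∀ x y a r, f (ρ x a) (σ y r) = κ (φ (x, y)) (f a r) := by
    intro x y a r
    rw [f_apply, f_apply, hκ, hc]
    simp [σ]
  obtain ⟨F, hF, hF'⟩ : ∃ F : IndProd φ ρ σ →ₗ[k] A,
      (∀ g z, F (indProd φ _ _ g z) = ρ (c g) (F z)) ∧ ∀ a b, F (indPair φ ρ σ a b) = f a b :=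
    ⟨pairLift φ ρ σ κ f hf, pairLift_equivariant φ ρ σ κ hf, pairLift_indPair φ ρ σ κ hf⟩
  refine ⟨LinearEquiv.ofLinearMap F ((indPair φ ρ σ).flip 1) ?_ ?_, hF⟩
  · ext a
    simp [hF', f_apply]
  · refine LinearMap.ext fun z => ?_
    induction z using indPair_induction with
    | h0 => simp
    | hadd x y hx hy => simp only [map_add, hx, hy]
    | h1 h a r =>
      rw [LinearMap.comp_apply, hF, hF', f_apply, LinearMap.flip_apply]
      nth_rw 2 [← hφ h]
      rw [ind_indPair]
      rw [map_smul, map_smul, LinearMap.smul_apply, ← map_smul]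
      simp [σ]

end CommUnit
end Product

section GrothendieckGroup

/-- The relations `[B] = [A] + [C]` for the short exact sequences `0 → A → B → C → 0` of
finite-dimensional representations of `G` over `k`. -/
def exactRelations (k : Type u) [Field k] (G : Type*) [Group G] :
    Set (FreeAbelianGroup (FDRep k G)) :=
  {x | ∃ (A B C : FDRep k G) (i : IntertwiningMap A.ρ B.ρ) (p : IntertwiningMap B.ρ C.ρ),
    Function.Injective i ∧ Function.Exact i p ∧ Function.Surjective p ∧
      x = FreeAbelianGroup.of B - FreeAbelianGroup.of A - FreeAbelianGroup.of C}

/-- The Grothendieck group `K₀` of the abelian category of finite-dimensional representations of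
`G` over `k`. -/
def RepK0 (k : Type u) [Field k] (G : Type*) [Group G] : Type _ :=
  FreeAbelianGroup (FDRep k G) ⧸ AddSubgroup.closure (exactRelations k G)

variable {k : Type u} [Field k]

section

variable {G : Type*} [Group G]

instance : AddCommGroup (RepK0 k G) :=
  inferInstanceAs (AddCommGroup (_ ⧸ AddSubgroup.closure (exactRelations k G)))

/-- The quotient map from the free abelian group on the objects. -/
def RepK0.proj : FreeAbelianGroup (FDRep k G) →+ RepK0 k G :=
  QuotientAddGroup.mk' (AddSubgroup.closure (exactRelations k G))

/-- The class `[V]` in the Grothendieck group. -/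
def RepK0.mk (V : FDRep k G) : RepK0 k G :=
  RepK0.proj (FreeAbelianGroup.of V)

theorem RepK0.mk_eq_add {A B C : FDRep k G} (i : IntertwiningMap A.ρ B.ρ)
    (p : IntertwiningMap B.ρ C.ρ) (hi : Function.Injective i) (hip : Function.Exact i p)
    (hp : Function.Surjective p) : RepK0.mk B = RepK0.mk A + RepK0.mk C := by
  rw [← sub_eq_zero, ← sub_sub]
  unfold RepK0.mk
  rw [← map_sub, ← map_sub]
  exact (QuotientAddGroup.eq_zero_iff _).2
    (AddSubgroup.subset_closure ⟨A, B, C, i, p, hi, hip, hp, rfl⟩)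

@[elab_as_elim]
theorem RepK0.induction {P : RepK0 k G → Prop} (h0 : P 0) (hmk : ∀ V, P (RepK0.mk V))
    (hneg : ∀ x, P x → P (-x)) (hadd : ∀ x y, P x → P y → P (x + y)) (x : RepK0 k G) : P x := by
  obtain ⟨x, rfl⟩ := QuotientAddGroup.mk'_surjective _ x
  induction x using FreeAbelianGroup.induction_on with
  | zero => exact h0
  | of V => exact hmk V
  | neg V hV => rw [map_neg]; exact hneg _ hV
  | add x y hx hy => rw [map_add]; exact hadd _ _ hx hy

/-- The universal property of the Grothendieck group. -/
def RepK0.lift {M : Type*} [AddCommGroup M] (f : FDRep k G → M)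
    (hf : ∀ (A B C : FDRep k G) (i : IntertwiningMap A.ρ B.ρ) (p : IntertwiningMap B.ρ C.ρ),
      Function.Injective i → Function.Exact i p → Function.Surjective p → f B = f A + f C) :
    RepK0 k G →+ M :=
  QuotientAddGroup.lift _ (FreeAbelianGroup.lift f) (by
    rw [AddSubgroup.closure_le]
    rintro _ ⟨A, B, C, i, p, hi, hip, hp, rfl⟩
    simp [hf A B C i p hi hip hp])

theorem RepK0.lift_mk {M : Type*} [AddCommGroup M] (f : FDRep k G → M)
    (hf : ∀ (A B C : FDRep k G) (i : IntertwiningMap A.ρ B.ρ) (p : IntertwiningMap B.ρ C.ρ),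
      Function.Injective i → Function.Exact i p → Function.Surjective p → f B = f A + f C)
    (V : FDRep k G) : RepK0.lift f hf (RepK0.mk V) = f V :=
  FreeAbelianGroup.lift_apply_of f V

theorem RepK0.mk_eq_of_equiv {V W : FDRep k G} (e : V ≃ₗ[k] W)
    (he : ∀ g v, e (V.ρ g v) = W.ρ g (e v)) : RepK0.mk V = RepK0.mk W := by
  let Z : FDRep k G := FDRep.of (Representation.trivial k G PUnit.{u + 1})
  have hz : RepK0.mk Z = 0 := by
    have := RepK0.mk_eq_add (A := Z) (B := Z) (C := Z) 0 0 (fun _ _ _ => rfl)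
      (fun x => ⟨fun _ => ⟨x, rfl⟩, fun _ => rfl⟩) (fun x => ⟨x, rfl⟩)
    simpa using this
  have := RepK0.mk_eq_add (A := V) (B := W) (C := Z)
    ⟨e.toLinearMap, fun g => LinearMap.ext fun v => he g v⟩ 0 e.injective
      (fun x => ⟨fun _ => ⟨e.symm x, e.apply_symm_apply x⟩, fun _ => rfl⟩) (fun x => ⟨0, rfl⟩)
  rw [this, hz, add_zero]

/-- Maschke's theorem: short exact sequences split. -/
theorem exists_splitting [CharZero k] [Finite G] {A B C : FDRep k G}
    (i : IntertwiningMap A.ρ B.ρ) (p : IntertwiningMap B.ρ C.ρ) (hi : Function.Injective i)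
    (hip : Function.Exact i p) (hp : Function.Surjective p) :
    ∃ (r : B →ₗ[k] A) (s : C →ₗ[k] B), (∀ g b, r (B.ρ g b) = A.ρ g (r b)) ∧
      (∀ g c, s (C.ρ g c) = B.ρ g (s c)) ∧ (∀ a, r (i a) = a) ∧ (∀ c, p (s c) = c) ∧
      ∀ b, i (r b) + s (p b) = b := by
  have : NeZero (Nat.card G : k) := ⟨Nat.cast_ne_zero.2 Nat.card_pos.ne'⟩
  obtain ⟨r', hr'⟩ := MonoidAlgebra.exists_leftInverse_of_injective
    (IntertwiningMap.equivLinearMapAsModule A.ρ B.ρ i) (LinearMap.ker_eq_bot.2 hi)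
  obtain ⟨r, rfl⟩ := (IntertwiningMap.equivLinearMapAsModule B.ρ A.ρ).surjective r'
  have hri : ∀ a, r (i a) = a := fun a => LinearMap.congr_fun hr' a
  have hrg : ∀ g b, r (B.ρ g b) = A.ρ g (r b) := fun g b => LinearMap.congr_fun (r.2 g) b
  have hig : ∀ g b, i (A.ρ g b) = B.ρ g (i b) := fun g b => LinearMap.congr_fun (i.2 g) b
  have hpg : ∀ g b, p (B.ρ g b) = C.ρ g (p b) := fun g b => LinearMap.congr_fun (p.2 g) b
  obtain ⟨t, ht⟩ := p.toLinearMap.exists_rightInverse_of_surjective (LinearMap.range_eq_top.2 hp)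
  have htp : ∀ c, p (t c) = c := fun c => LinearMap.congr_fun ht c
  have hpi : ∀ a, p (i a) = 0 := fun a => (hip (i a)).2 ⟨a, rfl⟩
  have key : ∀ b, p b = 0 → i (r b) = b := by
    intro b hb
    obtain ⟨a, rfl⟩ := (hip b).1 hb
    rw [hri]
  have hs : ∀ c, (t - i.toLinearMap ∘ₗ r.toLinearMap ∘ₗ t) c = t c - i (r (t c)) := fun _ => rfl
  refine ⟨r.toLinearMap, t - i.toLinearMap ∘ₗ r.toLinearMap ∘ₗ t, hrg, ?_, hri, ?_, ?_⟩
  · intro g c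
    have := key (t (C.ρ g c) - B.ρ g (t c)) (by rw [map_sub, hpg, htp, htp, sub_self])
    rw [map_sub, map_sub, hrg, hig] at this
    rw [hs, hs, map_sub]
    rw [sub_eq_sub_iff_sub_eq_sub, ← this]
  · intro c
    rw [hs, map_sub, htp, hpi, sub_zero]
  · intro b
    have := key (b - t (p b)) (by rw [map_sub, htp, sub_self])
    rw [map_sub, map_sub] at this
    rw [hs]
    change i (r b) + _ = b
    have h2 : i (r b) = b - t (p b) + i (r (t (p b))) := by rw [← this]; abel
    rw [h2]; abel

end

end GrothendieckGroup

section Ring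

/-- The embedding `S_m × S_n → S_{m+n}` as a Young subgroup: the first factor permutes the first
`m` points, the second one permutes the last `n` points. -/
def youngHom (m n : ℕ) : Equiv.Perm (Fin m) × Equiv.Perm (Fin n) →* Equiv.Perm (Fin (m + n)) :=
  (finSumFinEquiv.permCongrHom : Equiv.Perm (Fin m ⊕ Fin n) ≃* _).toMonoidHom.comp
    (Equiv.Perm.sumCongrHom (Fin m) (Fin n))

theorem youngHom_castAdd {m n : ℕ} (g : Equiv.Perm (Fin m)) (h : Equiv.Perm (Fin n)) (i : Fin m) :
    youngHom m n (g, h) (Fin.castAdd n i) = Fin.castAdd n (g i) := by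
  simp [youngHom]

theorem youngHom_natAdd {m n : ℕ} (g : Equiv.Perm (Fin m)) (h : Equiv.Perm (Fin n)) (i : Fin n) :
    youngHom m n (g, h) (Fin.natAdd m i) = Fin.natAdd m (h i) := by
  simp [youngHom]

/-- Transport of permutations along an equality `m = n`. -/
def permCast {m n : ℕ} (h : m = n) : Equiv.Perm (Fin m) ≃* Equiv.Perm (Fin n) :=
  (finCongr h).permCongrHom

theorem permCast_cast {m n : ℕ} (h : m = n) (g : Equiv.Perm (Fin m)) (i : Fin m) :
    permCast h g (Fin.cast h i) = Fin.cast h (g i) := by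
  subst h; rfl

theorem permCast_assoc {m n p : ℕ} (x : Equiv.Perm (Fin m)) (y : Equiv.Perm (Fin n))
    (z : Equiv.Perm (Fin p)) :
    permCast (Nat.add_assoc m n p) (youngHom (m + n) p (youngHom m n (x, y), z)) =
      youngHom m (n + p) (x, youngHom n p (y, z)) := by
  refine Equiv.ext fun j => ?_
  obtain ⟨j, rfl⟩ := (finCongr (Nat.add_assoc m n p)).surjective j
  rw [finCongr_apply, permCast_cast]
  induction j using Fin.addCases with
  | left j =>
    induction j using Fin.addCases with
    | left j =>
      rw [youngHom_castAdd, youngHom_castAdd]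
      exact (youngHom_castAdd x (youngHom n p (y, z)) j).symm
    | right j =>
      rw [youngHom_castAdd, youngHom_natAdd]
      have h1 : ∀ j : Fin n, Fin.cast (Nat.add_assoc m n p) (Fin.castAdd p (Fin.natAdd m j)) =
        Fin.natAdd m (Fin.castAdd p j) := fun _ => rfl
      rw [h1, h1, youngHom_natAdd, youngHom_castAdd]
  | right j =>
    rw [youngHom_natAdd]
    have h1 : ∀ j : Fin p, Fin.cast (Nat.add_assoc m n p) (Fin.natAdd (m + n) j) =
      Fin.natAdd m (Fin.natAdd n j) := fun j => Fin.ext (Nat.add_assoc m n j)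
    rw [h1, h1, youngHom_natAdd, youngHom_natAdd]

/-- The permutation that exchanges the blocks `n` and `m`. -/
def blockSwap (m n : ℕ) : Equiv.Perm (Fin (n + m)) :=
  finAddFlip.trans (finCongr (Nat.add_comm m n))

theorem permCast_comm {m n : ℕ} (x : Equiv.Perm (Fin m)) (y : Equiv.Perm (Fin n)) :
    permCast (Nat.add_comm m n) (youngHom m n (x, y)) * blockSwap m n =
      blockSwap m n * youngHom n m (y, x) := by
  have h1 : ∀ j : Fin n, blockSwap m n (Fin.castAdd m j) =
      Fin.cast (Nat.add_comm m n) (Fin.natAdd m j) := fun j => by simp [blockSwap]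
  have h2 : ∀ j : Fin m, blockSwap m n (Fin.natAdd n j) =
      Fin.cast (Nat.add_comm m n) (Fin.castAdd n j) := fun j => by simp [blockSwap]
  refine Equiv.ext fun j => ?_
  rw [Equiv.Perm.mul_apply, Equiv.Perm.mul_apply]
  induction j using Fin.addCases with
  | left j => rw [h1, permCast_cast, youngHom_natAdd, youngHom_castAdd, h1]
  | right j => rw [h2, permCast_cast, youngHom_castAdd, youngHom_natAdd, h2]

variable (k : Type u) [Field k]

/-- The degree `n` part of `K₀(𝒯_k)`, the Grothendieck group of `k[S_n]-mod`. -/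
abbrev K0Deg (n : ℕ) : Type (u + 1) := RepK0 k (Equiv.Perm (Fin n))

variable {k}

/-- The tensor product of `V ∈ k[S_m]-mod` and `W ∈ k[S_n]-mod` in the category `𝒯_k`: the
representation of `S_{m+n}` induced from the representation `V ⊗ W` of `S_m × S_n`. -/
def tensorObj {m n : ℕ} (V : FDRep k (Equiv.Perm (Fin m))) (W : FDRep k (Equiv.Perm (Fin n))) :
    FDRep k (Equiv.Perm (Fin (m + n))) :=
  FDRep.of (indProd (youngHom m n) V.ρ W.ρ)

/-- Transport along an equality of degrees. -/
def castHom {m n : ℕ} (h : m = n) : K0Deg k m →+ K0Deg k n :=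
  h ▸ AddMonoidHom.id _

theorem mk_castHom {m n : ℕ} (h : m = n) (a : K0Deg k m) :
    GradedMonoid.mk (A := K0Deg k) m a = GradedMonoid.mk n (castHom h a) := by
  subst h; rfl

theorem castHom_mk {m n : ℕ} (h : m = n) {V : FDRep k (Equiv.Perm (Fin m))}
    {W : FDRep k (Equiv.Perm (Fin n))}
    (H : ∃ e : V ≃ₗ[k] W, ∀ g v, e (V.ρ g v) = W.ρ (permCast h g) (e v)) :
    castHom h (RepK0.mk V) = RepK0.mk W := by
  obtain ⟨e, he⟩ := H
  subst h
  exact RepK0.mk_eq_of_equiv e he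

theorem castHom_symm {m n : ℕ} (h : m = n) {a : K0Deg k m} {b : K0Deg k n}
    (hab : castHom h a = b) : a = castHom h.symm b := by
  subst h; exact hab

theorem castHom_tensorObj_comm {m n : ℕ} (V : FDRep k (Equiv.Perm (Fin m)))
    (W : FDRep k (Equiv.Perm (Fin n))) :
    castHom (Nat.add_comm m n) (RepK0.mk (tensorObj V W)) = RepK0.mk (tensorObj W V) :=
  castHom_mk _ (exists_commEquiv (youngHom m n) (youngHom n m) (permCast (Nat.add_comm m n))
    (blockSwap m n) V.ρ W.ρ permCast_comm)

theorem castHom_tensorObj_assoc {m n p : ℕ} (U : FDRep k (Equiv.Perm (Fin m)))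
    (V : FDRep k (Equiv.Perm (Fin n))) (W : FDRep k (Equiv.Perm (Fin p))) :
    castHom (Nat.add_assoc m n p) (RepK0.mk (tensorObj (tensorObj U V) W)) =
      RepK0.mk (tensorObj U (tensorObj V W)) :=
  castHom_mk _ (exists_assocEquiv (youngHom m n) (youngHom (m + n) p) (youngHom n p)
    (youngHom m (n + p)) (permCast (Nat.add_assoc m n p)) U.ρ V.ρ W.ρ permCast_assoc)

/-- The unit object of `𝒯_k`, the trivial representation of `S_0`. -/
def unitObj (k : Type u) [Field k] : FDRep k (Equiv.Perm (Fin 0)) :=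
  FDRep.of (Representation.trivial k (Equiv.Perm (Fin 0)) k)

theorem mk_tensorObj_unit {n : ℕ} (V : FDRep k (Equiv.Perm (Fin n))) :
    RepK0.mk (tensorObj V (unitObj k)) = RepK0.mk V := by
  obtain ⟨e, he⟩ := exists_unitEquiv V.ρ (youngHom n 0) (MulEquiv.refl _) (by
    intro x y
    exact Equiv.ext fun j => youngHom_castAdd x y j)
  exact RepK0.mk_eq_of_equiv e he

variable [CharZero k]

theorem mk_tensorObj_left {m n : ℕ} {A B C : FDRep k (Equiv.Perm (Fin m))}
    (W : FDRep k (Equiv.Perm (Fin n)))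
    (i : IntertwiningMap A.ρ B.ρ) (p : IntertwiningMap B.ρ C.ρ) (hi : Function.Injective i)
    (hip : Function.Exact i p) (hp : Function.Surjective p) :
    RepK0.mk (tensorObj B W) = RepK0.mk (tensorObj A W) + RepK0.mk (tensorObj C W) := by
  obtain ⟨r, s, hr, hs, hri, hps, hrs⟩ := exists_splitting i p hi hip hp
  have hig : ∀ g b, i.toLinearMap (A.ρ g b) = B.ρ g (i.toLinearMap b) :=
    fun g b => LinearMap.congr_fun (i.2 g) b
  have hpg : ∀ g b, p.toLinearMap (B.ρ g b) = C.ρ g (p.toLinearMap b) :=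
    fun g b => LinearMap.congr_fun (p.2 g) b
  let φ := youngHom m n
  let I := mapLeft φ A.ρ B.ρ W.ρ i.toLinearMap hig
  let P := mapLeft φ B.ρ C.ρ W.ρ p.toLinearMap hpg
  let R := mapLeft φ B.ρ A.ρ W.ρ r hr
  let S := mapLeft φ C.ρ B.ρ W.ρ s hs
  have hRI : ∀ z, R (I z) = z := by
    intro z
    simp only [R, I, mapLeft_mapLeft]
    convert mapLeft_id φ A.ρ W.ρ z using 2
    congr 1
    exact LinearMap.ext hri
  have hPS : ∀ z, P (S z) = z := by
    intro z
    simp only [P, S, mapLeft_mapLeft]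
    convert mapLeft_id φ C.ρ W.ρ z using 2
    congr 1
    exact LinearMap.ext hps
  have hPI : ∀ z, P (I z) = 0 := by
    intro z
    simp only [P, I, mapLeft_mapLeft]
    convert mapLeft_zero φ A.ρ C.ρ W.ρ z using 2
    congr 1
    exact LinearMap.ext fun a => (hip (i a)).2 ⟨a, rfl⟩
  have hsum : ∀ z, I (R z) + S (P z) = z := by
    intro z
    simp only [P, S, I, R, mapLeft_mapLeft]
    rw [← mapLeft_add]
    convert mapLeft_id φ B.ρ W.ρ z using 2
    congr 1
    exact LinearMap.ext hrs
  refine RepK0.mk_eq_add (A := tensorObj A W) (B := tensorObj B W) (C := tensorObj C W)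
    ⟨I, fun g => LinearMap.ext fun z => mapLeft_equivariant ..⟩
    ⟨P, fun g => LinearMap.ext fun z => mapLeft_equivariant ..⟩
    (Function.LeftInverse.injective hRI) ?_ (Function.RightInverse.surjective hPS)
  intro z
  constructor
  · intro hz
    refine ⟨R z, ?_⟩
    have h := hsum z
    rw [show P z = 0 from hz, map_zero, add_zero] at h
    exact h
  · rintro ⟨y, rfl⟩
    exact hPI y

/-- The multiplication `K₀(k[S_m]-mod) × K₀(k[S_n]-mod) → K₀(k[S_{m+n}]-mod)` induced by the
tensor product of `𝒯_k`. -/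
def mulHom (m n : ℕ) : K0Deg k m →+ K0Deg k n →+ K0Deg k (m + n) :=
  RepK0.lift
    (fun V => RepK0.lift (fun W => RepK0.mk (tensorObj V W)) (by
      intro A B C i p hi hip hp
      simp only [castHom_symm _ (castHom_tensorObj_comm V _)]
      rw [mk_tensorObj_left V i p hi hip hp, map_add]))
    (by
      intro A B C i p hi hip hp
      ext x
      induction x using RepK0.induction with
      | h0 => simp
      | hneg x hx => simp only [map_neg, hx]
      | hadd x y hx hy => simp only [map_add, hx, hy]
      | hmk W =>
        simp only [AddMonoidHom.add_apply, RepK0.lift_mk]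
        exact mk_tensorObj_left W i p hi hip hp)

theorem mulHom_mk {m n : ℕ} (V : FDRep k (Equiv.Perm (Fin m))) (W : FDRep k (Equiv.Perm (Fin n))) :
    mulHom m n (RepK0.mk V) (RepK0.mk W) = RepK0.mk (tensorObj V W) := by
  simp only [mulHom, RepK0.lift_mk]

theorem mulHom_assoc {m n p : ℕ} (a : K0Deg k m) (b : K0Deg k n) (c : K0Deg k p) :
    castHom (Nat.add_assoc m n p) (mulHom (m + n) p (mulHom m n a b) c) =
      mulHom m (n + p) a (mulHom n p b c) := by
  induction a using RepK0.induction with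
  | h0 => simp
  | hneg x hx => simp only [map_neg, AddMonoidHom.neg_apply, hx]
  | hadd x y hx hy => simp only [map_add, AddMonoidHom.add_apply, hx, hy]
  | hmk U =>
    induction b using RepK0.induction with
    | h0 => simp
    | hneg x hx => simp only [map_neg, AddMonoidHom.neg_apply, hx]
    | hadd x y hx hy => simp only [map_add, AddMonoidHom.add_apply, hx, hy]
    | hmk V =>
      induction c using RepK0.induction with
      | h0 => simp
      | hneg x hx => simp only [map_neg, hx]
      | hadd x y hx hy => simp only [map_add, hx, hy]
      | hmk W => simp only [mulHom_mk, castHom_tensorObj_assoc]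

theorem mulHom_comm {m n : ℕ} (a : K0Deg k m) (b : K0Deg k n) :
    castHom (Nat.add_comm m n) (mulHom m n a b) = mulHom n m b a := by
  induction a using RepK0.induction with
  | h0 => simp
  | hneg x hx => simp only [map_neg, AddMonoidHom.neg_apply, hx]
  | hadd x y hx hy => simp only [map_add, AddMonoidHom.add_apply, hx, hy]
  | hmk V =>
    induction b using RepK0.induction with
    | h0 => simp
    | hneg x hx => simp only [map_neg, AddMonoidHom.neg_apply, hx]
    | hadd x y hx hy => simp only [map_add, AddMonoidHom.add_apply, hx, hy]
    | hmk W => simp only [mulHom_mk, castHom_tensorObj_comm]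

theorem mulHom_one {n : ℕ} (a : K0Deg k n) : mulHom n 0 a (RepK0.mk (unitObj k)) = a := by
  induction a using RepK0.induction with
  | h0 => simp
  | hneg x hx => simp only [map_neg, AddMonoidHom.neg_apply, hx]
  | hadd x y hx hy => simp only [map_add, AddMonoidHom.add_apply, hx, hy]
  | hmk V => rw [mulHom_mk, mk_tensorObj_unit]

instance : GradedMonoid.GMul (K0Deg k) where
  mul a b := mulHom _ _ a b

instance : GradedMonoid.GOne (K0Deg k) where
  one := RepK0.mk (unitObj k)

theorem gmul_comm (a b : GradedMonoid (K0Deg k)) : a * b = b * a := by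
  obtain ⟨m, a⟩ := a
  obtain ⟨n, b⟩ := b
  refine (mk_castHom (Nat.add_comm m n) (mulHom m n a b)).trans ?_
  rw [mulHom_comm]
  rfl

theorem gmul_one (a : GradedMonoid (K0Deg k)) : a * 1 = a := by
  obtain ⟨m, a⟩ := a
  exact congrArg (GradedMonoid.mk m) (mulHom_one a)

/-- The graded pieces `K₀(k[S_n]-mod)` form a graded commutative ring. -/
instance : DirectSum.GCommRing (K0Deg k) where
  mul_zero a := map_zero _
  zero_mul b := by
    change mulHom _ _ 0 b = 0
    rw [map_zero, AddMonoidHom.zero_apply]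
  mul_add a b c := map_add _ _ _
  add_mul a b c := by
    change mulHom _ _ (a + b) c = mulHom _ _ a c + mulHom _ _ b c
    rw [map_add, AddMonoidHom.add_apply]
  one_mul a := by rw [gmul_comm, gmul_one]
  mul_one := gmul_one
  mul_assoc := by
    rintro ⟨m, a⟩ ⟨n, b⟩ ⟨p, c⟩
    refine (mk_castHom (Nat.add_assoc m n p) (mulHom (m + n) p (mulHom m n a b) c)).trans ?_
    rw [mulHom_assoc]
    rfl
  natCast n := n • RepK0.mk (unitObj k)
  natCast_zero := zero_smul _ _
  natCast_succ n := succ_nsmul _ _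
  intCast n := n • RepK0.mk (unitObj k)
  intCast_ofNat n := natCast_zsmul _ _
  intCast_negSucc_ofNat n := negSucc_zsmul _ _
  mul_comm := gmul_comm

end Ring

open scoped DirectSum

section Classes

variable (k : Type u) [Field k] [CharZero k]

/-- The Grothendieck ring `K₀(𝒯_k)` of the free tensor category `𝒯_k`, whose objects are the
finitely supported families of objects of `k[S_n]-mod`, `n ≥ 0`: the direct sum of the groups
`K₀(k[S_n]-mod)`, with the multiplication induced by the tensor product `tensorObj`. -/
abbrev TensorK0 : Type (u + 1) := ⨁ n, K0Deg k n

variable {k}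

/-- The class in `K₀(𝒯_k)` of an object of `k[S_n]-mod`. -/
def cls {n : ℕ} (V : FDRep k (Equiv.Perm (Fin n))) : TensorK0 k :=
  DirectSum.of (K0Deg k) n (RepK0.mk V)

variable (k)

/-- The sign representation of `S_n`. -/
def signRep (n : ℕ) : Representation k (Equiv.Perm (Fin n)) k where
  toFun g := ((Equiv.Perm.sign g : ℤ) : k) • LinearMap.id
  map_one' := by simp; rfl
  map_mul' g h := by
    ext
    simp [mul_comm]

/-- The class `x = [X]` of the generator of `𝒯_k`, the trivial representation of `S_1`. -/
def xClass : TensorK0 k := cls (FDRep.of (Representation.trivial k (Equiv.Perm (Fin 1)) k))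

/-- The class `λⁿx = [ΛⁿX]` of the sign representation of `S_n`. -/
def lambdaClass (n : ℕ) : TensorK0 k := cls (FDRep.of (signRep k n))

/-- The set of the classes of the simple objects of `𝒯_k`. A simple object is an irreducible
representation of one of the groups `S_n`. -/
def simpleClasses : Set (TensorK0 k) :=
  {y | ∃ (n : ℕ) (V : FDRep k (Equiv.Perm (Fin n))), IsIrreducible V.ρ ∧ y = cls V}

end Classes

end FreeTensor

end

/-! Write `e_n = λⁿx` and `h_n = [SymⁿX]`. The ring is generated by the `h_n`
(`eq_top_of_trivial_mem`), so it suffices that `f` fixes each of them. The `e_n` and `h_n` are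
treated together, by strong induction on the degree (`map_lambdaClass_and_symClass`).

Let `N = M + 1 ≥ 3`, let `f` fix `e_i` and `h_i` for `i < N`, and put `d = f(e_N) - e_N`. In the
relation `∑ (-1)^a e_a h_b = 0` (`sum_lambdaClass_mul_symClass`) only the two extreme terms can
move, so `f(h_N) = h_N - (-1)^N d`. The products `E = e_M x` and `H = h_M x` are fixed and contain
`e_N` and `h_N`. Positivity therefore puts `f(e_N)` between `0` and `E`, and `f(h_N)` between `0`
and `H`, for the multiplicity of every irreducible representation. On the other hand `e_N` and `H`
have no common constituent, nor have `E` and `h_N`, nor, for `M ≥ 3`, `E` and `H`. This forces `d =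
0` if `N` is even (`eq_zero_of_charPair_cross`) or odd and at least `5`
(`eq_zero_of_charPair_outer`).

For `N = 3` the classes `E` and `H` share one constituent, `E - e_3 = H - h_3`, and `d` could be
this class. Then `f(e_3) = e_2 e_1` and `f(h_3) = h_2 h_1`. The contradiction appears in degree `4`:
dimension divided by `n!` is a ring homomorphism, and by the relation above the dimensions of the
effective classes `f(e_2² - e_4)` and `f(h_2² - h_4)` would add up to `-6` (`not_map_three_eq_mul`).

Generation and disjointness are both read off from characters induced from Young subgroups. The
pairings of sign characters induced from column groups with trivial characters induced from row
groups form a unitriangular integer matrix, and a class function orthogonal to all the former is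
zero. Multiplicities are measured by dimensions of `Hom` spaces, so no classification of the
irreducible representations is needed. -/

noncomputable section

namespace FreeTensor

open Representation
open scoped TensorProduct

/-! ### Characters, `Hom` dimensions and effective classes for a finite group. -/

section Characters

variable {k : Type u} [Field k] {G : Type*} [Group G]

/-- Insert `i r + s p = 1` after `B.ρ g` and use cyclicity of the trace: the two summands have the
traces of `r (B.ρ g) i = A.ρ g` and `p (B.ρ g) s = C.ρ g`. -/
theorem character_eq_add_of_splitting {A B C : FDRep k G} {i : A →ₗ[k] B} {p : B →ₗ[k] C}
    {r : B →ₗ[k] A} {s : C →ₗ[k] B} (hi : ∀ g a, i (A.ρ g a) = B.ρ g (i a))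
    (hs : ∀ g c, s (C.ρ g c) = B.ρ g (s c)) (hri : ∀ a, r (i a) = a) (hps : ∀ c, p (s c) = c)
    (hsum : ∀ b, i (r b) + s (p b) = b) (g : G) :
    B.character g = A.character g + C.character g := by
  have h1 : B.ρ g = (B.ρ g ∘ₗ i) ∘ₗ r + (B.ρ g ∘ₗ s) ∘ₗ p := by
    ext b
    simp only [LinearMap.add_apply, LinearMap.comp_apply]
    rw [← map_add, hsum]
  have h2 : r ∘ₗ B.ρ g ∘ₗ i = A.ρ g := by
    ext a
    simp only [LinearMap.comp_apply]
    rw [← hi, hri]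
  have h3 : p ∘ₗ B.ρ g ∘ₗ s = C.ρ g := by
    ext a
    simp only [LinearMap.comp_apply]
    rw [← hs, hps]
  rw [FDRep.character, FDRep.character, FDRep.character, h1, map_add,
    LinearMap.trace_comp_comm' r, LinearMap.trace_comp_comm' p, h2, h3]

/-- The pairing of functions on a finite group that computes the dimensions of `Hom` spaces of
representations from their characters. -/
def charPair [Fintype G] (φ ψ : G → k) : k := (Nat.card G : k)⁻¹ * ∑ g, ψ g * φ g⁻¹

section
variable [Fintype G] (φ φ' ψ ψ' : G → k)

theorem charPair_comm : charPair φ ψ = charPair ψ φ := by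
  unfold charPair
  congr 1
  rw [← Equiv.sum_comp (Equiv.inv G)]
  simp [mul_comm]

theorem charPair_add_left : charPair (φ + φ') ψ = charPair φ ψ + charPair φ' ψ := by
  simp [charPair, mul_add, Finset.sum_add_distrib]

theorem charPair_add_right : charPair φ (ψ + ψ') = charPair φ ψ + charPair φ ψ' := by
  simp [charPair, mul_add, add_mul, Finset.sum_add_distrib]

theorem charPair_sub_left : charPair (φ - φ') ψ = charPair φ ψ - charPair φ' ψ := by
  simp [charPair, mul_sub, Finset.sum_sub_distrib]

theorem charPair_sub_right : charPair φ (ψ - ψ') = charPair φ ψ - charPair φ ψ' := by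
  simp [charPair, mul_sub, sub_mul, Finset.sum_sub_distrib]

end

variable [CharZero k] [Fintype G]

theorem charPair_character (V W : FDRep k G) :
    charPair V.character W.character = (Module.finrank k (IntertwiningMap V.ρ W.ρ) : k) := by
  have : Invertible (Nat.card G : k) := invertibleOfNonzero (Nat.cast_ne_zero.2 Nat.card_pos.ne')
  exact card_inv_mul_sum_char_mul_char_eq_finrank V.ρ W.ρ

/-- The homomorphism sending the class of a representation to its character. -/
def charHom (k : Type u) [Field k] (G : Type*) [Group G] [CharZero k] [Finite G] :
    RepK0 k G →+ (G → k) :=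
  RepK0.lift (fun V => V.character) (by
    intro A B C i p hi hip hp
    obtain ⟨r, s, hr, hs, hri, hps, hsum⟩ := exists_splitting i p hi hip hp
    funext g
    exact character_eq_add_of_splitting (i := i.toLinearMap) (p := p.toLinearMap)
      (fun g b => LinearMap.congr_fun (i.2 g) b) hs hri hps hsum g)

theorem charHom_mk (V : FDRep k G) : charHom k G (RepK0.mk V) = V.character :=
  RepK0.lift_mk ..

theorem charHom_conj (x : RepK0 k G) (t g : G) :
    charHom k G x (t * g * t⁻¹) = charHom k G x g := by
  induction x using RepK0.induction with
  | h0 => simp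
  | hneg x hx => simp [map_neg, hx]
  | hadd x y hx hy => simp [map_add, hx, hy]
  | hmk V => rw [charHom_mk, FDRep.char_conj]

/-- The dimension of the space of homomorphisms from `U`. -/
def mult (U : FDRep k G) : RepK0 k G →+ ℤ :=
  RepK0.lift (fun V => (Module.finrank k (IntertwiningMap U.ρ V.ρ) : ℤ)) (by
    intro A B C i p hi hip hp
    have h : charHom k G (RepK0.mk B) = charHom k G (RepK0.mk A) + charHom k G (RepK0.mk C) := by
      rw [← map_add, RepK0.mk_eq_add i p hi hip hp]
    simp only [charHom_mk] at h
    have h2 := charPair_add_right U.character A.character C.character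
    rw [← h, charPair_character, charPair_character, charPair_character] at h2
    exact_mod_cast h2)

theorem mult_mk (U V : FDRep k G) :
    mult U (RepK0.mk V) = Module.finrank k (IntertwiningMap U.ρ V.ρ) :=
  RepK0.lift_mk ..

theorem mult_mk_nonneg (U V : FDRep k G) : 0 ≤ mult U (RepK0.mk V) := by
  rw [mult_mk]; positivity

theorem charPair_charHom (U : FDRep k G) (x : RepK0 k G) :
    charPair U.character (charHom k G x) = mult U x := by
  induction x using RepK0.induction with
  | h0 => simp [charPair]
  | hneg x hx => rw [map_neg, map_neg, Int.cast_neg, ← hx]; simp [charPair]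
  | hadd x y hx hy => rw [map_add, map_add, charPair_add_right, hx, hy, Int.cast_add]
  | hmk V => rw [charHom_mk, charPair_character, mult_mk, Int.cast_natCast]

theorem charPair_charHom_isInt (x y : RepK0 k G) :
    ∃ n : ℤ, charPair (charHom k G x) (charHom k G y) = n := by
  induction x using RepK0.induction with
  | h0 => exact ⟨0, by simp [charPair]⟩
  | hneg x hx =>
    obtain ⟨n, hn⟩ := hx
    refine ⟨-n, ?_⟩
    rw [map_neg, Int.cast_neg, ← hn]
    simp [charPair]
  | hadd x y hx hy =>
    obtain ⟨n, hn⟩ := hx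
    obtain ⟨m, hm⟩ := hy
    exact ⟨n + m, by rw [map_add, charPair_add_left, hn, hm, Int.cast_add]⟩
  | hmk V => exact ⟨_, by rw [charHom_mk, charPair_charHom]⟩

theorem mult_mk_comm (U V : FDRep k G) : mult U (RepK0.mk V) = mult V (RepK0.mk U) := by
  have : ((mult U (RepK0.mk V) : ℤ) : k) = (mult V (RepK0.mk U) : ℤ) := by
    rw [← charPair_charHom, ← charPair_charHom, charHom_mk, charHom_mk, charPair_comm]
  exact_mod_cast this

theorem exists_ne_zero_of_mult_ne_zero {U V : FDRep k G} (h : mult U (RepK0.mk V) ≠ 0) :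
    ∃ f : IntertwiningMap U.ρ V.ρ, f ≠ 0 := by
  by_contra! h'
  apply h
  have : Subsingleton (IntertwiningMap U.ρ V.ρ) := ⟨fun f g => (h' f).trans (h' g).symm⟩
  rw [mult_mk, Module.finrank_zero_of_subsingleton, Nat.cast_zero]

theorem mult_ne_zero_of_ne_zero {U V : FDRep k G} {f : IntertwiningMap U.ρ V.ρ} (hf : f ≠ 0) :
    mult U (RepK0.mk V) ≠ 0 := by
  rw [mult_mk, Nat.cast_ne_zero]
  intro h
  exact hf (Module.finrank_zero_iff.1 h |>.elim f 0)

theorem mult_self_pos {V : FDRep k G} (hV : Module.finrank k V ≠ 0) :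
    0 < mult V (RepK0.mk V) := by
  refine (mult_mk_nonneg V V).lt_of_ne' ?_
  refine mult_ne_zero_of_ne_zero (f := IntertwiningMap.id V.ρ) fun h => hV ?_
  have : Subsingleton V := ⟨fun a b => by
    rw [← IntertwiningMap.id_apply V.ρ a, ← IntertwiningMap.id_apply V.ρ b, h]; rfl⟩
  exact Module.finrank_zero_of_subsingleton

omit [CharZero k] [Fintype G] in
theorem mk_eq_zero_of_finrank {V : FDRep k G} (hV : Module.finrank k V = 0) :
    RepK0.mk V = 0 := by
  have : Subsingleton V := Module.finrank_zero_iff.1 hV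
  have h := RepK0.mk_eq_add (A := V) (B := V) (C := V) 0 0 (fun _ _ _ => Subsingleton.elim _ _)
    (fun x => ⟨fun _ => ⟨x, Subsingleton.elim _ _⟩, fun _ => Subsingleton.elim _ _⟩)
    (fun x => ⟨x, Subsingleton.elim _ _⟩)
  simpa using h

/-- By symmetry of `mult` there is also a nonzero map `V → U`. It is onto because `U` is
irreducible, and `C` is its kernel. -/
theorem exists_mk_eq_add_of_mult_ne_zero {U V : FDRep k G} (hU : IsIrreducible U.ρ)
    (h : mult U (RepK0.mk V) ≠ 0) : ∃ C : FDRep k G, RepK0.mk V = RepK0.mk U + RepK0.mk C := by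
  rw [mult_mk_comm] at h
  obtain ⟨f, hf⟩ := exists_ne_zero_of_mult_ne_zero h
  have hs := (IsIrreducible.surjective_or_eq_zero f).resolve_right hf
  refine ⟨FDRep.of f.ker.toRepresentation, ?_⟩
  rw [add_comm]
  exact RepK0.mk_eq_add (A := FDRep.of f.ker.toRepresentation) (B := V) (C := U)
    ⟨f.ker.toSubmodule.subtype, fun g => rfl⟩ f Subtype.val_injective
    (fun x => ⟨fun hx => ⟨⟨x, hx⟩, rfl⟩, by rintro ⟨y, rfl⟩; exact y.2⟩) hs

theorem exists_irreducible_mult_ne_zero {V : FDRep k G} (hV : Module.finrank k V ≠ 0) :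
    ∃ U : FDRep k G, IsIrreducible U.ρ ∧ mult U (RepK0.mk V) ≠ 0 := by
  suffices H : ∀ n, ∀ V : FDRep k G, Module.finrank k V = n → n ≠ 0 → ∃ (U : FDRep k G)
      (f : IntertwiningMap U.ρ V.ρ), IsIrreducible U.ρ ∧ f ≠ 0 ∧ Function.Injective f by
    obtain ⟨U, f, hU, hf, -⟩ := H _ V rfl hV
    exact ⟨U, hU, mult_ne_zero_of_ne_zero hf⟩
  intro n
  induction n using Nat.strong_induction_on with
  | _ n ih =>
  intro V hn hn0
  by_cases hirr : IsIrreducible V.ρ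
  · refine ⟨V, IntertwiningMap.id V.ρ, hirr, fun h => ?_, fun _ _ h => h⟩
    have := mult_self_pos (V := V) (by omega)
    have hs : Subsingleton V := ⟨fun a b => by
      rw [← IntertwiningMap.id_apply V.ρ a, ← IntertwiningMap.id_apply V.ρ b, h]; rfl⟩
    exact hn0 (hn ▸ Module.finrank_zero_of_subsingleton)
  · have hnt : Nontrivial (Subrepresentation V.ρ) := by
      refine ⟨⊥, ⊤, fun h => hn0 ?_⟩
      have h2 : (⊥ : Submodule k V) = ⊤ := congrArg Subrepresentation.toSubmodule h
      rw [← hn, ← finrank_top k V, ← h2, finrank_bot]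
    have : ∃ T : Subrepresentation V.ρ, T ≠ ⊥ ∧ T ≠ ⊤ := by
      by_contra! h
      exact hirr ⟨fun T => or_iff_not_imp_left.2 (h T)⟩
    obtain ⟨T, hT, hT'⟩ := this
    have h1 : Module.finrank k T.toSubmodule < n := by
      rw [← hn]
      exact Submodule.finrank_lt fun h => hT' (Subrepresentation.toSubmodule_injective h)
    have h2 : Module.finrank k T.toSubmodule ≠ 0 := fun h =>
      hT (Subrepresentation.toSubmodule_injective (Submodule.finrank_eq_zero.1 h))
    obtain ⟨U, f, hU, hf, hinj⟩ := ih _ h1 (FDRep.of T.toRepresentation) rfl h2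
    refine ⟨U, (⟨T.toSubmodule.subtype, fun g => rfl⟩ :
      IntertwiningMap T.toRepresentation V.ρ).comp f, hU, fun h => hf ?_, ?_⟩
    · ext x
      exact congrArg (fun f => f x) h
    · exact Subtype.val_injective.comp hinj

theorem finrank_eq_add {V U C : FDRep k G} (h : RepK0.mk V = RepK0.mk U + RepK0.mk C) :
    Module.finrank k V = Module.finrank k U + Module.finrank k C := by
  have := congrFun (congrArg (charHom k G) h) 1
  rw [map_add, Pi.add_apply, charHom_mk, charHom_mk, charHom_mk, FDRep.char_one, FDRep.char_one,
    FDRep.char_one] at this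
  exact_mod_cast this

theorem finrank_ne_zero_of_mult_ne_zero {U V : FDRep k G} (h : mult U (RepK0.mk V) ≠ 0) :
    Module.finrank k U ≠ 0 := by
  intro h0
  have : Subsingleton U := Module.finrank_zero_iff.1 h0
  obtain ⟨f, hf⟩ := exists_ne_zero_of_mult_ne_zero h
  exact hf (DFunLike.ext _ _ fun x => by rw [Subsingleton.elim x 0, map_zero, map_zero])

/-- A class is effective if it is the class of a representation. -/
def IsEffective (x : RepK0 k G) : Prop := ∃ V, x = RepK0.mk V

/-- Irreducible constituents of `W` are peeled off from both sides, by induction on the dimension of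
`W`. The number `mult U` may be a proper multiple of the true multiplicity when `U` has
endomorphisms other than scalars, which does not affect the comparison. -/
theorem isEffective_sub_of_mult_le (V W : FDRep k G)
    (h : ∀ U : FDRep k G, IsIrreducible U.ρ → mult U (RepK0.mk W) ≤ mult U (RepK0.mk V)) :
    IsEffective (RepK0.mk V - RepK0.mk W) := by
  suffices H : ∀ n, ∀ V W : FDRep k G, Module.finrank k W = n → (∀ U : FDRep k G,
      IsIrreducible U.ρ → mult U (RepK0.mk W) ≤ mult U (RepK0.mk V)) →
      IsEffective (RepK0.mk V - RepK0.mk W) from H _ V W rfl h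
  clear h V W
  intro n
  induction n using Nat.strong_induction_on with
  | _ n ih =>
  intro V W hn h
  by_cases hW : Module.finrank k W = 0
  · exact ⟨V, by rw [mk_eq_zero_of_finrank hW, sub_zero]⟩
  obtain ⟨U, hU, hUW⟩ := exists_irreducible_mult_ne_zero hW
  have hUV : mult U (RepK0.mk V) ≠ 0 := by
    have := h U hU
    have := mult_mk_nonneg U W
    omega
  obtain ⟨W', hW'⟩ := exists_mk_eq_add_of_mult_ne_zero hU hUW
  obtain ⟨V', hV'⟩ := exists_mk_eq_add_of_mult_ne_zero hU hUV
  have hd := finrank_eq_add hW'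
  have hU0 := finrank_ne_zero_of_mult_ne_zero hUW
  rw [hV', hW', add_sub_add_left_eq_sub]
  refine ih _ (by omega) V' W' rfl fun U' hU' => ?_
  have := h U' hU'
  rw [hV', hW', map_add, map_add] at this
  omega

omit [CharZero k] [Fintype G] in
theorem IsEffective.add {x y : RepK0 k G} (hx : IsEffective x) (hy : IsEffective y) :
    IsEffective (x + y) := by
  obtain ⟨V, rfl⟩ := hx
  obtain ⟨W, rfl⟩ := hy
  refine ⟨FDRep.of (Representation.prod V.ρ W.ρ), Eq.symm ?_⟩
  refine RepK0.mk_eq_add (A := V) (B := FDRep.of (Representation.prod V.ρ W.ρ)) (C := W)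
    (IntertwiningMap.inl k V.ρ W.ρ) (IntertwiningMap.snd k V.ρ W.ρ) (fun a b h => ?_)
    (fun x => ⟨fun hx => ⟨x.1, Prod.ext rfl hx.symm⟩, ?_⟩) (fun x => ⟨(0, x), rfl⟩)
  · exact congrArg Prod.fst h
  · rintro ⟨y, rfl⟩
    rfl

omit [CharZero k] [Fintype G] in
theorem exists_eq_mk_sub_mk (x : RepK0 k G) :
    ∃ V W : FDRep k G, x = RepK0.mk V - RepK0.mk W := by
  induction x using RepK0.induction with
  | h0 =>
    let Z : FDRep k G := FDRep.of (Representation.trivial k G PUnit.{u + 1})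
    exact ⟨Z, Z, (sub_self _).symm⟩
  | hmk V =>
    let Z : FDRep k G := FDRep.of (Representation.trivial k G PUnit.{u + 1})
    exact ⟨V, Z, by
      rw [mk_eq_zero_of_finrank (V := Z) (Module.finrank_zero_of_subsingleton), sub_zero]⟩
  | hneg x hx =>
    obtain ⟨V, W, rfl⟩ := hx
    exact ⟨W, V, neg_sub _ _⟩
  | hadd x y hx hy =>
    obtain ⟨V, W, rfl⟩ := hx
    obtain ⟨V', W', rfl⟩ := hy
    obtain ⟨A, hA⟩ := IsEffective.add ⟨V, rfl⟩ ⟨V', rfl⟩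
    obtain ⟨B, hB⟩ := IsEffective.add ⟨W, rfl⟩ ⟨W', rfl⟩
    exact ⟨A, B, by rw [← hA, ← hB]; abel⟩

theorem isEffective_of_mult_nonneg {x : RepK0 k G}
    (h : ∀ U : FDRep k G, IsIrreducible U.ρ → 0 ≤ mult U x) : IsEffective x := by
  obtain ⟨V, W, rfl⟩ := exists_eq_mk_sub_mk x
  exact isEffective_sub_of_mult_le V W fun U hU => by
    have := h U hU
    rw [map_sub] at this
    omega

theorem IsEffective.mult_nonneg {x : RepK0 k G} (hx : IsEffective x) (U : FDRep k G) :
    0 ≤ mult U x := by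
  obtain ⟨V, rfl⟩ := hx
  exact mult_mk_nonneg U V

theorem eq_zero_of_mult_eq_zero {x : RepK0 k G}
    (h : ∀ U : FDRep k G, IsIrreducible U.ρ → mult U x = 0) : x = 0 := by
  obtain ⟨V, rfl⟩ := isEffective_of_mult_nonneg fun U hU => (h U hU).ge
  by_contra hV
  obtain ⟨U, hU, hU'⟩ := exists_irreducible_mult_ne_zero (V := V)
    fun h0 => hV (mk_eq_zero_of_finrank h0)
  exact hU' (h U hU)

/-- The pairings with the characters of irreducible representations recover all `mult U x`, and
these determine the class. -/
theorem charHom_injective : Function.Injective (charHom k G) := by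
  rw [injective_iff_map_eq_zero]
  intro x hx
  refine eq_zero_of_mult_eq_zero fun U _ => ?_
  have := charPair_charHom U x
  rw [hx] at this
  simpa [charPair] using this.symm

theorem IsEffective.charPair_nonneg {x y : RepK0 k G} (hx : IsEffective x) (hy : IsEffective y) :
    ∃ n : ℕ, charPair (charHom k G x) (charHom k G y) = n := by
  obtain ⟨V, rfl⟩ := hx
  obtain ⟨W, rfl⟩ := hy
  exact ⟨_, by rw [charHom_mk, charHom_mk, charPair_character]⟩

theorem IsEffective.charPair_self_pos {x : RepK0 k G} (hx : IsEffective x) (h0 : x ≠ 0) :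
    ∃ n : ℕ, charPair (charHom k G x) (charHom k G x) = n ∧ 0 < n := by
  obtain ⟨V, rfl⟩ := hx
  refine ⟨Module.finrank k (IntertwiningMap V.ρ V.ρ), by rw [charHom_mk, charPair_character], ?_⟩
  have := mult_self_pos (V := V) fun h => h0 (mk_eq_zero_of_finrank h)
  rw [mult_mk] at this
  exact_mod_cast this

/-- A common constituent `U` would give a surjection `V → U` and a nonzero map `U → W`. Their
composite is nonzero, while the pairing is the dimension of `Hom(V, W)`. -/
theorem mult_eq_zero_or_of_charPair {x y : RepK0 k G} (hx : IsEffective x) (hy : IsEffective y)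
    (h : charPair (charHom k G x) (charHom k G y) = 0) {U : FDRep k G} (hU : IsIrreducible U.ρ) :
    mult U x = 0 ∨ mult U y = 0 := by
  obtain ⟨V, rfl⟩ := hx
  obtain ⟨W, rfl⟩ := hy
  by_contra! hc
  obtain ⟨hV, hW⟩ := hc
  rw [mult_mk_comm] at hV
  obtain ⟨f, hf⟩ := exists_ne_zero_of_mult_ne_zero hV
  obtain ⟨g, hg⟩ := exists_ne_zero_of_mult_ne_zero hW
  have hf' := (IsIrreducible.surjective_or_eq_zero f).resolve_right hf
  have hgf : g.comp f ≠ 0 := by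
    intro h0
    apply hg
    ext u
    obtain ⟨v, rfl⟩ := hf' u
    exact congrArg (fun F => F v) h0
  have := mult_ne_zero_of_ne_zero hgf
  rw [charHom_mk, charHom_mk, charPair_character] at h
  rw [mult_mk] at this
  exact this (by exact_mod_cast h)

theorem IsEffective.mem_closure {x : RepK0 k G} (hx : IsEffective x) :
    x ∈ AddSubmonoid.closure {y | ∃ U : FDRep k G, IsIrreducible U.ρ ∧ y = RepK0.mk U} := by
  obtain ⟨V, rfl⟩ := hx
  obtain ⟨n, hn⟩ : ∃ n, Module.finrank k V = n := ⟨_, rfl⟩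
  induction n using Nat.strong_induction_on generalizing V with
  | _ n ih =>
  by_cases hV : Module.finrank k V = 0
  · rw [mk_eq_zero_of_finrank hV]
    exact zero_mem _
  obtain ⟨U, hU, hUV⟩ := exists_irreducible_mult_ne_zero hV
  obtain ⟨C, hC⟩ := exists_mk_eq_add_of_mult_ne_zero hU hUV
  have hd := finrank_eq_add hC
  have hU0 := finrank_ne_zero_of_mult_ne_zero hUV
  rw [hC]
  exact add_mem (AddSubmonoid.subset_closure ⟨U, hU, rfl⟩) (ih _ (by omega) C rfl)

end Characters

/-! ### The character of an induced representation. -/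

section InducedCharacter

variable {k G H A : Type*} [Field k] [Group G] [Fintype G] [Group H] (φ : G →* H)
  [AddCommGroup A] [Module k A] (ρ : Representation k G A)

open Classical in
/-- The sum of the operators `ρ g` over the preimages `g` of `h`. -/
def fiberSum (h : H) : A →ₗ[k] A := ∑ g, if φ g = h then ρ g else 0

theorem fiberSum_mul_map (h : H) (g : G) : fiberSum φ ρ (h * φ g) = fiberSum φ ρ h ∘ₗ ρ g := by
  classical
  ext a
  simp only [fiberSum, LinearMap.comp_apply, LinearMap.sum_apply]
  rw [← Equiv.sum_comp (Equiv.mulRight g)]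
  refine Finset.sum_congr rfl fun x _ => ?_
  simp only [Equiv.coe_mulRight, map_mul, mul_left_inj]
  split_ifs <;> simp

/-- The projection of an induced representation to the subspace from which it is induced. -/
def indProj : IndV φ ρ →ₗ[k] A :=
  Coinvariants.lift _
    (TensorProduct.lift <| (Finsupp.lift _ _ _ fun h => fiberSum φ ρ h⁻¹) ∘ₗ
      (MonoidAlgebra.coeffLinearEquiv k).toLinearMap)
    fun g ↦ by
      ext h x
      have := LinearMap.congr_fun (fiberSum_mul_map φ ρ (h⁻¹ * (φ g)⁻¹) g) x
      simp only [inv_mul_cancel_right, LinearMap.comp_apply] at this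
      simp [ofMulAction_single, mul_inv_rev, this]

theorem indProj_ind (h : H) (a : A) :
    indProj φ ρ (ind φ ρ h (IndV.mk φ ρ 1 a)) = fiberSum φ ρ h a := by
  rw [ind_mk]
  simp [indProj]

variable [Fintype H]

/-- On a translate `s · ι(a)` of the inducing subspace, each `g` contributes for exactly one `t`,
namely `s φ(g)⁻¹`, and then contributes `s · ι(a)` itself. Averaging over the whole group replaces a
choice of coset representatives. -/
theorem sum_ind_indProj (z : IndV φ ρ) :
    ∑ t : H, ind φ ρ t (IndV.mk φ ρ 1 (indProj φ ρ (ind φ ρ t⁻¹ z))) =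
      (Nat.card G : k) • z := by
  classical
  induction z using ind_induction with
  | h0 => simp
  | hadd x y hx hy => simp only [map_add, Finset.sum_add_distrib, hx, hy, smul_add]
  | h1 s a =>
    have h2 : ∀ t : H, ind φ ρ t (IndV.mk φ ρ 1 (indProj φ ρ (ind φ ρ t⁻¹
        (ind φ ρ s (IndV.mk φ ρ 1 a))))) =
        ∑ g : G, if φ g = t⁻¹ * s then ind φ ρ s (IndV.mk φ ρ 1 a) else 0 := by
      intro t
      rw [← Module.End.mul_apply (ind φ ρ t⁻¹), ← map_mul, indProj_ind, fiberSum,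
        LinearMap.sum_apply, map_sum, map_sum]
      refine Finset.sum_congr rfl fun g _ => ?_
      split_ifs with hg
      · rw [← ind_mk_one, hg, ← Module.End.mul_apply, ← map_mul, mul_inv_cancel_left]
      · simp
    rw [Finset.sum_congr rfl fun t _ => h2 t, Finset.sum_comm]
    have h3 : ∀ g : G, (∑ t : H, if φ g = t⁻¹ * s then ind φ ρ s (IndV.mk φ ρ 1 a) else 0) =
        ind φ ρ s (IndV.mk φ ρ 1 a) := by
      intro g
      rw [Finset.sum_eq_single (s * (φ g)⁻¹)]
      · simp
      · intro t _ ht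
        refine if_neg fun h => ht ?_
        rw [h]; group
      · simp
    rw [Finset.sum_congr rfl fun g _ => h3 g]
    simp [Nat.card_eq_fintype_card, Nat.cast_smul_eq_nsmul]

/-- By `sum_ind_indProj` the operator factors through `A`, term by term; `tr(XY) = tr(YX)` then
moves the trace to `A`. -/
theorem card_mul_character_ind [DecidableEq H] [Module.Finite k A] (h : H) :
    (Nat.card G : k) * Representation.character (ind φ ρ) h =
      ∑ t : H, ∑ g : G, if φ g = t⁻¹ * h * t then Representation.character ρ g else 0 := by
  have h1 : (Nat.card G : k) • ind φ ρ h =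
      ∑ t : H, (ind φ ρ (h * t) ∘ₗ IndV.mk φ ρ 1) ∘ₗ (indProj φ ρ ∘ₗ ind φ ρ t⁻¹) := by
    refine LinearMap.ext fun z => ?_
    rw [LinearMap.smul_apply, ← map_smul, ← sum_ind_indProj, map_sum, LinearMap.sum_apply]
    refine Finset.sum_congr rfl fun t _ => ?_
    rw [map_mul]
    rfl
  have h2 : ∀ t : H, (indProj φ ρ ∘ₗ ind φ ρ t⁻¹) ∘ₗ (ind φ ρ (h * t) ∘ₗ IndV.mk φ ρ 1) =
      fiberSum φ ρ (t⁻¹ * h * t) := by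
    intro t
    refine LinearMap.ext fun a => ?_
    rw [← indProj_ind, mul_assoc, map_mul _ t⁻¹]
    rfl
  rw [Representation.character, ← smul_eq_mul, ← map_smul, h1, map_sum]
  refine Finset.sum_congr rfl fun t _ => ?_
  rw [LinearMap.trace_comp_comm' (indProj φ ρ ∘ₗ ind φ ρ t⁻¹), h2, fiberSum, map_sum]
  refine Finset.sum_congr rfl fun g _ => ?_
  rw [apply_ite (LinearMap.trace k A), map_zero]
  congr

end InducedCharacter

/-! ### The character of a product in the Grothendieck ring. -/

section ProductCharacter

variable {k : Type u} [Field k] [CharZero k] {m n : ℕ}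

omit [CharZero k] in
theorem character_outer {G H A B : Type*} [Group G] [Group H] [AddCommGroup A] [Module k A]
    [Module.Finite k A] [AddCommGroup B] [Module k B] [Module.Finite k B]
    (ρ : Representation k G A) (σ : Representation k H B) (x : G × H) :
    Representation.character (outer ρ σ) x =
      Representation.character ρ x.1 * Representation.character σ x.2 :=
  LinearMap.trace_tensorProduct' (ρ x.1) (σ x.2)

/-- The character of a product in the Grothendieck ring, scaled by `m! n!`. -/
theorem charHom_mulHom (a : K0Deg k m) (b : K0Deg k n) (g : Equiv.Perm (Fin (m + n))) :
    ((m.factorial * n.factorial : ℕ) : k) * charHom k _ (mulHom m n a b) g =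
      ∑ t : Equiv.Perm (Fin (m + n)), ∑ x : Equiv.Perm (Fin m) × Equiv.Perm (Fin n),
        if youngHom m n x = t⁻¹ * g * t then charHom k _ a x.1 * charHom k _ b x.2 else 0 := by
  induction a using RepK0.induction with
  | h0 => simp
  | hneg x hx =>
    simp only [map_neg, AddMonoidHom.neg_apply, Pi.neg_apply, mul_neg, hx, neg_mul]
    simp only [← Finset.sum_neg_distrib]
    refine Finset.sum_congr rfl fun t _ => Finset.sum_congr rfl fun x _ => ?_
    split_ifs <;> simp
  | hadd x y hx hy =>
    simp only [map_add, AddMonoidHom.add_apply, Pi.add_apply, mul_add, hx, hy, add_mul]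
    simp only [← Finset.sum_add_distrib, ← ite_add_zero]
  | hmk V =>
    induction b using RepK0.induction with
    | h0 => simp
    | hneg x hx =>
      simp only [map_neg, Pi.neg_apply, mul_neg, hx]
      simp only [← Finset.sum_neg_distrib]
      refine Finset.sum_congr rfl fun t _ => Finset.sum_congr rfl fun x _ => ?_
      split_ifs <;> simp
    | hadd x y hx hy =>
      simp only [map_add, Pi.add_apply, mul_add, hx, hy]
      simp only [← Finset.sum_add_distrib, ← ite_add_zero]
    | hmk W =>
      have h := card_mul_character_ind (youngHom m n) (outer V.ρ W.ρ) g
      have hc : Nat.card (Equiv.Perm (Fin m) × Equiv.Perm (Fin n)) =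
          m.factorial * n.factorial := by
        simp [Nat.card_eq_fintype_card, Fintype.card_perm]
      rw [hc] at h
      rw [mulHom_mk, charHom_mk, charHom_mk, charHom_mk]
      refine Eq.trans h ?_
      simp only [character_outer]
      rfl

end ProductCharacter

/-! ### Young subgroups as stabilizers of colorings. -/

section Coloring

variable {N : ℕ} {α : Type*}

/-- The Young subgroup of the permutations that preserve a coloring. -/
def colorStab (c : Fin N → α) : Subgroup (Equiv.Perm (Fin N)) where
  carrier := {s | ∀ i, c (s i) = c i}
  mul_mem' {a b} ha hb i := by rw [Equiv.Perm.mul_apply, ha, hb]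
  one_mem' _ := rfl
  inv_mem' {a} ha i := by rw [← ha (a⁻¹ i), ← Equiv.Perm.mul_apply, mul_inv_cancel]; rfl

theorem mem_colorStab {c : Fin N → α} {s : Equiv.Perm (Fin N)} :
    s ∈ colorStab c ↔ ∀ i, c (s i) = c i := Iff.rfl

theorem colorStab_congr {β : Type*} {c : Fin N → α} {d : Fin N → β}
    (h : ∀ i j, c i = c j ↔ d i = d j) : colorStab c = colorStab d := by
  ext s
  simp only [mem_colorStab, h]

theorem mem_colorStab_comp {c : Fin N → α} {τ s : Equiv.Perm (Fin N)} :
    s ∈ colorStab (c ∘ τ) ↔ τ * s * τ⁻¹ ∈ colorStab c := by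
  simp only [mem_colorStab, Function.comp_apply, Equiv.Perm.mul_apply]
  refine ⟨fun h i => by simpa using h (τ⁻¹ i), fun h i => by simpa using h (τ i)⟩

theorem card_colorStab_comp (c : Fin N → α) (τ : Equiv.Perm (Fin N)) :
    Nat.card (colorStab (c ∘ τ)) = Nat.card (colorStab c) :=
  Nat.card_congr ((MulAut.conj τ).toEquiv.subtypeEquiv fun s => by
    rw [mem_colorStab_comp]; rfl)

theorem youngHom_injective (m n : ℕ) : Function.Injective (youngHom m n) :=
  finSumFinEquiv.permCongrHom.injective.comp Equiv.Perm.sumCongrHom_injective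

theorem sign_youngHom {m n : ℕ} (x : Equiv.Perm (Fin m) × Equiv.Perm (Fin n)) :
    Equiv.Perm.sign (youngHom m n x) = Equiv.Perm.sign x.1 * Equiv.Perm.sign x.2 := by
  have : youngHom m n x = finSumFinEquiv.permCongr (Equiv.Perm.sumCongr x.1 x.2) := rfl
  rw [this, Equiv.Perm.sign_permCongr, Equiv.Perm.sign_sumCongr]

theorem exists_youngHom_eq {m n : ℕ} {w : Equiv.Perm (Fin (m + n))}
    (hw : ∀ i : Fin m, ∃ j : Fin m, w (Fin.castAdd n i) = Fin.castAdd n j) :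
    ∃ x, youngHom m n x = w := by
  have h : Set.MapsTo (finSumFinEquiv.permCongr.symm w)
      (Set.range (Sum.inl : Fin m → Fin m ⊕ Fin n))
      (Set.range Sum.inl) := by
    rintro _ ⟨i, rfl⟩
    obtain ⟨j, hj⟩ := hw i
    refine ⟨j, ?_⟩
    simp [Equiv.permCongr_def, hj]
  obtain ⟨x, hx⟩ := Equiv.Perm.mem_sumCongrHom_range_of_perm_mapsTo_inl h
  refine ⟨x, ?_⟩
  change finSumFinEquiv.permCongr (Equiv.Perm.sumCongrHom _ _ x) = w
  rw [hx, Equiv.apply_symm_apply]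

/-- Since no color occurs in both blocks, a permutation preserving colors preserves each block. -/
theorem colorStab_eq_map {m n : ℕ} {c : Fin (m + n) → α}
    (hc : ∀ i j, c (Fin.castAdd n i) ≠ c (Fin.natAdd m j)) :
    colorStab c = ((colorStab (c ∘ Fin.castAdd n)).prod (colorStab (c ∘ Fin.natAdd m))).map
      (youngHom m n) := by
  ext w
  rw [Subgroup.mem_map]
  constructor
  · intro hw
    obtain ⟨x, rfl⟩ := exists_youngHom_eq (w := w) (by
      intro i
      have := hw (Fin.castAdd n i)
      generalize w (Fin.castAdd n i) = l at this ⊢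
      induction l using Fin.addCases with
      | left j => exact ⟨j, rfl⟩
      | right j => exact absurd this.symm (hc i j))
    refine ⟨x, ⟨fun i => ?_, fun i => ?_⟩, rfl⟩
    · have := hw (Fin.castAdd n i)
      rwa [youngHom_castAdd] at this
    · have := hw (Fin.natAdd m i)
      rwa [youngHom_natAdd] at this
  · rintro ⟨x, ⟨hx1, hx2⟩, rfl⟩ l
    induction l using Fin.addCases with
    | left j => rw [youngHom_castAdd]; exact hx1 j
    | right j => rw [youngHom_natAdd]; exact hx2 j

theorem card_colorStab_eq_mul {m n : ℕ} {c : Fin (m + n) → α}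
    (hc : ∀ i j, c (Fin.castAdd n i) ≠ c (Fin.natAdd m j)) :
    Nat.card (colorStab c) =
      Nat.card (colorStab (c ∘ Fin.castAdd n)) * Nat.card (colorStab (c ∘ Fin.natAdd m)) := by
  rw [colorStab_eq_map hc, ← Nat.card_prod]
  exact Nat.card_congr (((Subgroup.equivMapOfInjective _ _ (youngHom_injective m n)).symm.trans
    (Subgroup.prodEquiv _ _)).toEquiv)

end Coloring

/-! ### Characters induced from Young subgroups; `e = 0` is the trivial and `e = 1` the sign case.
-/

section IndChar

variable (k : Type u) [Field k]

/-- The function `sign ^ e` with values in `k`. -/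
def signPow (e : ℕ) {N : ℕ} (g : Equiv.Perm (Fin N)) : k := ((Equiv.Perm.sign g : ℤ) : k) ^ e

open Classical in
/-- The character of the representation induced from the character `sign ^ e` of the Young subgroup
of a coloring. -/
def indChar (e : ℕ) {N : ℕ} {α : Type*} (c : Fin N → α) (g : Equiv.Perm (Fin N)) : k :=
  signPow k e g * ((Nat.card (colorStab c) : k)⁻¹ *
    ∑ t : Equiv.Perm (Fin N), if t⁻¹ * g * t ∈ colorStab c then 1 else 0)

variable {k} {N : ℕ} {α : Type*}

theorem signPow_mul (e : ℕ) (g h : Equiv.Perm (Fin N)) :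
    signPow k e (g * h) = signPow k e g * signPow k e h := by
  simp [signPow, mul_pow]

theorem signPow_one (e : ℕ) : signPow k e (1 : Equiv.Perm (Fin N)) = 1 := by
  simp [signPow]

theorem signPow_zero (g : Equiv.Perm (Fin N)) : signPow k 0 g = 1 := pow_zero _

theorem signPow_inv (e : ℕ) (g : Equiv.Perm (Fin N)) : signPow k e g⁻¹ = signPow k e g := by
  simp [signPow]

theorem signPow_mul_self (e : ℕ) (g : Equiv.Perm (Fin N)) :
    signPow k e g * signPow k e g = 1 := by
  nth_rw 1 [← signPow_inv, ← signPow_mul, inv_mul_cancel, signPow_one]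

theorem signPow_conj (e : ℕ) (t g : Equiv.Perm (Fin N)) :
    signPow k e (t⁻¹ * g * t) = signPow k e g := by
  rw [signPow_mul, signPow_mul, mul_right_comm, ← signPow_mul, inv_mul_cancel, signPow_one, one_mul]

theorem signPow_youngHom (e : ℕ) {m n : ℕ} (x : Equiv.Perm (Fin m) × Equiv.Perm (Fin n)) :
    signPow k e (youngHom m n x) = signPow k e x.1 * signPow k e x.2 := by
  simp [signPow, sign_youngHom, mul_pow]

theorem indChar_congr (e : ℕ) {β : Type*} {c : Fin N → α} {d : Fin N → β}
    (h : ∀ i j, c i = c j ↔ d i = d j) : indChar k e c = indChar k e d := by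
  funext g
  unfold indChar
  rw [colorStab_congr h]

/-- Rearranging a coloring conjugates its Young subgroup. -/
theorem indChar_comp (e : ℕ) (c : Fin N → α) (τ : Equiv.Perm (Fin N)) :
    indChar k e (c ∘ τ) = indChar k e c := by
  classical
  funext g
  unfold indChar
  rw [card_colorStab_comp]
  congr 2
  refine Eq.trans ?_ (Equiv.sum_comp (Equiv.mulRight τ⁻¹)
    fun t => if t⁻¹ * g * t ∈ colorStab c then (1 : k) else 0)
  refine Finset.sum_congr rfl fun t _ => ?_
  simp only [mem_colorStab_comp, Equiv.coe_mulRight, mul_inv_rev, inv_inv, mul_assoc]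

theorem indChar_const [CharZero k] (e : ℕ) {c : Fin N → α} (hc : ∀ i j, c i = c j) :
    indChar k e c = signPow k e := by
  funext g
  have h : colorStab c = ⊤ := by
    ext s
    simp only [mem_colorStab, Subgroup.mem_top, iff_true]
    exact fun i => hc _ _
  have h0 : (N.factorial : k) ≠ 0 := Nat.cast_ne_zero.2 N.factorial_ne_zero
  unfold indChar
  simp [h, Nat.card_eq_fintype_card, Fintype.card_perm, h0]

variable [CharZero k]

/-- Induction in stages. The inner averages over `y` in `S_m × S_n` are absorbed by the substitution
`t ↦ t y` in the outer sum, so each `y` contributes the same and the factor `m! n!` cancels. -/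
theorem charHom_mulHom_eq_indChar (e : ℕ) {m n : ℕ} {a : K0Deg k m} {b : K0Deg k n}
    {c : Fin (m + n) → α} (hc : ∀ i j, c (Fin.castAdd n i) ≠ c (Fin.natAdd m j))
    (ha : charHom k _ a = indChar k e (c ∘ Fin.castAdd n))
    (hb : charHom k _ b = indChar k e (c ∘ Fin.natAdd m)) :
    charHom k _ (mulHom m n a b) = indChar k e c := by
  classical
  funext g
  have h0 : ((m.factorial * n.factorial : ℕ) : k) ≠ 0 :=
    Nat.cast_ne_zero.2 (mul_ne_zero m.factorial_ne_zero n.factorial_ne_zero)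
  apply mul_left_cancel₀ h0
  rw [charHom_mulHom, ha, hb]
  set S := colorStab c with hS
  set S₁ := colorStab (c ∘ Fin.castAdd n)
  set S₂ := colorStab (c ∘ Fin.natAdd m)
  -- Since `youngHom` is injective, at most one `x` contributes, and it does so exactly when the
  -- conjugate of `w` lies in the product of the two smaller stabilizers.
  have key : ∀ (w : Equiv.Perm (Fin (m + n))) (y : Equiv.Perm (Fin m) × Equiv.Perm (Fin n)),
      (∑ x, if youngHom m n x = w then
        ((if y.1⁻¹ * x.1 * y.1 ∈ S₁ then 1 else 0) * (if y.2⁻¹ * x.2 * y.2 ∈ S₂ then 1 else 0) : k)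
        else 0) = if (youngHom m n y)⁻¹ * w * youngHom m n y ∈ S then 1 else 0 := by
    intro w y
    split_ifs with hw
    · rw [hS, colorStab_eq_map hc, Subgroup.mem_map] at hw
      obtain ⟨z, hz, hzw⟩ := hw
      have hw : w = youngHom m n (y * z * y⁻¹) := by
        rw [map_mul, map_mul, map_inv, hzw]; group
      rw [Finset.sum_eq_single (y * z * y⁻¹), if_pos hw.symm, if_pos, if_pos, mul_one]
      · have h2 : z.2 ∈ S₂ := hz.2
        simpa [mul_assoc] using h2
      · have h1 : z.1 ∈ S₁ := hz.1
        simpa [mul_assoc] using h1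
      · exact fun x _ hx => if_neg fun h => hx (youngHom_injective m n (h.trans hw))
      · simp
    · refine Finset.sum_eq_zero fun x _ => ?_
      split_ifs with h1 h2 h3
      · refine absurd ?_ hw
        rw [hS, colorStab_eq_map hc, Subgroup.mem_map]
        refine ⟨y⁻¹ * x * y, ⟨h2, h3⟩, ?_⟩
        rw [map_mul, map_mul, map_inv, h1]
      all_goals simp
  have h1 : ∀ t : Equiv.Perm (Fin (m + n)),
      (∑ x : Equiv.Perm (Fin m) × Equiv.Perm (Fin n), if youngHom m n x = t⁻¹ * g * t then
        indChar k e (c ∘ Fin.castAdd n) x.1 * indChar k e (c ∘ Fin.natAdd m) x.2 else 0) =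
      signPow k e g * ((Nat.card S : k)⁻¹ * ∑ y : Equiv.Perm (Fin m) × Equiv.Perm (Fin n),
        if (t * youngHom m n y)⁻¹ * g * (t * youngHom m n y) ∈ S then 1 else 0) := by
    intro t
    have h2 : ∀ y : Equiv.Perm (Fin m) × Equiv.Perm (Fin n),
        (t * youngHom m n y)⁻¹ * g * (t * youngHom m n y) =
        (youngHom m n y)⁻¹ * (t⁻¹ * g * t) * youngHom m n y := fun y => by group
    simp only [h2, ← key]
    rw [Finset.sum_comm, Finset.mul_sum, Finset.mul_sum]
    refine Finset.sum_congr rfl fun x _ => ?_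
    by_cases hx : youngHom m n x = t⁻¹ * g * t
    · simp only [if_pos hx]
      rw [← signPow_conj e t g, ← hx, signPow_youngHom, card_colorStab_eq_mul hc,
        Fintype.sum_prod_type]
      have hsum := Finset.sum_mul_sum Finset.univ Finset.univ
        (fun r : Equiv.Perm (Fin m) => if r⁻¹ * x.1 * r ∈ S₁ then (1 : k) else 0)
        (fun r : Equiv.Perm (Fin n) => if r⁻¹ * x.2 * r ∈ S₂ then (1 : k) else 0)
      simp only
      refine Eq.trans ?_ (congrArg (fun z => _ * (_ * z)) hsum)
      simp only [indChar, S₁, S₂]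
      push_cast
      rw [mul_inv]
      ring
    · simp only [if_neg hx]
      simp
  rw [Finset.sum_congr rfl fun t _ => h1 t, ← Finset.mul_sum, ← Finset.mul_sum, Finset.sum_comm]
  have h3 : ∀ y : Equiv.Perm (Fin m) × Equiv.Perm (Fin n),
      (∑ t : Equiv.Perm (Fin (m + n)),
        if (t * youngHom m n y)⁻¹ * g * (t * youngHom m n y) ∈ S then (1 : k) else 0) =
      ∑ t : Equiv.Perm (Fin (m + n)), if t⁻¹ * g * t ∈ S then (1 : k) else 0 := by
    intro y
    exact Equiv.sum_comp (Equiv.mulRight (youngHom m n y))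
      fun t => if t⁻¹ * g * t ∈ S then (1 : k) else 0
  rw [Finset.sum_congr rfl fun y _ => h3 y, Finset.sum_const, Finset.card_univ, Fintype.card_prod,
    Fintype.card_perm, Fintype.card_perm, Fintype.card_fin, Fintype.card_fin, nsmul_eq_mul]
  simp only [indChar]
  ring

theorem of_mul_of {m n : ℕ} (a : K0Deg k m) (b : K0Deg k n) :
    DirectSum.of (K0Deg k) m a * DirectSum.of (K0Deg k) n b =
      DirectSum.of (K0Deg k) (m + n) (mulHom m n a b) :=
  DirectSum.of_mul_of a b

/-- A subring of the Grothendieck ring that contains the classes with characters `sign ^ e` contains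
classes whose characters are induced from the characters `sign ^ e` of all Young subgroups. -/
theorem exists_charHom_eq_indChar (e : ℕ) (R : Subring (TensorK0 k))
    (hR : ∀ n, ∃ a : K0Deg k n, DirectSum.of (K0Deg k) n a ∈ R ∧ charHom k _ a = signPow k e)
    (c : Fin N → α) :
    ∃ a : K0Deg k N, DirectSum.of (K0Deg k) N a ∈ R ∧ charHom k _ a = indChar k e c := by
  classical
  induction N using Nat.strong_induction_on with
  | _ N ih =>
  by_cases hconst : ∀ i j, c i = c j
  · rw [indChar_const e hconst]
    exact hR N
  push Not at hconst
  obtain ⟨i, j, hij⟩ := hconst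
  -- One color class is moved to the first `m` positions by `τ`. Both blocks are nonempty and share
  -- no color, so the induction hypothesis applies to each.
  let s : Finset (Fin N) := {l | c l = c i}
  obtain ⟨m, hm⟩ : ∃ m, s.card = m := ⟨_, rfl⟩
  obtain ⟨n, hn⟩ : ∃ n, sᶜ.card = n := ⟨_, rfl⟩
  have hm0 : 0 < m := hm ▸ Finset.card_pos.2 ⟨i, by simp [s]⟩
  have hn0 : 0 < n := hn ▸ Finset.card_pos.2 ⟨j, by simp [s, hij.symm]⟩
  have hN : N = m + n := by
    rw [← hm, ← hn, Finset.card_add_card_compl, Fintype.card_fin]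
  subst hN
  let τ : Equiv.Perm (Fin (m + n)) := finSumFinEquiv.symm.trans (finSumEquivOfFinset hm hn)
  have hτ1 : ∀ l, τ (Fin.castAdd n l) ∈ s := fun l => by
    simp [τ]
  have hτ2 : ∀ l, τ (Fin.natAdd m l) ∈ sᶜ := fun l => by
    simp only [τ, Equiv.trans_apply, finSumFinEquiv_symm_apply_natAdd, finSumEquivOfFinset_inr]
    exact Finset.orderEmbOfFin_mem _ _ _
  obtain ⟨a, haR, ha⟩ := ih m (by omega) ((c ∘ τ) ∘ Fin.castAdd n)
  obtain ⟨b, hbR, hb⟩ := ih n (by omega) ((c ∘ τ) ∘ Fin.natAdd m)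
  refine ⟨mulHom m n a b, ?_, ?_⟩
  · rw [← of_mul_of]
    exact mul_mem haR hbR
  · rw [← indChar_comp e c τ]
    refine charHom_mulHom_eq_indChar e (fun p q h => ?_) ha hb
    have h1 := hτ1 p
    have h2 := hτ2 q
    simp only [s, Finset.compl_filter, Finset.mem_filter, Finset.mem_univ, true_and] at h1 h2
    exact h2 (h.symm.trans h1)

end IndChar

/-! ### Frobenius reciprocity and Mackey's formula for Young subgroups. -/

section InducedPairing

variable {k : Type u} [Field k] [CharZero k] {N : ℕ} {α β : Type*}

theorem natCast_card_colorStab_ne_zero (c : Fin N → α) : (Nat.card (colorStab c) : k) ≠ 0 :=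
  Nat.cast_ne_zero.2 Nat.card_pos.ne'

open Classical in
/-- Frobenius reciprocity for class functions and Young subgroups. -/
theorem charPair_indChar (e : ℕ) (c : Fin N → α) {χ : Equiv.Perm (Fin N) → k}
    (hχ : ∀ t g, χ (t * g * t⁻¹) = χ g) :
    charPair (indChar k e c) χ = (Nat.card (colorStab c) : k)⁻¹ *
      ∑ s, if s ∈ colorStab c then signPow k e s * χ s else 0 := by
  have h0 : (N.factorial : k) ≠ 0 := Nat.cast_ne_zero.2 N.factorial_ne_zero
  have h1 : ∀ g, χ g * indChar k e c g⁻¹ = (Nat.card (colorStab c) : k)⁻¹ *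
      ∑ t, if t⁻¹ * g * t ∈ colorStab c then signPow k e g * χ g else 0 := by
    intro g
    have h2 : ∀ t : Equiv.Perm (Fin N), t⁻¹ * g⁻¹ * t = (t⁻¹ * g * t)⁻¹ := fun t => by group
    simp only [indChar, h2, inv_mem_iff, signPow_inv]
    rw [mul_left_comm, ← mul_assoc, mul_left_comm, mul_comm (signPow k e g), Finset.mul_sum]
    congr 1
    exact Finset.sum_congr rfl fun t _ => by split_ifs <;> ring
  have h3 : ∀ t : Equiv.Perm (Fin N),
      (∑ g, if t⁻¹ * g * t ∈ colorStab c then signPow k e g * χ g else 0) =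
      ∑ s, if s ∈ colorStab c then signPow k e s * χ s else 0 := by
    intro t
    refine Eq.trans (Finset.sum_congr rfl fun g _ => ?_) (Equiv.sum_comp (MulAut.conj t⁻¹).toEquiv
      fun s => if s ∈ colorStab c then signPow k e s * χ s else 0)
    have h4 : (MulAut.conj t⁻¹).toEquiv g = t⁻¹ * g * t := by simp
    have h5 := hχ t⁻¹ g
    rw [inv_inv] at h5
    rw [h4, signPow_conj, h5]
  unfold charPair
  rw [Finset.sum_congr rfl fun g _ => h1 g, ← Finset.mul_sum, Finset.sum_comm,
    Finset.sum_congr rfl fun t _ => h3 t]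
  rw [Finset.sum_const, Finset.card_univ, Nat.card_eq_fintype_card, Fintype.card_perm,
    Fintype.card_fin, nsmul_eq_mul]
  field_simp

-- If two points have the same color, their transposition lies in the stabilizer, and multiplication
-- by it reverses all signs.
open Classical in
theorem sum_signPow_colorStab (p : Fin N → α) :
    (∑ s, if s ∈ colorStab p then signPow k 1 s else 0) =
      if Function.Injective p then 1 else 0 := by
  split_ifs with hp
  · rw [Finset.sum_eq_single 1]
    · rw [if_pos (one_mem _), signPow_one]
    · intro s _ hs
      refine if_neg fun h => hs (Equiv.ext fun i => hp (h i))
    · simp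
  · obtain ⟨i, j, hij, hne⟩ : ∃ i j, p i = p j ∧ i ≠ j := by
      simpa [Function.Injective] using hp
    have hswap : Equiv.swap i j ∈ colorStab p := by
      intro l
      rw [Equiv.swap_apply_def]
      split_ifs with h1 h2
      · rw [h1, hij]
      · rw [h2, hij]
      · rfl
    have hneg : signPow k 1 (Equiv.swap i j) = -1 := by
      simp [signPow, Equiv.Perm.sign_swap hne]
    rw [← self_eq_neg, ← Finset.sum_neg_distrib]
    refine Eq.trans (Equiv.sum_comp (Equiv.mulLeft (Equiv.swap i j)) _).symm
      (Finset.sum_congr rfl fun s _ => ?_)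
    rw [Equiv.coe_mulLeft, Subgroup.mul_mem_cancel_left _ hswap, signPow_mul, hneg]
    split_ifs <;> simp

omit [CharZero k] in
theorem indChar_conj (e : ℕ) (c : Fin N → α) (t g : Equiv.Perm (Fin N)) :
    indChar k e c (t * g * t⁻¹) = indChar k e c g := by
  classical
  have h1 : signPow k e (t * g * t⁻¹) = signPow k e g := by
    have := signPow_conj (k := k) e t⁻¹ g
    rwa [inv_inv] at this
  unfold indChar
  rw [h1]
  congr 2
  refine Eq.trans ?_ (Equiv.sum_comp (Equiv.mulLeft t⁻¹)
    fun s => if s⁻¹ * g * s ∈ colorStab c then (1 : k) else 0)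
  refine Finset.sum_congr rfl fun s _ => ?_
  simp only [Equiv.coe_mulLeft, mul_inv_rev, inv_inv, mul_assoc]

/-- The pairing of the induced characters of Young subgroups, one of them twisted by the sign,
counts the ways to make the two colorings jointly injective. -/
theorem charPair_indChar_indChar (d : Fin N → β) (c : Fin N → α) :
    charPair (indChar k 1 d) (indChar k 0 c) =
      (Nat.card (colorStab d) : k)⁻¹ * ((Nat.card (colorStab c) : k)⁻¹ *
        Nat.card {t : Equiv.Perm (Fin N) // Function.Injective fun i => (d i, c (t i))}) := by
  classical
  rw [charPair_indChar 1 d (indChar_conj 0 c)]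
  congr 1
  -- The stabilizer of the joint coloring `(d, c ∘ t)` is the intersection of the stabilizer of `d`
  -- with a conjugate of that of `c`. It is again a Young subgroup, so `sum_signPow_colorStab`
  -- evaluates its sign sum.
  have h1 : ∀ s, (if s ∈ colorStab d then signPow k 1 s * indChar k 0 c s else 0) =
      (Nat.card (colorStab c) : k)⁻¹ * ∑ t : Equiv.Perm (Fin N),
        if s ∈ colorStab (fun i => (d i, c (t i))) then signPow k 1 s else 0 := by
    intro s
    rw [← Equiv.sum_comp (Equiv.inv (Equiv.Perm (Fin N)))]
    have h2 : ∀ t : Equiv.Perm (Fin N), s ∈ colorStab (fun i => (d i, c (t⁻¹ i))) ↔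
        s ∈ colorStab d ∧ t⁻¹ * s * t ∈ colorStab c := by
      intro t
      have := mem_colorStab_comp (c := c) (τ := t⁻¹) (s := s)
      rw [inv_inv] at this
      rw [← this]
      simp only [mem_colorStab, Prod.mk.injEq, Function.comp_apply]
      exact forall_and
    simp only [Equiv.inv_apply, h2, indChar, signPow_zero, one_mul]
    split_ifs with hs
    · simp only [hs, true_and]
      rw [mul_left_comm, Finset.mul_sum]
      simp
    · simp [hs]
  rw [Finset.sum_congr rfl fun s _ => h1 s, ← Finset.mul_sum, Finset.sum_comm]
  congr 1
  rw [Nat.card_eq_fintype_card, Fintype.card_subtype, ← Finset.sum_boole]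
  exact Finset.sum_congr rfl fun t _ => (sum_signPow_colorStab _).trans (by congr)

theorem charPair_indChar_indChar_eq_zero {d : Fin N → β} {c : Fin N → α}
    (h : ∀ t : Equiv.Perm (Fin N), ¬ Function.Injective fun i => (d i, c (t i))) :
    charPair (indChar k 1 d) (indChar k 0 c) = 0 := by
  have : IsEmpty {t : Equiv.Perm (Fin N) // Function.Injective fun i => (d i, c (t i))} :=
    ⟨fun t => h t.1 t.2⟩
  rw [charPair_indChar_indChar, Nat.card_eq_zero.2 (Or.inl this), Nat.cast_zero, mul_zero, mul_zero]

end InducedPairing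

/-! ### Young diagrams and unitriangularity of the pairing of column and row characters. -/

section Diagrams

/-- Young diagrams with `N` cells. -/
abbrev DiagramOf (N : ℕ) := {μ : YoungDiagram // μ.card = N}

theorem YoungDiagram.fst_lt_card {μ : YoungDiagram} {x : ℕ × ℕ} (hx : x ∈ μ) :
    x.1 < μ.card := by
  have h1 : x.1 < μ.colLen x.2 := YoungDiagram.mem_iff_lt_colLen.1 hx
  rw [YoungDiagram.colLen_eq_card] at h1
  exact h1.trans_le (Finset.card_le_card (Finset.filter_subset _ _))

theorem YoungDiagram.snd_lt_card {μ : YoungDiagram} {x : ℕ × ℕ} (hx : x ∈ μ) :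
    x.2 < μ.card := by
  have h1 : x.2 < μ.rowLen x.1 := YoungDiagram.mem_iff_lt_rowLen.1 hx
  rw [YoungDiagram.rowLen_eq_card] at h1
  exact h1.trans_le (Finset.card_le_card (Finset.filter_subset _ _))

instance (N : ℕ) : Finite (DiagramOf N) := by
  refine Finite.of_injective (β := ((Finset.range N ×ˢ Finset.range N).powerset : Finset _))
    (fun μ => ⟨μ.1.cells, ?_⟩) fun μ ν h => ?_
  · rw [Finset.mem_powerset]
    intro x hx
    rw [Finset.mem_product, Finset.mem_range, Finset.mem_range, ← μ.2]
    exact ⟨YoungDiagram.fst_lt_card hx, YoungDiagram.snd_lt_card hx⟩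
  · exact Subtype.ext (YoungDiagram.ext (congrArg Subtype.val h))

variable {N : ℕ}

/-- An enumeration of the cells of a Young diagram. -/
def cellEquiv (μ : DiagramOf N) : Fin N ≃ μ.1.cells :=
  (Finset.equivFinOfCardEq μ.2).symm

/-- The row of a cell. -/
def rowColor (μ : DiagramOf N) (i : Fin N) : ℕ := (cellEquiv μ i).1.1

/-- The column of a cell. -/
def colColor (μ : DiagramOf N) (i : Fin N) : ℕ := (cellEquiv μ i).1.2

/-- The sum of the row indices of the cells. -/
def rowSum (μ : DiagramOf N) : ℕ := ∑ i, rowColor μ i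

theorem mem_cells (μ : DiagramOf N) (i : Fin N) : (rowColor μ i, colColor μ i) ∈ μ.1 :=
  (cellEquiv μ i).2

theorem rowColor_colColor_injective (μ : DiagramOf N) :
    Function.Injective fun i => (colColor μ i, rowColor μ i) := by
  intro i j h
  have h1 := congrArg Prod.snd h
  have h2 := congrArg Prod.fst h
  exact (cellEquiv μ).injective (Subtype.ext (Prod.ext h1 h2))

theorem exists_cell (μ : DiagramOf N) {x : ℕ × ℕ} (hx : x ∈ μ.1) :
    ∃ i, rowColor μ i = x.1 ∧ colColor μ i = x.2 := by
  obtain ⟨i, hi⟩ := (cellEquiv μ).surjective ⟨x, hx⟩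
  refine ⟨i, ?_, ?_⟩ <;> simp [rowColor, colColor, hi]

theorem card_filter_rowColor (μ : DiagramOf N) (r : ℕ) :
    (Finset.univ.filter fun i => rowColor μ i = r).card = μ.1.rowLen r := by
  rw [YoungDiagram.rowLen_eq_card]
  refine Finset.card_bij (fun i _ => (rowColor μ i, colColor μ i)) ?_ ?_ ?_
  · intro i hi
    rw [YoungDiagram.mem_row_iff]
    exact ⟨mem_cells μ i, (Finset.mem_filter.1 hi).2⟩
  · intro i _ j _ h
    exact rowColor_colColor_injective μ (Prod.ext (congrArg Prod.snd h) (congrArg Prod.fst h))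
  · intro x hx
    rw [YoungDiagram.mem_row_iff] at hx
    obtain ⟨i, h1, h2⟩ := exists_cell μ hx.1
    exact ⟨i, by simp [h1, hx.2], Prod.ext h1 h2⟩

/-- Move the cells inside their columns to rows `a i`, keeping them distinct. The weight `φ` is
negative exactly on the diagram, so the diagram minimizes the total weight among finite sets of
cells. The column lengths contribute equally before and after, hence only the row indices matter. In
the case of equality no cell of the diagram can be left out, and by cardinality the new set is the
diagram. -/
theorem rowSum_le_of_injective (μ : DiagramOf N) (a : Fin N → ℕ)
    (ha : Function.Injective fun i => (colColor μ i, a i)) :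
    rowSum μ ≤ ∑ i, a i ∧ (rowSum μ = ∑ i, a i → ∀ i, (a i, colColor μ i) ∈ μ.1) := by
  classical
  let φ : ℕ × ℕ → ℤ := fun x => x.1 - μ.1.colLen x.2
  have hφ : ∀ x, x ∈ μ.1 ↔ φ x < 0 := by
    intro x
    have : x ∈ μ.1 ↔ x.1 < μ.1.colLen x.2 := YoungDiagram.mem_iff_lt_colLen
    rw [this]
    simp only [φ]
    omega
  let T : Finset (ℕ × ℕ) := Finset.univ.image fun i => (a i, colColor μ i)
  have hinj : Function.Injective fun i => (a i, colColor μ i) := fun i j h => ha (by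
    simp only [Prod.mk.injEq] at h ⊢
    exact h.symm)
  have hinj' : Function.Injective fun i => (rowColor μ i, colColor μ i) := fun i j h =>
    (cellEquiv μ).injective (Subtype.ext h)
  have hcells : μ.1.cells = Finset.univ.image fun i => (rowColor μ i, colColor μ i) := by
    ext x
    rw [Finset.mem_image]
    refine ⟨fun hx => ?_, ?_⟩
    · obtain ⟨i, h1, h2⟩ := exists_cell μ hx
      exact ⟨i, Finset.mem_univ _, Prod.ext h1 h2⟩
    · rintro ⟨i, -, rfl⟩
      exact mem_cells μ i
  have hT : ∑ x ∈ T, φ x = ((∑ i, a i : ℕ) : ℤ) - ∑ i, (μ.1.colLen (colColor μ i) : ℤ) := by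
    rw [Finset.sum_image fun i _ j _ h => hinj h, Finset.sum_sub_distrib]
    push_cast
    rfl
  have hμ : ∑ x ∈ μ.1.cells, φ x = (rowSum μ : ℤ) - ∑ i, (μ.1.colLen (colColor μ i) : ℤ) := by
    rw [hcells, Finset.sum_image fun i _ j _ h => hinj' h, Finset.sum_sub_distrib, rowSum]
    push_cast
    rfl
  have h1 : ∑ x ∈ μ.1.cells, φ x = ∑ x ∈ μ.1.cells ∩ T, φ x + ∑ x ∈ μ.1.cells \ T, φ x :=
    (Finset.sum_inter_add_sum_sdiff _ _ _).symm
  have h2 : ∑ x ∈ T, φ x = ∑ x ∈ T ∩ μ.1.cells, φ x + ∑ x ∈ T \ μ.1.cells, φ x :=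
    (Finset.sum_inter_add_sum_sdiff _ _ _).symm
  have h3 : 0 ≤ ∑ x ∈ T \ μ.1.cells, φ x := Finset.sum_nonneg fun x hx => by
    have := (hφ x).not.1 (Finset.mem_sdiff.1 hx).2
    omega
  have h4 : ∑ x ∈ μ.1.cells \ T, φ x ≤ 0 := Finset.sum_nonpos fun x hx =>
    ((hφ x).1 (Finset.mem_sdiff.1 hx).1).le
  rw [Finset.inter_comm] at h2
  refine ⟨by omega, fun heq i => ?_⟩
  have h5 : ∑ x ∈ μ.1.cells \ T, φ x = 0 := by omega
  have h6 : μ.1.cells ⊆ T := by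
    intro x hx
    by_contra hxT
    have hlt := Finset.sum_lt_sum (s := μ.1.cells \ T) (f := φ) (g := fun _ => 0)
      (fun y hy => ((hφ y).1 (Finset.mem_sdiff.1 hy).1).le)
      ⟨x, Finset.mem_sdiff.2 ⟨hx, hxT⟩, (hφ x).1 hx⟩
    rw [h5, Finset.sum_const_zero] at hlt
    exact lt_irrefl _ hlt
  have h7 : T.card ≤ μ.1.cells.card := by
    refine Finset.card_image_le.trans ?_
    rw [Finset.card_univ, Fintype.card_fin]
    exact μ.2.ge
  have h8 := Finset.eq_of_subset_of_card_le h6 h7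
  change (a i, colColor μ i) ∈ μ.1.cells
  rw [h8]
  exact Finset.mem_image_of_mem _ (Finset.mem_univ i)

theorem exists_perm_of_forall_mem (μ : DiagramOf N) {a : Fin N → ℕ}
    (ha : Function.Injective fun i => (colColor μ i, a i)) (hmem : ∀ i, (a i, colColor μ i) ∈ μ.1) :
    ∃ r : Equiv.Perm (Fin N), ∀ i, rowColor μ (r i) = a i ∧ colColor μ (r i) = colColor μ i := by
  choose r hr using fun i => exists_cell μ (hmem i)
  have hinj : Function.Injective r := by
    intro i j h
    refine ha (Prod.ext ?_ ?_)
    · exact (hr i).2.symm.trans ((congrArg _ h).trans (hr j).2)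
    · exact (hr i).1.symm.trans ((congrArg _ h).trans (hr j).1)
  exact ⟨Equiv.ofBijective r (Finite.injective_iff_bijective.1 hinj), hr⟩

/-- The source of triangularity. If the row sums were equal, the equality case of
`rowSum_le_of_injective` would match the rows of `μ` with those of `ν`, so all row lengths, hence
the diagrams, would agree. -/
theorem rowSum_lt_of_injective {μ ν : DiagramOf N} (hne : μ ≠ ν) {t : Equiv.Perm (Fin N)}
    (ht : Function.Injective fun i => (colColor μ i, rowColor ν (t i))) :
    rowSum μ < rowSum ν := by
  classical
  obtain ⟨h1, h2⟩ := rowSum_le_of_injective μ (fun i => rowColor ν (t i)) ht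
  have h3 : ∑ i, rowColor ν (t i) = rowSum ν := Equiv.sum_comp t (rowColor ν)
  rw [h3] at h1 h2
  refine lt_of_le_of_ne h1 fun heq => hne ?_
  obtain ⟨r, hr⟩ := exists_perm_of_forall_mem μ ht (h2 heq)
  have h4 : ∀ l, μ.1.rowLen l = ν.1.rowLen l := by
    intro l
    rw [← card_filter_rowColor, ← card_filter_rowColor]
    refine Finset.card_equiv (r.symm.trans t) fun i => ?_
    have := (hr (r.symm i)).1
    rw [Equiv.apply_symm_apply] at this
    simp [this]
  refine Subtype.ext (YoungDiagram.ext (Finset.ext fun x => ?_))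
  rw [YoungDiagram.mem_cells, YoungDiagram.mem_cells]
  exact YoungDiagram.mem_iff_lt_rowLen.trans
    (Iff.trans (by rw [h4 x.1]) YoungDiagram.mem_iff_lt_rowLen.symm)

/-- Such a `t` is uniquely a row permutation times a column permutation: existence is the equality
case of `rowSum_le_of_injective`, and uniqueness holds because a cell is determined by its row and
column. This gives the diagonal entries `1` of the pairing matrix. -/
theorem card_injective_rowColor (μ : DiagramOf N) :
    Nat.card {t : Equiv.Perm (Fin N) //
      Function.Injective fun i => (colColor μ i, rowColor μ (t i))} =
      Nat.card (colorStab (rowColor μ)) * Nat.card (colorStab (colColor μ)) := by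
  rw [← Nat.card_prod]
  symm
  refine Nat.card_congr (Equiv.ofBijective (fun x => ⟨x.1.1 * x.2.1, ?_⟩) ⟨?_, ?_⟩)
  · have h1 : ∀ i, (colColor μ i, rowColor μ ((x.1.1 * x.2.1) i)) =
        (colColor μ (x.2.1 i), rowColor μ (x.2.1 i)) := fun i => by
      rw [Equiv.Perm.mul_apply, x.1.2, x.2.2]
    simp only [h1]
    exact (rowColor_colColor_injective μ).comp x.2.1.injective
  · rintro ⟨a, b⟩ ⟨a', b'⟩ h
    have h1 : a.1 * b.1 = a'.1 * b'.1 := congrArg Subtype.val h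
    have h2 : b.1 = b'.1 := by
      refine Equiv.ext fun i => rowColor_colColor_injective μ (Prod.ext ?_ ?_)
      · exact (b.2 i).trans (b'.2 i).symm
      · have h3 := a.2 (b.1 i)
        have h4 := a'.2 (b'.1 i)
        rw [← Equiv.Perm.mul_apply] at h3 h4
        rw [← h1] at h4
        exact h3.symm.trans h4
    have h3 : a.1 = a'.1 := by
      rw [h2] at h1
      exact mul_right_cancel h1
    exact Prod.ext (Subtype.ext h3) (Subtype.ext h2)
  · rintro ⟨t, ht⟩
    obtain ⟨h1, h2⟩ := rowSum_le_of_injective μ (fun i => rowColor μ (t i)) ht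
    obtain ⟨r, hr⟩ := exists_perm_of_forall_mem μ ht (h2 (Equiv.sum_comp t (rowColor μ)).symm)
    refine ⟨(⟨t * r⁻¹, fun i => ?_⟩, ⟨r, fun i => (hr i).2⟩), Subtype.ext ?_⟩
    · have h3 := (hr (r⁻¹ i)).1
      rw [← Equiv.Perm.mul_apply, mul_inv_cancel] at h3
      exact h3.symm
    · exact inv_mul_cancel_right _ _

variable {k : Type u} [Field k] [CharZero k]

theorem charPair_diagram_self (μ : DiagramOf N) :
    charPair (indChar k 1 (colColor μ)) (indChar k 0 (rowColor μ)) = 1 := by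
  rw [charPair_indChar_indChar, card_injective_rowColor, Nat.cast_mul]
  have h1 := natCast_card_colorStab_ne_zero (k := k) (rowColor μ)
  have h2 := natCast_card_colorStab_ne_zero (k := k) (colColor μ)
  field_simp

theorem charPair_diagram_eq_zero {μ ν : DiagramOf N} (hne : μ ≠ ν) (h : rowSum ν ≤ rowSum μ) :
    charPair (indChar k 1 (colColor μ)) (indChar k 0 (rowColor ν)) = 0 := by
  refine charPair_indChar_indChar_eq_zero fun t ht => ?_
  exact (rowSum_lt_of_injective hne ht).not_ge h

end Diagrams

/-! ### Conjugacy of permutations in terms of their orbits. -/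

section Orbits

variable {α : Type*} [Fintype α] [DecidableEq α]

theorem mem_support_iff_exists_sameCycle {f : Equiv.Perm α} {x : α} :
    x ∈ f.support ↔ ∃ y, y ≠ x ∧ f.SameCycle x y := by
  rw [Equiv.Perm.mem_support]
  constructor
  · exact fun h => ⟨f x, h, Equiv.Perm.sameCycle_apply_right.2 (Equiv.Perm.SameCycle.refl f x)⟩
  · rintro ⟨y, hne, hy⟩ h
    exact hne (hy.eq_of_left h).symm

theorem image_support_cycleFactorsFinset (f : Equiv.Perm α) :
    f.cycleFactorsFinset.image Equiv.Perm.support =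
      f.support.image fun x => Finset.univ.filter fun y => f.SameCycle x y := by
  have key : ∀ x ∈ f.support, (f.cycleOf x).support =
      Finset.univ.filter fun y => f.SameCycle x y := by
    intro x hx
    ext y
    rw [Equiv.Perm.mem_support_cycleOf_iff, Finset.mem_filter]
    simp [hx]
  ext S
  simp only [Finset.mem_image]
  constructor
  · rintro ⟨c, hc, rfl⟩
    have hcyc := (Equiv.Perm.mem_cycleFactorsFinset_iff.1 hc).1
    obtain ⟨x, hx⟩ := hcyc.nonempty_support
    have hxf := Equiv.Perm.mem_cycleFactorsFinset_support_le hc hx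
    exact ⟨x, hxf, by rw [← key x hxf, ← Equiv.Perm.cycle_is_cycleOf hx hc]⟩
  · rintro ⟨x, hx, rfl⟩
    exact ⟨f.cycleOf x, Equiv.Perm.cycleOf_mem_cycleFactorsFinset_iff.2 hx, key x hx⟩

theorem cycleType_eq_map_image (f : Equiv.Perm α) :
    f.cycleType = (f.cycleFactorsFinset.image Equiv.Perm.support).val.map Finset.card := by
  have hinj : Set.InjOn Equiv.Perm.support (f.cycleFactorsFinset : Set (Equiv.Perm α)) := by
    intro c hc c' hc' h
    have hcyc := (Equiv.Perm.mem_cycleFactorsFinset_iff.1 hc).1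
    obtain ⟨x, hx⟩ := hcyc.nonempty_support
    rw [Equiv.Perm.cycle_is_cycleOf hx hc, Equiv.Perm.cycle_is_cycleOf (h ▸ hx) hc']
  rw [Finset.image_val_of_injOn hinj, Multiset.map_map, Equiv.Perm.cycleType_def]

/-- The cycle type lists the sizes of the nontrivial orbits. -/
theorem isConj_of_sameCycle_iff {f g : Equiv.Perm α}
    (h : ∀ x y, f.SameCycle x y ↔ g.SameCycle x y) : IsConj f g := by
  rw [Equiv.Perm.isConj_iff_cycleType_eq, cycleType_eq_map_image, cycleType_eq_map_image,
    image_support_cycleFactorsFinset, image_support_cycleFactorsFinset]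
  have hs : f.support = g.support := by
    ext x
    simp only [mem_support_iff_exists_sameCycle, h]
  simp only [hs, h]

/-- The number of orbits of a permutation. -/
def orbitCount (f : Equiv.Perm α) : ℕ := Nat.card (Quotient (Equiv.Perm.SameCycle.setoid f))

omit [DecidableEq α] in
theorem orbitCount_le (f : Equiv.Perm α) : orbitCount f ≤ Fintype.card α := by
  rw [← Nat.card_eq_fintype_card]
  exact Nat.card_le_card_of_surjective _ Quotient.mk_surjective

omit [Fintype α] [DecidableEq α] in
theorem sameCycle_of_forall {f g : Equiv.Perm α} (h : ∀ x, g.SameCycle (f x) x) {x y : α}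
    (hxy : f.SameCycle x y) : g.SameCycle x y := by
  have hpow : ∀ (n : ℕ) (x : α), g.SameCycle x ((f ^ n) x) := by
    intro n
    induction n with
    | zero => exact fun x => Equiv.Perm.SameCycle.refl g x
    | succ n ih =>
      intro x
      rw [pow_succ, Equiv.Perm.mul_apply]
      exact (h x).symm.trans (ih (f x))
  obtain ⟨n, hn⟩ := hxy
  rcases n with n | n
  · rw [← hn]
    exact hpow n x
  · rw [← hn]
    refine Equiv.Perm.SameCycle.symm ?_
    have := hpow (n + 1) ((f ^ Int.negSucc n) x)
    rwa [← Equiv.Perm.mul_apply, zpow_negSucc, mul_inv_cancel, Equiv.Perm.one_apply] at this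

/-- The orbits of `f` refine those of `g`; if there are not more of them, the two partitions
coincide. -/
theorem isConj_of_orbitCount_le {f g : Equiv.Perm α} (h : ∀ x, g.SameCycle (f x) x)
    (hle : orbitCount f ≤ orbitCount g) : IsConj f g := by
  refine isConj_of_sameCycle_iff fun x y => ⟨sameCycle_of_forall h, fun hxy => ?_⟩
  let q : Quotient (Equiv.Perm.SameCycle.setoid f) → Quotient (Equiv.Perm.SameCycle.setoid g) :=
    Quotient.map id fun _ _ hab => sameCycle_of_forall h hab
  have hq : Function.Surjective q := by
    intro z
    obtain ⟨z, rfl⟩ := Quotient.mk_surjective z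
    exact ⟨Quotient.mk _ z, rfl⟩
  have hcard : Nat.card (Quotient (Equiv.Perm.SameCycle.setoid f)) =
      Nat.card (Quotient (Equiv.Perm.SameCycle.setoid g)) :=
    le_antisymm hle (Nat.card_le_card_of_surjective q hq)
  have hb : Function.Bijective q := (Nat.bijective_iff_surjective_and_card q).2 ⟨hq, hcard⟩
  exact Quotient.exact (hb.1 (Quotient.sound hxy : q (Quotient.mk _ x) = q (Quotient.mk _ y)))

end Orbits

/-! ### The classes of trivial representations generate the Grothendieck ring. -/

section Generation

variable {k : Type u} [Field k] [CharZero k] {N : ℕ}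

/-- Color the points by the orbits of `g`. An element of the resulting Young subgroup either has
more orbits than `g`, where `χ` vanishes by induction, or is conjugate to `g`. The orthogonality
relation thus reduces to a positive multiple of `± χ g`. -/
theorem classFunction_eq_zero {χ : Equiv.Perm (Fin N) → k} (hχ : ∀ t g, χ (t * g * t⁻¹) = χ g)
    (h : ∀ d : Fin N → Fin N, charPair (indChar k 1 d) χ = 0) : χ = 0 := by
  classical
  suffices H : ∀ n, ∀ g : Equiv.Perm (Fin N), N - orbitCount g = n → χ g = 0 from
    funext fun g => H _ g rfl
  intro n
  induction n using Nat.strong_induction_on with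
  | _ n ih =>
  intro g hg
  let d : Fin N → Fin N := fun i => (Quotient.mk (Equiv.Perm.SameCycle.setoid g) i).out
  have hd : ∀ i j, d i = d j ↔ g.SameCycle i j := by
    intro i j
    refine ⟨fun h => Quotient.exact (s := Equiv.Perm.SameCycle.setoid g) (Quotient.out_injective h),
      fun h => congrArg Quotient.out (Quotient.sound (s := Equiv.Perm.SameCycle.setoid g) h)⟩
  have h1 := h d
  rw [charPair_indChar 1 d hχ, mul_eq_zero, or_iff_right
    (inv_ne_zero (natCast_card_colorStab_ne_zero d))] at h1
  have h2 : ∀ s : Equiv.Perm (Fin N), (if s ∈ colorStab d then signPow k 1 s * χ s else 0) =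
      if s ∈ colorStab d ∧ orbitCount s ≤ orbitCount g then signPow k 1 g * χ g else 0 := by
    intro s
    by_cases hs : s ∈ colorStab d
    · simp only [hs, true_and, if_true]
      have hs' : ∀ x, g.SameCycle (s x) x := fun x => (hd _ _).1 (hs x)
      split_ifs with hle
      · obtain ⟨t, ht⟩ := isConj_iff.1 (isConj_of_orbitCount_le hs' hle)
        rw [← ht, hχ]
        have := signPow_conj (k := k) 1 t⁻¹ s
        rw [inv_inv] at this
        rw [this]
      · have h3 := orbitCount_le s
        rw [Fintype.card_fin] at h3
        rw [ih (N - orbitCount s) (by omega) s rfl, mul_zero]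
    · simp [hs]
  rw [Finset.sum_congr rfl fun s _ => h2 s, ← Finset.sum_filter, Finset.sum_const, nsmul_eq_mul,
    mul_eq_zero, Nat.cast_eq_zero, Finset.card_eq_zero] at h1
  rcases h1 with h1 | h1
  · refine absurd h1 (Finset.Nonempty.ne_empty ⟨g, ?_⟩)
    rw [Finset.mem_filter]
    refine ⟨Finset.mem_univ _, fun i => (hd _ _).2 ?_, le_rfl⟩
    exact Equiv.Perm.sameCycle_apply_left.2 (Equiv.Perm.SameCycle.refl g i)
  · refine (mul_eq_zero.1 h1).resolve_left fun h3 => ?_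
    have := signPow_mul_self (k := k) 1 g
    rw [h3, zero_mul] at this
    exact zero_ne_one this

/-- Sort the colors by decreasing number of points; the column lengths of the diagram are these
numbers. -/
theorem exists_diagram_of_coloring (d : Fin N → Fin N) :
    ∃ (μ : DiagramOf N) (σ : Equiv.Perm (Fin N)),
      ∀ i j, d (σ i) = d (σ j) ↔ colColor μ i = colColor μ j := by
  classical
  let cnt : Fin N → ℕ := fun j => Fintype.card {x // d x = j}
  let κ : Equiv.Perm (Fin N) := Tuple.sort fun j => OrderDual.toDual (cnt j)
  have hκ : ∀ i j, i ≤ j → cnt (κ j) ≤ cnt (κ i) := fun i j hij =>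
    Tuple.monotone_sort (fun j => OrderDual.toDual (cnt j)) hij
  have hcnt : ∀ j, Fintype.card {x // κ.symm (d x) = j} = cnt (κ j) := fun j =>
    Fintype.card_congr (Equiv.subtypeEquivRight fun x => Equiv.symm_apply_eq κ)
  have hcntN : ∀ j, cnt j ≤ N := fun j => by
    simpa using Fintype.card_subtype_le fun x => d x = j
  let μ : YoungDiagram :=
    { cells := (Finset.range N ×ˢ Finset.range N).filter
        fun x => ∃ h : x.2 < N, x.1 < cnt (κ ⟨x.2, h⟩)
      isLowerSet := by
        intro x y hyx hx
        rw [Finset.mem_coe, Finset.mem_filter] at hx ⊢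
        obtain ⟨hx1, hx2, hx3⟩ := hx
        have h1 : y.1 ≤ x.1 := hyx.1
        have h2 : y.2 ≤ x.2 := hyx.2
        rw [Finset.mem_product, Finset.mem_range, Finset.mem_range] at hx1 ⊢
        refine ⟨⟨by omega, by omega⟩, by omega, ?_⟩
        have := hκ ⟨y.2, by omega⟩ ⟨x.2, hx2⟩ h2
        omega }
  have hμ : ∀ x, x ∈ μ.cells ↔ ∃ h : x.2 < N, x.1 < cnt (κ ⟨x.2, h⟩) := by
    intro x
    rw [Finset.mem_filter, Finset.mem_product, Finset.mem_range, Finset.mem_range]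
    refine ⟨fun h => h.2, fun h => ⟨⟨?_, h.1⟩, h⟩⟩
    obtain ⟨h1, h2⟩ := h
    exact h2.trans_le (hcntN _)
  let E₁ : Fin N ≃ Σ j, {x // κ.symm (d x) = j} :=
    (Equiv.sigmaFiberEquiv fun x => κ.symm (d x)).symm
  let E₂ : (Σ j, {x // κ.symm (d x) = j}) ≃ Σ j, Fin (cnt (κ j)) :=
    Equiv.sigmaCongrRight fun j => Fintype.equivFinOfCardEq (hcnt j)
  let E₃ : (Σ j, Fin (cnt (κ j))) ≃ μ.cells :=
    { toFun := fun x => ⟨(x.2, x.1), (hμ _).2 ⟨x.1.2, x.2.2⟩⟩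
      invFun := fun x => ⟨⟨x.1.2, ((hμ _).1 x.2).1⟩, ⟨x.1.1, ((hμ _).1 x.2).2⟩⟩
      left_inv := fun _ => rfl
      right_inv := fun _ => rfl }
  let E : Fin N ≃ μ.cells := (E₁.trans E₂).trans E₃
  have hcard : μ.card = N := by
    have := Fintype.card_congr E
    rw [Fintype.card_fin, Fintype.card_coe] at this
    exact this.symm
  refine ⟨⟨μ, hcard⟩, (cellEquiv ⟨μ, hcard⟩).trans E.symm, fun i j => ?_⟩
  have h1 : ∀ i, colColor ⟨μ, hcard⟩ i =
      (κ.symm (d ((cellEquiv ⟨μ, hcard⟩).trans E.symm i)) : ℕ) := by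
    exact fun i => congrArg (fun z => z.1.2) (E.apply_symm_apply (cellEquiv ⟨μ, hcard⟩ i)).symm
  rw [h1, h1, Fin.val_inj, κ.symm.injective.eq_iff]

theorem classFunction_eq_zero_of_diagram {χ : Equiv.Perm (Fin N) → k}
    (hχ : ∀ t g, χ (t * g * t⁻¹) = χ g)
    (h : ∀ μ : DiagramOf N, charPair (indChar k 1 (colColor μ)) χ = 0) : χ = 0 := by
  refine classFunction_eq_zero hχ fun d => ?_
  obtain ⟨μ, σ, hσ⟩ := exists_diagram_of_coloring d
  rw [← indChar_comp 1 d σ, indChar_congr 1 (c := d ∘ σ) (d := colColor μ) hσ]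
  exact h μ

theorem charHom_mk_trivial (n : ℕ) :
    charHom k _ (RepK0.mk (FDRep.of (Representation.trivial k (Equiv.Perm (Fin n)) k))) =
      signPow k 0 := by
  funext g
  rw [charHom_mk, signPow_zero]
  refine (LinearMap.trace_id k k).trans ?_
  simp

theorem charHom_mk_signRep (n : ℕ) :
    charHom k _ (RepK0.mk (FDRep.of (signRep k n))) = signPow k 1 := by
  funext g
  rw [charHom_mk, signPow, pow_one]
  have : (FDRep.of (signRep k n)).character g =
    LinearMap.trace k k (((Equiv.Perm.sign g : ℤ) : k) • LinearMap.id) := rfl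
  rw [this, map_smul, LinearMap.trace_id]
  simp

/-- Pairing with a fixed function, on the Grothendieck group. -/
def pairHom (φ : Equiv.Perm (Fin N) → k) : K0Deg k N →+ k :=
  AddMonoidHom.mk' (fun x => charPair φ (charHom k _ x)) fun x y => by
    rw [map_add, charPair_add_right]

theorem pairHom_apply (φ : Equiv.Perm (Fin N) → k) (x : K0Deg k N) :
    pairHom φ x = charPair φ (charHom k _ x) := rfl

/-- The Grothendieck ring is generated by the classes of the trivial representations. -/
theorem eq_top_of_trivial_mem (R : Subring (TensorK0 k))
    (hR : ∀ n, DirectSum.of (K0Deg k) n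
      (RepK0.mk (FDRep.of (Representation.trivial k (Equiv.Perm (Fin n)) k))) ∈ R) : R = ⊤ := by
  classical
  rw [eq_top_iff]
  rintro x -
  induction x using DirectSum.induction_on with
  | zero => exact zero_mem _
  | add x y hx hy => exact add_mem hx hy
  | of N a =>
  -- The classes `e μ` are not required to lie in `R`; they only show that the pairings with column
  -- characters are integers.
  choose e _ he using fun μ : DiagramOf N => exists_charHom_eq_indChar 1 (⊤ : Subring (TensorK0 k))
    (fun n => ⟨_, Subring.mem_top _, charHom_mk_signRep n⟩) (colColor μ)
  choose h hhR hh using fun μ : DiagramOf N => exists_charHom_eq_indChar 0 R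
    (fun n => ⟨_, hR n, charHom_mk_trivial n⟩) (rowColor μ)
  have : Fintype (DiagramOf N) := Fintype.ofFinite _
  obtain ⟨B, hB⟩ : ∃ B, ∀ μ : DiagramOf N, rowSum μ < B :=
    ⟨(∑ μ : DiagramOf N, rowSum μ) + 1, fun μ => Nat.lt_succ_of_le
      (Finset.single_le_sum (f := rowSum) (fun _ _ => Nat.zero_le _) (Finset.mem_univ μ))⟩
  -- The class `a` is corrected from the largest row sums downwards. Within a layer of constant row
  -- sum the pairing matrix is the identity, and the `h ν` of that layer are orthogonal to the
  -- column characters of larger row sum, so earlier corrections survive.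
  have key : ∀ M, ∃ l : K0Deg k N, DirectSum.of (K0Deg k) N l ∈ R ∧ ∀ μ, B ≤ rowSum μ + M →
      pairHom (indChar k 1 (colColor μ)) (a - l) = 0 := by
    intro M
    induction M with
    | zero => exact ⟨0, by rw [map_zero]; exact zero_mem _, fun μ hμ => absurd hμ (hB μ).not_ge⟩
    | succ M ih =>
      obtain ⟨l, hlR, hl⟩ := ih
      choose n hn using fun μ => charPair_charHom_isInt (e μ) (a - l)
      refine ⟨l + ∑ μ with rowSum μ + (M + 1) = B, n μ • h μ, ?_, fun μ hμ => ?_⟩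
      · rw [map_add, map_sum]
        refine add_mem hlR (sum_mem fun μ _ => ?_)
        rw [map_zsmul]
        exact zsmul_mem (hhR μ) _
      · have hz : ∀ ν, rowSum ν + (M + 1) = B → μ ≠ ν →
            pairHom (indChar k 1 (colColor μ)) (n ν • h ν) = 0 := by
          intro ν hν hne
          rw [map_zsmul, pairHom_apply, hh, charPair_diagram_eq_zero hne (by omega), smul_zero]
        rw [← sub_sub, map_sub, map_sum]
        by_cases hM : rowSum μ + (M + 1) = B
        · rw [Finset.sum_eq_single_of_mem μ (by simp [hM])
            fun ν hν hne => hz ν (Finset.mem_filter.1 hν).2 hne.symm, map_zsmul, pairHom_apply,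
            pairHom_apply, hh, charPair_diagram_self, ← he, hn]
          simp
        · rw [hl μ (by omega), Finset.sum_eq_zero, sub_zero]
          intro ν hν
          have hν := (Finset.mem_filter.1 hν).2
          exact hz ν hν fun heq => hM (heq ▸ hν)
  obtain ⟨l, hlR, hl⟩ := key B
  have h0 : charHom k _ (a - l) = 0 :=
    classFunction_eq_zero_of_diagram (charHom_conj _) fun μ => hl μ (Nat.le_add_left _ _)
  have h1 : a - l = 0 := charHom_injective (h0.trans (map_zero _).symm)
  rw [sub_eq_zero.1 h1]
  exact hlR

end Generation

/-! ### A sign-reversing involution on the stable subsets of a permutation. -/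

section Toggle

variable {α : Type*} [Fintype α] [DecidableEq α]

/-- `w` agrees with `g` on `A` and fixes all other points. -/
def IsPartOn (g : Equiv.Perm α) (A : Finset α) (w : Equiv.Perm α) : Prop :=
  (∀ i ∈ A, w i = g i) ∧ ∀ i ∉ A, w i = i

omit [Fintype α] [DecidableEq α] in
theorem IsPartOn.unique {g w w' : Equiv.Perm α} {A : Finset α} (h : IsPartOn g A w)
    (h' : IsPartOn g A w') : w = w' := by
  refine Equiv.ext fun i => ?_
  by_cases hi : i ∈ A
  · rw [h.1 i hi, h'.1 i hi]
  · rw [h.2 i hi, h'.2 i hi]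

omit [Fintype α] [DecidableEq α] in
theorem IsPartOn.apply_mem {g w : Equiv.Perm α} {A : Finset α} (h : IsPartOn g A w) {i : α}
    (hi : i ∈ A) : g i ∈ A := by
  by_contra hgi
  have h1 := h.2 _ hgi
  rw [← h.1 i hi] at h1
  have h2 := w.injective h1
  rw [← h.1 i hi, h2] at hgi
  exact hgi hi

omit [DecidableEq α] in
theorem IsPartOn.mem_of_sameCycle {g w : Equiv.Perm α} {A : Finset α} (h : IsPartOn g A w)
    {i j : α} (hi : i ∈ A) (hij : g.SameCycle i j) : j ∈ A := by
  obtain ⟨n, -, rfl⟩ := hij.exists_pow_eq'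
  clear hij
  induction n with
  | zero => exact hi
  | succ n ih =>
    rw [pow_succ', Equiv.Perm.mul_apply]
    exact h.apply_mem ih

/-- The orbit of a point. -/
def orbitFinset (g : Equiv.Perm α) (x : α) : Finset α := Finset.univ.filter fun y => g.SameCycle x y

theorem mem_orbitFinset {g : Equiv.Perm α} {x y : α} : y ∈ orbitFinset g x ↔ g.SameCycle x y := by
  simp [orbitFinset]

theorem self_mem_orbitFinset (g : Equiv.Perm α) (x : α) : x ∈ orbitFinset g x :=
  mem_orbitFinset.2 (Equiv.Perm.SameCycle.refl g x)

theorem isPartOn_cycleOf (g : Equiv.Perm α) (x : α) :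
    IsPartOn g (orbitFinset g x) (g.cycleOf x) :=
  ⟨fun _ hy => (mem_orbitFinset.1 hy).cycleOf_apply,
    fun _ hy => Equiv.Perm.cycleOf_apply_of_not_sameCycle (mem_orbitFinset.not.1 hy)⟩

/-- A cycle of length `l` has sign `(-1)^(l-1)`; a fixed point is the case `l = 1`. -/
theorem sign_cycleOf_mul (g : Equiv.Perm α) (x : α) :
    (Equiv.Perm.sign (g.cycleOf x) : ℤ) * (-1) ^ (orbitFinset g x).card = -1 := by
  by_cases hx : g x = x
  · have h1 : orbitFinset g x = {x} := by
      ext y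
      rw [mem_orbitFinset, Finset.mem_singleton]
      exact ⟨fun h => (h.eq_of_left hx).symm, fun h => h ▸ Equiv.Perm.SameCycle.refl g _⟩
    rw [h1, (Equiv.Perm.cycleOf_eq_one_iff g).2 hx]
    simp
  · have h1 : orbitFinset g x = (g.cycleOf x).support := by
      ext y
      rw [mem_orbitFinset, Equiv.Perm.mem_support_cycleOf_iff, Equiv.Perm.mem_support]
      simp [hx]
    rw [h1, (Equiv.Perm.isCycle_cycleOf g hx).sign]
    push_cast
    rw [neg_mul, ← pow_add, ← two_mul, pow_mul]
    simp

open Classical in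
/-- Adding or removing the orbit of `x`. -/
def toggle (g : Equiv.Perm α) (x : α) (p : Finset α × Equiv.Perm α) : Finset α × Equiv.Perm α :=
  if x ∈ p.1 then (p.1 \ orbitFinset g x, p.2 * (g.cycleOf x)⁻¹)
  else (p.1 ∪ orbitFinset g x, p.2 * g.cycleOf x)

theorem cycleOf_mem_orbitFinset {g : Equiv.Perm α} {x y : α} (hy : y ∈ orbitFinset g x) :
    (g.cycleOf x) y ∈ orbitFinset g x := by
  rw [(isPartOn_cycleOf g x).1 y hy]
  exact (isPartOn_cycleOf g x).apply_mem hy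

theorem cycleOf_inv_mem_orbitFinset {g : Equiv.Perm α} {x y : α} (hy : y ∈ orbitFinset g x) :
    (g.cycleOf x)⁻¹ y ∈ orbitFinset g x := by
  by_contra h
  have h1 := (isPartOn_cycleOf g x).2 _ h
  rw [← Equiv.Perm.mul_apply, mul_inv_cancel, Equiv.Perm.one_apply] at h1
  exact h (h1 ▸ hy)

theorem cycleOf_inv_apply_of_notMem {g : Equiv.Perm α} {x y : α} (hy : y ∉ orbitFinset g x) :
    (g.cycleOf x)⁻¹ y = y := by
  rw [Equiv.Perm.inv_eq_iff_eq]
  exact ((isPartOn_cycleOf g x).2 y hy).symm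

theorem IsPartOn.orbit_subset {g w : Equiv.Perm α} {A : Finset α} (h : IsPartOn g A w) {x : α}
    (hx : x ∈ A) : orbitFinset g x ⊆ A :=
  fun _ hy => h.mem_of_sameCycle hx (mem_orbitFinset.1 hy)

theorem IsPartOn.orbit_disjoint {g w : Equiv.Perm α} {A : Finset α} (h : IsPartOn g A w) {x : α}
    (hx : x ∉ A) : Disjoint A (orbitFinset g x) :=
  Finset.disjoint_left.2 fun _ hy hy' =>
    hx (h.mem_of_sameCycle hy (mem_orbitFinset.1 hy').symm)

theorem isPartOn_toggle {g : Equiv.Perm α} (x : α) {p : Finset α × Equiv.Perm α}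
    (h : IsPartOn g p.1 p.2) : IsPartOn g (toggle g x p).1 (toggle g x p).2 := by
  obtain ⟨A, w⟩ := p
  unfold toggle
  split_ifs with hx
  · have hsub := h.orbit_subset hx
    refine ⟨fun i hi => ?_, fun i hi => ?_⟩
    · rw [Finset.mem_sdiff] at hi
      rw [Equiv.Perm.mul_apply, cycleOf_inv_apply_of_notMem hi.2, h.1 i hi.1]
    · rw [Equiv.Perm.mul_apply]
      by_cases hO : i ∈ orbitFinset g x
      · have h1 := cycleOf_inv_mem_orbitFinset hO
        rw [h.1 _ (hsub h1), ← (isPartOn_cycleOf g x).1 _ h1, ← Equiv.Perm.mul_apply,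
          mul_inv_cancel, Equiv.Perm.one_apply]
      · rw [cycleOf_inv_apply_of_notMem hO]
        refine h.2 i fun hA => hi (Finset.mem_sdiff.2 ⟨hA, hO⟩)
  · have hdis := h.orbit_disjoint hx
    refine ⟨fun i hi => ?_, fun i hi => ?_⟩
    · rw [Equiv.Perm.mul_apply]
      rcases Finset.mem_union.1 hi with hA | hO
      · rw [(isPartOn_cycleOf g x).2 i (Finset.disjoint_left.1 hdis hA), h.1 i hA]
      · rw [h.2 _ (Finset.disjoint_right.1 hdis (cycleOf_mem_orbitFinset hO)),
          (isPartOn_cycleOf g x).1 i hO]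
    · rw [Finset.mem_union, not_or] at hi
      rw [Equiv.Perm.mul_apply, (isPartOn_cycleOf g x).2 i hi.2, h.2 i hi.1]

theorem mem_toggle_fst {g : Equiv.Perm α} (x : α) (p : Finset α × Equiv.Perm α) :
    x ∈ (toggle g x p).1 ↔ x ∉ p.1 := by
  unfold toggle
  split_ifs with hx <;> simp [hx, self_mem_orbitFinset]

theorem toggle_toggle {g : Equiv.Perm α} (x : α) {p : Finset α × Equiv.Perm α}
    (h : IsPartOn g p.1 p.2) : toggle g x (toggle g x p) = p := by
  by_cases hx : x ∈ p.1
  · rw [toggle, if_neg (by rw [mem_toggle_fst]; exact not_not.2 hx), toggle, if_pos hx]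
    exact Prod.ext (Finset.sdiff_union_of_subset (h.orbit_subset hx)) (inv_mul_cancel_right _ _)
  · rw [toggle, if_pos ((mem_toggle_fst x p).2 hx), toggle, if_neg hx]
    exact Prod.ext (Finset.union_sdiff_cancel_right (h.orbit_disjoint hx))
      (mul_inv_cancel_right _ _)

theorem sign_toggle {g : Equiv.Perm α} (x : α) {p : Finset α × Equiv.Perm α}
    (h : IsPartOn g p.1 p.2) :
    (Equiv.Perm.sign (toggle g x p).2 : ℤ) * (-1) ^ (toggle g x p).1.card =
      -((Equiv.Perm.sign p.2 : ℤ) * (-1) ^ p.1.card) := by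
  have h1 := sign_cycleOf_mul g x
  unfold toggle
  split_ifs with hx
  · have h2 := Finset.card_sdiff_add_card_eq_card (h.orbit_subset hx)
    rw [← h2, pow_add]
    simp only [Equiv.Perm.sign_mul, Equiv.Perm.sign_inv, Units.val_mul]
    have h3 : (Equiv.Perm.sign (g.cycleOf x) : ℤ) * Equiv.Perm.sign (g.cycleOf x) = 1 := by
      rw [← Units.val_mul, Int.units_mul_self, Units.val_one]
    linear_combination (Equiv.Perm.sign p.2 : ℤ) * (-1) ^ (p.1 \ orbitFinset g x).card *
      (Equiv.Perm.sign (g.cycleOf x) * h1 - (-1) ^ (orbitFinset g x).card * h3)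
  · simp only [Finset.card_union_of_disjoint (h.orbit_disjoint hx), pow_add, Equiv.Perm.sign_mul,
      Units.val_mul]
    linear_combination (Equiv.Perm.sign p.2 : ℤ) * (-1) ^ p.1.card * h1

-- Fix a point `x`. Adding its orbit to a stable subset, or removing it, is an involution without
-- fixed points, and by `sign_cycleOf_mul` it reverses the sign of the summand.
open Classical in
theorem sum_sign_isPartOn [Nonempty α] (g : Equiv.Perm α) :
    ∑ A : Finset α, ∑ w, (if IsPartOn g A w then
      (Equiv.Perm.sign w : ℤ) * (-1) ^ A.card else 0) = 0 := by
  obtain ⟨x⟩ := ‹Nonempty α›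
  rw [← Fintype.sum_prod_type', ← Finset.sum_filter]
  refine Finset.sum_involution (fun p _ => toggle g x p) ?_ ?_ ?_ ?_
  · intro p hp
    rw [sign_toggle x (Finset.mem_filter.1 hp).2, add_neg_cancel]
  · intro p _ _ heq
    have := mem_toggle_fst (g := g) x p
    rw [heq] at this
    tauto
  · intro p hp
    rw [Finset.mem_filter] at hp ⊢
    exact ⟨Finset.mem_univ _, isPartOn_toggle x hp.2⟩
  · exact fun p hp => toggle_toggle x (Finset.mem_filter.1 hp).2

end Toggle

/-! ### The alternating relation between exterior and symmetric powers. -/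

section Koszul

variable {k : Type u} [Field k] [CharZero k]

/-- The block of the first `m` points. -/
def firstBlock (m n : ℕ) : Finset (Fin (m + n)) := Finset.univ.map (Fin.castAddEmb n)

theorem castAdd_mem_firstBlock {m n : ℕ} (i : Fin m) : Fin.castAdd n i ∈ firstBlock m n :=
  Finset.mem_map_of_mem _ (Finset.mem_univ i)

theorem mem_firstBlock_iff {m n : ℕ} {l : Fin (m + n)} :
    l ∈ firstBlock m n ↔ ∃ i, l = Fin.castAdd n i := by
  refine ⟨fun h => ?_, ?_⟩
  · obtain ⟨i, -, hi⟩ := Finset.mem_map.1 h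
    exact ⟨i, hi.symm⟩
  · rintro ⟨i, rfl⟩
    exact castAdd_mem_firstBlock i

theorem card_firstBlock (m n : ℕ) : (firstBlock m n).card = m := by
  rw [firstBlock, Finset.card_map, Finset.card_univ, Fintype.card_fin]

theorem isPartOn_youngHom {m n : ℕ} (x : Equiv.Perm (Fin m) × Equiv.Perm (Fin n)) :
    IsPartOn (youngHom m n x) (firstBlock m n) (youngHom m n (x.1, 1)) := by
  refine ⟨fun i hi => ?_, fun i hi => ?_⟩
  · obtain ⟨i, rfl⟩ := mem_firstBlock_iff.1 hi
    rw [youngHom_castAdd, youngHom_castAdd x.1 x.2]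
  · induction i using Fin.addCases with
    | left i => exact absurd (castAdd_mem_firstBlock i) hi
    | right j => rw [youngHom_natAdd, Equiv.Perm.one_apply]

open Classical in
/-- The sign of the restriction of `g` to a stable subset, and `0` if the subset is not stable. -/
def partSign {N : ℕ} (g : Equiv.Perm (Fin N)) (A : Finset (Fin N)) : ℤ :=
  ∑ w, if IsPartOn g A w then (Equiv.Perm.sign w : ℤ) else 0

theorem partSign_eq_of_isPartOn {N : ℕ} {g w : Equiv.Perm (Fin N)} {A : Finset (Fin N)}
    (h : IsPartOn g A w) : partSign g A = Equiv.Perm.sign w := by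
  classical
  rw [partSign, Finset.sum_eq_single w, if_pos h]
  · exact fun w' _ hw' => if_neg fun h' => hw' (h'.unique h)
  · simp

/-- There is a preimage exactly when `y` stabilizes the first block; it is unique, and its first
component is the restriction of `y`. -/
theorem sum_youngHom_eq_partSign {m n : ℕ} (y : Equiv.Perm (Fin (m + n))) :
    (∑ x : Equiv.Perm (Fin m) × Equiv.Perm (Fin n),
      if youngHom m n x = y then (Equiv.Perm.sign x.1 : ℤ) else 0) =
      partSign y (firstBlock m n) := by
  classical
  by_cases hy : ∃ x, youngHom m n x = y
  · obtain ⟨x, rfl⟩ := hy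
    rw [partSign_eq_of_isPartOn (isPartOn_youngHom x), Finset.sum_eq_single x, if_pos rfl,
      sign_youngHom]
    · simp
    · exact fun x' _ hx' => if_neg fun h => hx' (youngHom_injective m n h)
    · simp
  · rw [partSign, Finset.sum_eq_zero, Finset.sum_eq_zero]
    · intro w _
      refine if_neg fun h => hy (exists_youngHom_eq fun i => ?_)
      exact mem_firstBlock_iff.1 (h.apply_mem (castAdd_mem_firstBlock i))
    · exact fun x _ => if_neg fun h => hy ⟨x, h⟩

theorem partSign_conj {N : ℕ} (g t : Equiv.Perm (Fin N)) (A : Finset (Fin N)) :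
    partSign (t⁻¹ * g * t) A = partSign g (A.map t.toEmbedding) := by
  classical
  have key : ∀ w, IsPartOn (t⁻¹ * g * t) A w ↔ IsPartOn g (A.map t.toEmbedding) (t * w * t⁻¹) := by
    intro w
    unfold IsPartOn
    rw [← t.forall_congr_right (q := fun i => i ∈ A.map t.toEmbedding → (t * w * t⁻¹) i = g i),
      ← t.forall_congr_right (q := fun i => i ∉ A.map t.toEmbedding → (t * w * t⁻¹) i = i)]
    simp [Equiv.eq_symm_apply, Equiv.Perm.inv_def]
  unfold partSign
  refine Eq.trans ?_ (Equiv.sum_comp (MulAut.conj t).toEquiv _)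
  refine Finset.sum_congr rfl fun w _ => ?_
  have h1 : (MulAut.conj t).toEquiv w = t * w * t⁻¹ := rfl
  have h2 : Equiv.Perm.sign (t * w * t⁻¹) = Equiv.Perm.sign w := by
    rw [Equiv.Perm.sign_mul, Equiv.Perm.sign_mul, Equiv.Perm.sign_inv, mul_right_comm,
      Int.units_mul_self, one_mul]
  simp only [h1, h2, key]

/-- These permutations form a left coset `τ (S_m × S_n)`. -/
theorem card_filter_map_firstBlock {m n : ℕ} {A : Finset (Fin (m + n))} (hA : A.card = m) :
    (Finset.univ.filter fun t : Equiv.Perm (Fin (m + n)) =>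
      (firstBlock m n).map t.toEmbedding = A).card = m.factorial * n.factorial := by
  classical
  have hA' : Aᶜ.card = n := by
    rw [Finset.card_compl, hA, Fintype.card_fin]; omega
  let τ : Equiv.Perm (Fin (m + n)) := finSumFinEquiv.symm.trans (finSumEquivOfFinset hA hA')
  have hτ : ∀ l, τ (Fin.castAdd n l) ∈ A := fun l => by simp [τ]
  have hτA : (firstBlock m n).map τ.toEmbedding = A := by
    refine Finset.eq_of_subset_of_card_le (fun l hl => ?_) ?_
    · obtain ⟨i, hi, rfl⟩ := Finset.mem_map.1 hl
      obtain ⟨i, rfl⟩ := mem_firstBlock_iff.1 hi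
      exact hτ i
    · rw [Finset.card_map, card_firstBlock, hA]
  have hcard : m.factorial * n.factorial =
      (Finset.univ : Finset (Equiv.Perm (Fin m) × Equiv.Perm (Fin n))).card := by
    rw [Finset.card_univ, Fintype.card_prod, Fintype.card_perm, Fintype.card_perm,
      Fintype.card_fin, Fintype.card_fin]
  rw [hcard]
  symm
  refine Finset.card_bij (fun x _ => τ * youngHom m n x) ?_ ?_ ?_
  · intro x _
    rw [Finset.mem_filter]
    refine ⟨Finset.mem_univ _, Finset.eq_of_subset_of_card_le (fun l hl => ?_) ?_⟩
    · obtain ⟨i, hi, rfl⟩ := Finset.mem_map.1 hl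
      obtain ⟨i, rfl⟩ := mem_firstBlock_iff.1 hi
      change (τ * youngHom m n (x.1, x.2)) (Fin.castAdd n i) ∈ A
      rw [Equiv.Perm.mul_apply, youngHom_castAdd]
      exact hτ _
    · rw [Finset.card_map, card_firstBlock, hA]
  · intro x _ x' _ h
    exact youngHom_injective m n (mul_left_cancel h)
  · intro t ht
    rw [Finset.mem_filter] at ht
    obtain ⟨x, hx⟩ := exists_youngHom_eq (w := τ⁻¹ * t) (fun i => by
      rw [← mem_firstBlock_iff]
      have h1 : t (Fin.castAdd n i) ∈ A := by
        rw [← ht.2]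
        exact Finset.mem_map_of_mem t.toEmbedding (castAdd_mem_firstBlock i)
      rw [← hτA] at h1
      obtain ⟨j, hj, hjt⟩ := Finset.mem_map.1 h1
      have h2 : (τ⁻¹ * t) (Fin.castAdd n i) = j := by
        rw [Equiv.Perm.mul_apply, Equiv.Perm.inv_eq_iff_eq]
        exact hjt.symm
      rwa [h2])
    exact ⟨x, Finset.mem_univ _, by rw [hx, mul_inv_cancel_left]⟩

/-- In the induced character formula, group the permutations `t` by the image of the first block.
Every `m`-element subset occurs `m! n!` times, which cancels the scaling. -/
theorem charHom_mulHom_sign_trivial {m n : ℕ} {a : K0Deg k m} {b : K0Deg k n}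
    (ha : charHom k _ a = signPow k 1) (hb : charHom k _ b = signPow k 0)
    (g : Equiv.Perm (Fin (m + n))) :
    charHom k _ (mulHom m n a b) g =
      ((∑ A ∈ Finset.powersetCard m Finset.univ, partSign g A : ℤ) : k) := by
  classical
  have h0 : ((m.factorial * n.factorial : ℕ) : k) ≠ 0 :=
    Nat.cast_ne_zero.2 (mul_ne_zero m.factorial_ne_zero n.factorial_ne_zero)
  apply mul_left_cancel₀ h0
  have h1 : ∀ t : Equiv.Perm (Fin (m + n)),
      (∑ x : Equiv.Perm (Fin m) × Equiv.Perm (Fin n), if youngHom m n x = t⁻¹ * g * t then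
        charHom k _ a x.1 * charHom k _ b x.2 else 0) =
      ((partSign g ((firstBlock m n).map t.toEmbedding) : ℤ) : k) := by
    intro t
    rw [← partSign_conj, ← sum_youngHom_eq_partSign, Int.cast_sum]
    refine Finset.sum_congr rfl fun x _ => ?_
    rw [ha, hb, signPow_zero, mul_one, signPow, pow_one]
    split_ifs <;> simp
  rw [charHom_mulHom, Finset.sum_congr rfl fun t _ => h1 t, ← Int.cast_sum]
  rw [← Finset.sum_fiberwise_of_maps_to (s := Finset.univ)
    (t := Finset.powersetCard m (Finset.univ : Finset (Fin (m + n))))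
    (g := fun t : Equiv.Perm (Fin (m + n)) => (firstBlock m n).map t.toEmbedding)
    (fun t _ => by
      rw [Finset.mem_powersetCard, Finset.card_map, card_firstBlock]
      exact ⟨Finset.subset_univ _, rfl⟩)]
  rw [← Int.cast_natCast, ← Int.cast_mul, Finset.mul_sum]
  congr 1
  refine Finset.sum_congr rfl fun A hA => ?_
  rw [Finset.sum_congr rfl fun t ht => by rw [(Finset.mem_filter.1 ht).2], Finset.sum_const,
    card_filter_map_firstBlock (Finset.mem_powersetCard.1 hA).2, nsmul_eq_mul]

/-- The class `[SymⁿX]` of the trivial representation of `S_n`. -/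
def symClass (k : Type u) [Field k] [CharZero k] (n : ℕ) : TensorK0 k :=
  cls (FDRep.of (Representation.trivial k (Equiv.Perm (Fin n)) k))

/-- The relation `∑ (-1)^a λ^a x · [Sym^b X] = 0` over `a + b = N`, for `N > 0`. -/
theorem sum_lambdaClass_mul_symClass {N : ℕ} (hN : 0 < N) :
    ∑ p ∈ Finset.HasAntidiagonal.antidiagonal N,
      ((-1 : ℤ) ^ p.1) • (lambdaClass k p.1 * symClass k p.2) = 0 := by
  classical
  -- The products live in degrees `p.1 + p.2`, which equal `N` only propositionally. Naming
  -- representatives `x p` in degree `N` lets their characters be added.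
  have h1 : ∀ p : ℕ × ℕ, ∃ x : K0Deg k N, p ∈ Finset.HasAntidiagonal.antidiagonal N →
      (lambdaClass k p.1 * symClass k p.2 = DirectSum.of (K0Deg k) N x ∧ ∀ g,
        charHom k _ x g = ((∑ A ∈ Finset.powersetCard p.1 Finset.univ, partSign g A : ℤ) : k)) := by
    rintro ⟨a, b⟩
    by_cases h : (a, b) ∈ Finset.HasAntidiagonal.antidiagonal N
    · obtain rfl : a + b = N := Finset.HasAntidiagonal.mem_antidiagonal.1 h
      exact ⟨mulHom a b _ _, fun _ => ⟨of_mul_of _ _,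
        charHom_mulHom_sign_trivial (charHom_mk_signRep a) (charHom_mk_trivial b)⟩⟩
    · exact ⟨0, fun h' => absurd h' h⟩
  choose x hx using h1
  have h2 : ∑ p ∈ Finset.HasAntidiagonal.antidiagonal N, ((-1 : ℤ) ^ p.1) • x p = 0 := by
    apply charHom_injective
    rw [map_sum, map_zero]
    funext g
    rw [Finset.sum_apply, Pi.zero_apply]
    have h3 : ∀ p ∈ Finset.HasAntidiagonal.antidiagonal N, charHom k _ (((-1 : ℤ) ^ p.1) • x p) g =
        ((∑ A ∈ Finset.powersetCard p.1 Finset.univ, (-1) ^ A.card * partSign g A : ℤ) : k) := by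
      intro p hp
      rw [map_zsmul, Pi.smul_apply, (hx p hp).2, zsmul_eq_mul, ← Int.cast_mul, Finset.mul_sum]
      congr 1
      refine Finset.sum_congr rfl fun A hA => ?_
      rw [(Finset.mem_powersetCard.1 hA).2]
    rw [Finset.sum_congr rfl h3, ← Int.cast_sum, Finset.Nat.sum_antidiagonal_eq_sum_range_succ_mk]
    -- Summing over all sizes of `A` gives the sum over all subsets, which `sum_sign_isPartOn`
    -- annihilates; this is where `N > 0` is needed.
    have h4 := Finset.sum_powerset (Finset.univ : Finset (Fin N))
      fun A => (-1) ^ A.card * partSign g A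
    rw [Finset.card_univ, Fintype.card_fin] at h4
    rw [← h4, Finset.powerset_univ]
    have : Nonempty (Fin N) := ⟨⟨0, hN⟩⟩
    have h5 := sum_sign_isPartOn g
    rw [Int.cast_eq_zero, ← h5]
    refine Finset.sum_congr rfl fun A _ => ?_
    rw [partSign, Finset.mul_sum]
    refine Finset.sum_congr rfl fun w _ => ?_
    split_ifs
    · ring
    · ring
  have h6 : ∀ p ∈ Finset.HasAntidiagonal.antidiagonal N,
      ((-1 : ℤ) ^ p.1) • (lambdaClass k p.1 * symClass k p.2) =
        DirectSum.of (K0Deg k) N (((-1 : ℤ) ^ p.1) • x p) := by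
    intro p hp
    rw [(hx p hp).1, map_zsmul]
  rw [Finset.sum_congr rfl h6, ← map_sum, h2, map_zero]

end Koszul

/-! ### Constituents of products of sign or of trivial classes. -/

section LinearCharacters

variable {k : Type u} [Field k] [CharZero k]

omit [CharZero k] in
theorem isIrreducible_of_finrank_eq_one {G : Type*} [Group G] {V : FDRep k G}
    (hV : Module.finrank k V = 1) : IsIrreducible V.ρ := by
  have hbt : (⊥ : Subrepresentation V.ρ) ≠ ⊤ := fun h => by
    have h2 : (⊥ : Submodule k V) = ⊤ := congrArg Subrepresentation.toSubmodule h
    have h3 := finrank_top k V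
    rw [← h2, finrank_bot, hV] at h3
    exact zero_ne_one h3
  have : Nontrivial (Subrepresentation V.ρ) := ⟨⊥, ⊤, hbt⟩
  refine ⟨fun T => ?_⟩
  by_cases h : T.toSubmodule = ⊥
  · exact Or.inl (Subrepresentation.toSubmodule_injective h)
  · right
    refine Subrepresentation.toSubmodule_injective (Submodule.eq_top_of_finrank_eq ?_)
    have h1 := Submodule.finrank_le T.toSubmodule
    have h2 : Module.finrank k T.toSubmodule ≠ 0 := fun h0 => h (Submodule.finrank_eq_zero.1 h0)
    omega

/-- The coloring of the first `m` points by `0` and of the last `n` points by `1`. -/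
def blockColor (m n : ℕ) : Fin (m + n) → ℕ := Fin.addCases (fun _ => 0) fun _ => 1

theorem charHom_mulHom_signPow (e : ℕ) {m n : ℕ} {a : K0Deg k m} {b : K0Deg k n}
    (ha : charHom k _ a = signPow k e) (hb : charHom k _ b = signPow k e) :
    charHom k _ (mulHom m n a b) = indChar k e (blockColor m n) := by
  refine charHom_mulHom_eq_indChar e (fun i j => by simp [blockColor]) ?_ ?_
  · rw [ha, indChar_const e fun i j => by simp [blockColor]]
  · rw [hb, indChar_const e fun i j => by simp [blockColor]]

/-- By Frobenius reciprocity the linear character `sign ^ e` has multiplicity one in the product, so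
its class can be split off. -/
theorem isEffective_mulHom_sub (e : ℕ) {m n : ℕ} {A : FDRep k (Equiv.Perm (Fin m))}
    {B : FDRep k (Equiv.Perm (Fin n))} {C : FDRep k (Equiv.Perm (Fin (m + n)))}
    (hA : charHom k _ (RepK0.mk A) = signPow k e) (hB : charHom k _ (RepK0.mk B) = signPow k e)
    (hC : charHom k _ (RepK0.mk C) = signPow k e) :
    IsEffective (mulHom m n (RepK0.mk A) (RepK0.mk B) - RepK0.mk C) := by
  classical
  have hdim : Module.finrank k C = 1 := by
    have h := congrFun hC 1
    rw [charHom_mk, FDRep.char_one, signPow_one] at h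
    exact_mod_cast h
  have hpair : charPair C.character (charHom k _ (mulHom m n (RepK0.mk A) (RepK0.mk B))) = 1 := by
    rw [charHom_mulHom_signPow e hA hB, charPair_comm,
      charPair_indChar e _ (fun t g => FDRep.char_conj C g t), ← charHom_mk, hC]
    simp only [signPow_mul_self]
    rw [Finset.sum_boole, ← Fintype.card_subtype, ← Nat.card_eq_fintype_card]
    exact inv_mul_cancel₀ (natCast_card_colorStab_ne_zero _)
  rw [charPair_charHom] at hpair
  rw [mulHom_mk] at hpair ⊢
  have hne : mult C (RepK0.mk (tensorObj A B)) ≠ 0 := fun h => by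
    rw [h, Int.cast_zero] at hpair
    exact zero_ne_one hpair
  obtain ⟨Q, hQ⟩ := exists_mk_eq_add_of_mult_ne_zero (isIrreducible_of_finrank_eq_one hdim) hne
  exact ⟨Q, by rw [hQ, add_sub_cancel_left]⟩

/-- For every `t` at least two points have `d = 0` and `c ∘ t = 0`, so the joint coloring is never
injective. -/
theorem charPair_indChar_eq_zero_of_card {N : ℕ} {d c : Fin N → ℕ}
    (h : (Finset.univ.filter fun i => d i ≠ 0).card + (Finset.univ.filter fun i => c i ≠ 0).card + 2
      ≤ N) : charPair (indChar k 1 d) (indChar k 0 c) = 0 := by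
  refine charPair_indChar_indChar_eq_zero fun t ht => ?_
  have h1 : (Finset.univ.filter fun i => c (t i) ≠ 0).card =
      (Finset.univ.filter fun i => c i ≠ 0).card :=
    Finset.card_equiv t fun i => by simp
  have h2 : 1 < (Finset.univ.filter fun i => d i = 0 ∧ c (t i) = 0).card := by
    have h3 : (Finset.univ.filter fun i => d i = 0 ∧ c (t i) = 0)ᶜ ⊆
        (Finset.univ.filter fun i => d i ≠ 0) ∪ Finset.univ.filter fun i => c (t i) ≠ 0 := by
      intro i hi
      simp only [Finset.mem_compl, Finset.mem_filter, Finset.mem_univ, true_and,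
        Finset.mem_union] at hi ⊢
      tauto
    have h4 := (Finset.card_le_card h3).trans (Finset.card_union_le _ _)
    rw [Finset.card_compl, Fintype.card_fin] at h4
    omega
  obtain ⟨i, hi, j, hj, hne⟩ := Finset.one_lt_card.1 h2
  simp only [Finset.mem_filter, Finset.mem_univ, true_and] at hi hj
  exact hne (ht (by simp [hi.1, hi.2, hj.1, hj.2]))

theorem card_blockColor_one_ne_zero (m : ℕ) :
    (Finset.univ.filter fun i => blockColor m 1 i ≠ 0).card = 1 := by
  rw [Finset.card_eq_one]
  refine ⟨Fin.natAdd m 0, ?_⟩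
  ext l
  rw [Finset.mem_filter, Finset.mem_singleton]
  induction l using Fin.addCases with
  | left i =>
    simp only [blockColor, Fin.addCases_left]
    simp [Fin.ext_iff]
    omega
  | right j =>
    rw [Subsingleton.elim j 0]
    simp [blockColor]

variable (k) in
/-- The class of the sign representation, in degree `n`. -/
abbrev signCls (n : ℕ) : K0Deg k n := RepK0.mk (FDRep.of (signRep k n))

variable (k) in
/-- The class of the trivial representation, in degree `n`. -/
abbrev trivCls (n : ℕ) : K0Deg k n :=
  RepK0.mk (FDRep.of (Representation.trivial k (Equiv.Perm (Fin n)) k))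

theorem charHom_signCls (n : ℕ) : charHom k _ (signCls k n) = indChar k 1 fun _ => 0 := by
  rw [charHom_mk_signRep, indChar_const 1 fun _ _ => rfl]

theorem charHom_trivCls (n : ℕ) : charHom k _ (trivCls k n) = indChar k 0 fun _ => 0 := by
  rw [charHom_mk_trivial, indChar_const 0 fun _ _ => rfl]

theorem charHom_signCls_mul (m n : ℕ) :
    charHom k _ (mulHom m n (signCls k m) (signCls k n)) = indChar k 1 (blockColor m n) :=
  charHom_mulHom_signPow 1 (charHom_mk_signRep m) (charHom_mk_signRep n)

theorem charHom_trivCls_mul (m n : ℕ) :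
    charHom k _ (mulHom m n (trivCls k m) (trivCls k n)) = indChar k 0 (blockColor m n) :=
  charHom_mulHom_signPow 0 (charHom_mk_trivial m) (charHom_mk_trivial n)

theorem isEffective_signCls_mul_sub (m n : ℕ) :
    IsEffective (mulHom m n (signCls k m) (signCls k n) - signCls k (m + n)) :=
  isEffective_mulHom_sub 1 (charHom_mk_signRep m) (charHom_mk_signRep n) (charHom_mk_signRep _)

theorem isEffective_trivCls_mul_sub (m n : ℕ) :
    IsEffective (mulHom m n (trivCls k m) (trivCls k n) - trivCls k (m + n)) :=
  isEffective_mulHom_sub 0 (charHom_mk_trivial m) (charHom_mk_trivial n) (charHom_mk_trivial _)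

theorem lambdaClass_zero : lambdaClass k 0 = 1 := by
  have h : signCls k 0 = RepK0.mk (unitObj k) := by
    apply charHom_injective
    rw [charHom_mk_signRep, unitObj, charHom_mk_trivial]
    funext g
    rw [Subsingleton.elim g 1, signPow_one, signPow_one]
  exact congrArg (DirectSum.of (K0Deg k) 0) h

theorem symClass_zero : symClass k 0 = 1 := rfl

theorem lambdaClass_one : lambdaClass k 1 = xClass k := by
  have h : signCls k 1 = trivCls k 1 := by
    apply charHom_injective
    rw [charHom_mk_signRep, charHom_mk_trivial]
    funext g
    rw [Subsingleton.elim g 1, signPow_one, signPow_one]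
  exact congrArg (DirectSum.of (K0Deg k) 1) h

theorem symClass_one : symClass k 1 = xClass k := rfl

end LinearCharacters

/-! ### Dimension divided by `n!` as a ring homomorphism. -/

section NormalizedDimension

variable {k : Type u} [Field k] [CharZero k]

variable (k) in
/-- The ring homomorphism sending the class of a representation of `S_n` to its dimension divided
by `n!`. -/
def normDim : TensorK0 k →+* k :=
  DirectSum.toSemiring
    (fun n => (AddMonoidHom.mulLeft ((n.factorial : k)⁻¹)).comp
      ((Pi.evalAddMonoidHom (fun _ : Equiv.Perm (Fin n) => k) 1).comp (charHom k _)))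
    (by
      have h := congrFun (charHom_mk_trivial (k := k) 0) 1
      rw [signPow_one] at h
      change ((Nat.factorial 0 : ℕ) : k)⁻¹ * charHom k _ (trivCls k 0) 1 = 1
      rw [h]
      simp)
    (by
      intro m n a b
      change ((m + n).factorial : k)⁻¹ * charHom k _ (mulHom m n a b) 1 =
        (m.factorial : k)⁻¹ * charHom k _ a 1 * ((n.factorial : k)⁻¹ * charHom k _ b 1)
      have h := charHom_mulHom a b 1
      -- At the identity only `x = 1` contributes, for every `t`; hence induction multiplies the
      -- dimension by `(m + n)! / (m! n!)`.
      have h1 : ∀ t : Equiv.Perm (Fin (m + n)), (∑ x : Equiv.Perm (Fin m) × Equiv.Perm (Fin n),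
          if youngHom m n x = t⁻¹ * 1 * t then charHom k _ a x.1 * charHom k _ b x.2 else 0) =
          charHom k _ a 1 * charHom k _ b 1 := by
        intro t
        rw [mul_one, inv_mul_cancel, Finset.sum_eq_single 1]
        · simp
        · intro x _ hx
          exact if_neg fun h => hx (youngHom_injective m n (h.trans (map_one _).symm))
        · simp
      rw [Finset.sum_congr rfl fun t _ => h1 t, Finset.sum_const, Finset.card_univ,
        Fintype.card_perm, Fintype.card_fin, nsmul_eq_mul] at h
      have h2 : (m.factorial : k) ≠ 0 := Nat.cast_ne_zero.2 m.factorial_ne_zero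
      have h3 : (n.factorial : k) ≠ 0 := Nat.cast_ne_zero.2 n.factorial_ne_zero
      have h4 : ((m + n).factorial : k) ≠ 0 := Nat.cast_ne_zero.2 (m + n).factorial_ne_zero
      field_simp
      push_cast at h
      linear_combination h)

theorem normDim_of {n : ℕ} (a : K0Deg k n) :
    normDim k (DirectSum.of (K0Deg k) n a) = (n.factorial : k)⁻¹ * charHom k _ a 1 :=
  DirectSum.toSemiring_of ..

theorem normDim_lambdaClass (n : ℕ) : normDim k (lambdaClass k n) = (n.factorial : k)⁻¹ := by
  refine (normDim_of (signCls k n)).trans ?_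
  rw [charHom_mk_signRep, signPow_one, mul_one]

theorem normDim_symClass (n : ℕ) : normDim k (symClass k n) = (n.factorial : k)⁻¹ := by
  refine (normDim_of (trivCls k n)).trans ?_
  rw [charHom_mk_trivial, signPow_one, mul_one]

theorem IsEffective.exists_normDim {n : ℕ} {a : K0Deg k n} (ha : IsEffective a) :
    ∃ p : ℕ, normDim k (DirectSum.of (K0Deg k) n a) = (n.factorial : k)⁻¹ * p := by
  obtain ⟨V, rfl⟩ := ha
  exact ⟨Module.finrank k V, by rw [normDim_of, charHom_mk, FDRep.char_one]⟩

end NormalizedDimension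

/-! ### Constraints on the error class `d`, one irreducible representation at a time. -/

section Perturbation

variable {k : Type u} [Field k] [CharZero k] {G : Type} [Group G] [Fintype G]

/-- Compare multiplicities at one irreducible. If it is missing from `e`, then `0 ≤ d`, and `d` is
at most both `E` and `h`, one of which vanishes. If it is missing from `H`, then `d = h`; either `h`
vanishes, or `E` does and `e + d = 0` with both terms nonnegative. -/
theorem eq_zero_of_charPair_cross {e h E H d : RepK0 k G} (he : IsEffective e)
    (hh : IsEffective h) (hE : IsEffective E) (hH : IsEffective H) (h1 : IsEffective (e + d))
    (h2 : IsEffective (E - (e + d))) (h3 : IsEffective (h - d)) (h4 : IsEffective (H - (h - d)))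
    (heH : charPair (charHom k G e) (charHom k G H) = 0)
    (hEh : charPair (charHom k G E) (charHom k G h) = 0) : d = 0 := by
  refine eq_zero_of_mult_eq_zero fun U hU => ?_
  have a1 := he.mult_nonneg U
  have a2 := hh.mult_nonneg U
  have a3 := h1.mult_nonneg U
  have a4 := h2.mult_nonneg U
  have a5 := h3.mult_nonneg U
  have a6 := h4.mult_nonneg U
  have a7 := mult_eq_zero_or_of_charPair he hH heH hU
  have a8 := mult_eq_zero_or_of_charPair hE hh hEh hU
  simp only [map_add, map_sub] at a3 a4 a5 a6
  omega

/-- Each irreducible is missing from `E` or from `H`. In the first case `e` and `e + d`, both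
bounded by `E`, vanish there; in the second case `h` and `h + d` do. -/
theorem eq_zero_of_charPair_outer {e h E H d : RepK0 k G} (he : IsEffective e)
    (hh : IsEffective h) (hE : IsEffective E) (hH : IsEffective H)
    (hEe : IsEffective (E - e)) (hHh : IsEffective (H - h)) (h1 : IsEffective (e + d))
    (h2 : IsEffective (E - (e + d))) (h3 : IsEffective (h + d)) (h4 : IsEffective (H - (h + d)))
    (hEH : charPair (charHom k G E) (charHom k G H) = 0) : d = 0 := by
  refine eq_zero_of_mult_eq_zero fun U hU => ?_
  have a1 := he.mult_nonneg U
  have a2 := hh.mult_nonneg U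
  have a3 := h1.mult_nonneg U
  have a4 := h2.mult_nonneg U
  have a5 := h3.mult_nonneg U
  have a6 := h4.mult_nonneg U
  have a7 := hEe.mult_nonneg U
  have a8 := hHh.mult_nonneg U
  have a9 := mult_eq_zero_or_of_charPair hE hH hEH hU
  simp only [map_add, map_sub] at a3 a4 a5 a6 a7 a8
  omega

/-- Each irreducible is missing from `e` or from `h`, and there `d` has the multiplicity of `e + d`
or of `h + d`. -/
theorem isEffective_of_charPair_inner {e h d : RepK0 k G} (he : IsEffective e)
    (hh : IsEffective h) (h1 : IsEffective (e + d)) (h3 : IsEffective (h + d))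
    (heh : charPair (charHom k G e) (charHom k G h) = 0) : IsEffective d := by
  refine isEffective_of_mult_nonneg fun U hU => ?_
  have a3 := h1.mult_nonneg U
  have a5 := h3.mult_nonneg U
  have a9 := mult_eq_zero_or_of_charPair he hh heh hU
  simp only [map_add] at a3 a5
  omega

/-- If both were nonzero, the two self-pairings would each be at least `1` and the cross terms
nonnegative, so the total would be at least `2`. -/
theorem eq_zero_or_of_charPair_self_eq_one {d q : RepK0 k G} (hd : IsEffective d)
    (hq : IsEffective q)
    (h : charPair (charHom k G (d + q)) (charHom k G (d + q)) = 1) : d = 0 ∨ q = 0 := by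
  by_contra hn
  push Not at hn
  obtain ⟨a, ha, ha'⟩ := hd.charPair_self_pos hn.1
  obtain ⟨b, hb, hb'⟩ := hq.charPair_self_pos hn.2
  obtain ⟨c, hc⟩ := hd.charPair_nonneg hq
  obtain ⟨c', hc'⟩ := hq.charPair_nonneg hd
  rw [map_add, charPair_add_left, charPair_add_right, charPair_add_right, ha, hb, hc, hc'] at h
  have h' : a + c + (c' + b) = 1 := by exact_mod_cast h
  omega

end Perturbation

/-! ### The induction on the degree for a positive graded endomorphism. -/

section Endomorphisms

variable {k : Type u} [Field k] [CharZero k]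

theorem isEffective_apply_of_mem_closure {y : TensorK0 k}
    (hy : y ∈ AddSubmonoid.closure (simpleClasses k)) (n : ℕ) : IsEffective (y n) := by
  have h0 : ∀ m, IsEffective (0 : K0Deg k m) := fun m =>
    isEffective_of_mult_nonneg fun U _ => by rw [map_zero]
  induction hy using AddSubmonoid.closure_induction with
  | mem y hy =>
    obtain ⟨m, V, -, rfl⟩ := hy
    by_cases hmn : m = n
    · subst hmn
      exact ⟨V, DirectSum.of_eq_same m _⟩
    · have h : cls V n = 0 := DirectSum.of_eq_of_ne m n _ (Ne.symm hmn)
      rw [h]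
      exact h0 n
  | zero => exact h0 n
  | add y z _ _ hy hz => exact hy.add hz

theorem IsEffective.of_mem_closure {n : ℕ} {a : K0Deg k n} (ha : IsEffective a) :
    DirectSum.of (K0Deg k) n a ∈ AddSubmonoid.closure (simpleClasses k) := by
  have h := ha.mem_closure
  clear ha
  induction h using AddSubmonoid.closure_induction with
  | mem y hy =>
    obtain ⟨U, hU, rfl⟩ := hy
    exact AddSubmonoid.subset_closure ⟨n, U, hU, rfl⟩
  | zero => rw [map_zero]; exact zero_mem _
  | add y z _ _ hy hz => rw [map_add]; exact add_mem hy hz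

variable {f : TensorK0 k →+* TensorK0 k}

theorem IsEffective.of_map
    (hpos : ∀ s ∈ simpleClasses k, f s ∈ AddSubmonoid.closure (simpleClasses k)) {m n : ℕ}
    {a : K0Deg k m} {b : K0Deg k n} (ha : IsEffective a)
    (h : f (DirectSum.of (K0Deg k) m a) = DirectSum.of (K0Deg k) n b) : IsEffective b := by
  have h1 : AddSubmonoid.closure (simpleClasses k) ≤
      (AddSubmonoid.closure (simpleClasses k)).comap f := (AddSubmonoid.closure_le).2 hpos
  have h2 : f _ ∈ AddSubmonoid.closure (simpleClasses k) := h1 ha.of_mem_closure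
  rw [h] at h2
  have h3 := isEffective_apply_of_mem_closure h2 n
  rwa [DirectSum.of_eq_same] at h3

/-- Subtract the alternating relation from its image under `f`: every term except those at `(0, N)`
and `(N, 0)` is a product of fixed classes and cancels. -/
theorem map_symClass_sub {N : ℕ} (hN : 0 < N)
    (hfix : ∀ i < N, f (lambdaClass k i) = lambdaClass k i ∧ f (symClass k i) = symClass k i) :
    f (symClass k N) - symClass k N +
      (-1 : ℤ) ^ N • (f (lambdaClass k N) - lambdaClass k N) = 0 := by
  have h := sum_lambdaClass_mul_symClass (k := k) hN
  have key := congrArg f h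
  rw [map_zero, ← h, map_sum, ← sub_eq_zero, ← Finset.sum_sub_distrib,
    Finset.sum_eq_add_of_mem (0, N) (N, 0)
      (Finset.HasAntidiagonal.mem_antidiagonal.2 (zero_add N))
      (Finset.HasAntidiagonal.mem_antidiagonal.2 (add_zero N))
      (fun h => hN.ne (congrArg Prod.fst h))] at key
  · simp only [map_zsmul, lambdaClass_zero, symClass_zero, one_mul, mul_one,
      pow_zero, one_smul] at key
    rw [smul_sub]
    exact key
  · rintro ⟨i, j⟩ hij hne
    have hij' : i + j = N := Finset.HasAntidiagonal.mem_antidiagonal.1 hij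
    have hi : i < N := by
      rcases Nat.eq_zero_or_pos j with rfl | hj
      · exact absurd (by simpa using hij') (fun h => hne.2 (by rw [h]))
      · omega
    have hj : j < N := by
      rcases Nat.eq_zero_or_pos i with rfl | hj
      · exact absurd (by simpa using hij') (fun h => hne.1 (by rw [h]))
      · omega
    rw [map_zsmul, map_mul, (hfix i hi).1, (hfix j hj).2, sub_self]

theorem of_signCls_mul (m n : ℕ) : DirectSum.of (K0Deg k) (m + n)
    (mulHom m n (signCls k m) (signCls k n)) = lambdaClass k m * lambdaClass k n :=
  (of_mul_of ..).symm

theorem of_trivCls_mul (m n : ℕ) : DirectSum.of (K0Deg k) (m + n)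
    (mulHom m n (trivCls k m) (trivCls k n)) = symClass k m * symClass k n :=
  (of_mul_of ..).symm

theorem charPair_signCls_trivCls {N : ℕ} (hN : 2 ≤ N) :
    charPair (charHom k _ (signCls k N)) (charHom k _ (trivCls k N)) = 0 := by
  rw [charHom_signCls, charHom_trivCls]
  exact charPair_indChar_eq_zero_of_card (by simpa using hN)

theorem charPair_signCls_trivCls_mul {M : ℕ} (hM : 2 ≤ M) :
    charPair (charHom k _ (signCls k (M + 1)))
      (charHom k _ (mulHom M 1 (trivCls k M) (trivCls k 1))) = 0 := by
  rw [charHom_signCls, charHom_trivCls_mul]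
  refine charPair_indChar_eq_zero_of_card ?_
  rw [card_blockColor_one_ne_zero]
  simp
  omega

theorem charPair_signCls_mul_trivCls {M : ℕ} (hM : 2 ≤ M) :
    charPair (charHom k _ (mulHom M 1 (signCls k M) (signCls k 1)))
      (charHom k _ (trivCls k (M + 1))) = 0 := by
  rw [charHom_trivCls, charHom_signCls_mul]
  refine charPair_indChar_eq_zero_of_card ?_
  rw [card_blockColor_one_ne_zero]
  simp
  omega

theorem charPair_signCls_mul_trivCls_mul {M : ℕ} (hM : 3 ≤ M) :
    charPair (charHom k _ (mulHom M 1 (signCls k M) (signCls k 1)))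
      (charHom k _ (mulHom M 1 (trivCls k M) (trivCls k 1))) = 0 := by
  rw [charHom_trivCls_mul, charHom_signCls_mul]
  refine charPair_indChar_eq_zero_of_card ?_
  rw [card_blockColor_one_ne_zero]
  omega

/-- The exceptional degree: the counting formula gives `4 / (2 · 2)`. -/
theorem charPair_signCls_mul_trivCls_mul_two :
    charPair (charHom k _ (mulHom 2 1 (signCls k 2) (signCls k 1)))
      (charHom k _ (mulHom 2 1 (trivCls k 2) (trivCls k 1))) = 1 := by
  rw [charHom_trivCls_mul, charHom_signCls_mul, charPair_indChar_indChar]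
  have h1 : Nat.card (colorStab (blockColor 2 1)) = 2 := by
    change Nat.card {t : Equiv.Perm (Fin (2 + 1)) //
      ∀ i, blockColor 2 1 (t i) = blockColor 2 1 i} = 2
    rw [Nat.card_eq_fintype_card]
    decide
  have h2 : Nat.card {t : Equiv.Perm (Fin (2 + 1)) //
      Function.Injective fun i => (blockColor 2 1 i, blockColor 2 1 (t i))} = 4 := by
    rw [Nat.card_eq_fintype_card]
    decide
  rw [h1, h2]
  norm_num

theorem of_trivCls_add_sub_zsmul {N : ℕ} (hN : 0 < N)
    (hfix : ∀ i < N, f (lambdaClass k i) = lambdaClass k i ∧ f (symClass k i) = symClass k i)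
    {b b' : K0Deg k N} (hb : f (lambdaClass k N) = DirectSum.of (K0Deg k) N b)
    (hb' : f (symClass k N) = DirectSum.of (K0Deg k) N b') :
    b' - trivCls k N + (-1 : ℤ) ^ N • (b - signCls k N) = 0 := by
  have h := map_symClass_sub hN hfix
  rw [hb, hb', symClass, lambdaClass] at h
  apply DirectSum.of_injective (β := K0Deg k) N
  rw [map_add, map_zsmul, map_sub, map_sub, map_zero]
  exact h

/-- This is the alternating relation in degree `3`, rewritten with `e_1 = h_1 = x`. -/
theorem signCls_mul_sub_eq_trivCls_mul_sub :
    mulHom 2 1 (signCls k 2) (signCls k 1) - signCls k (2 + 1) =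
      mulHom 2 1 (trivCls k 2) (trivCls k 1) - trivCls k (2 + 1) := by
  apply DirectSum.of_injective (β := K0Deg k) (2 + 1)
  rw [map_sub, map_sub, of_signCls_mul, of_trivCls_mul]
  change lambdaClass k 2 * lambdaClass k 1 - lambdaClass k 3 =
    symClass k 2 * symClass k 1 - symClass k 3
  have h := sum_lambdaClass_mul_symClass (k := k) (N := 3) (by norm_num)
  simp only [Finset.Nat.sum_antidiagonal_eq_sum_range_succ_mk, Finset.sum_range_succ,
    Finset.sum_range_zero, lambdaClass_zero, symClass_zero, Nat.reduceSub] at h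
  rw [lambdaClass_one, ← symClass_one] at h ⊢
  simp only [zsmul_eq_mul] at h
  push_cast at h
  linear_combination h

/-- Apply `f` and then `normDim` to the alternating relation in degree `4`: the images of `e_4` and
`h_4` have total `1/2 + 1/2 - 1/4 = 3/4`. Positivity on `e_2² - e_4` and `h_2² - h_4` allows at most
`1/4 + 1/4`. -/
theorem not_map_three_eq_mul (hgraded : ∀ (n : ℕ) (a : K0Deg k n), ∃ b : K0Deg k n,
      f (DirectSum.of (K0Deg k) n a) = DirectSum.of (K0Deg k) n b)
    (hpos : ∀ s ∈ simpleClasses k, f s ∈ AddSubmonoid.closure (simpleClasses k))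
    (hlambda : ∀ i < 3, f (lambdaClass k i) = lambdaClass k i)
    (hsym : ∀ i < 3, f (symClass k i) = symClass k i)
    (h3 : f (lambdaClass k 3) = lambdaClass k 2 * lambdaClass k 1)
    (h3' : f (symClass k 3) = symClass k 2 * symClass k 1) : False := by
  obtain ⟨A, hA⟩ := hgraded 4 (signCls k 4)
  obtain ⟨B, hB⟩ := hgraded 4 (trivCls k 4)
  have hE : f (DirectSum.of (K0Deg k) (2 + 2) (mulHom 2 2 (signCls k 2) (signCls k 2) -
      signCls k (2 + 2))) = DirectSum.of (K0Deg k) (2 + 2)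
        (mulHom 2 2 (signCls k 2) (signCls k 2) - A) := by
    rw [map_sub, map_sub, map_sub, of_signCls_mul, map_mul, hlambda 2 (by norm_num)]
    congr 1
  have hH : f (DirectSum.of (K0Deg k) (2 + 2) (mulHom 2 2 (trivCls k 2) (trivCls k 2) -
      trivCls k (2 + 2))) = DirectSum.of (K0Deg k) (2 + 2)
        (mulHom 2 2 (trivCls k 2) (trivCls k 2) - B) := by
    rw [map_sub, map_sub, map_sub, of_trivCls_mul, map_mul, hsym 2 (by norm_num)]
    congr 1
  obtain ⟨p, hp⟩ := ((isEffective_signCls_mul_sub 2 2).of_map hpos hE).exists_normDim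
  obtain ⟨q, hq⟩ := ((isEffective_trivCls_mul_sub 2 2).of_map hpos hH).exists_normDim
  have h4 := congrArg (fun y => normDim k (f y))
    (sum_lambdaClass_mul_symClass (k := k) (N := 4) (by norm_num))
  rw [map_sub, of_signCls_mul, map_sub, ← hA, map_mul] at hp
  rw [map_sub, of_trivCls_mul, map_sub, ← hB, map_mul] at hq
  change _ - normDim k (f (lambdaClass k 4)) = _ at hp
  change _ - normDim k (f (symClass k 4)) = _ at hq
  simp only [Finset.Nat.sum_antidiagonal_eq_sum_range_succ_mk, Finset.sum_range_succ,
    Finset.sum_range_zero, map_add, map_zsmul, map_mul, lambdaClass_zero, symClass_zero, map_one,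
    map_zero, h3, h3', hlambda 1 (by norm_num), hlambda 2 (by norm_num), hsym 1 (by norm_num),
    hsym 2 (by norm_num), Nat.reduceSub, normDim_lambdaClass, normDim_symClass] at h4 hp hq
  simp [Nat.factorial] at h4 hp hq
  -- All three equations are scaled by `4! = 24`: `12` is `24 · (1/4 + 1/4)` and `18` is `24 · 3/4`.
  have : (p : k) + q + 18 = 12 := by
    linear_combination (-24) * hp - 24 * hq - 24 * h4
  have : p + q + 18 = 12 := by exact_mod_cast this
  omega

theorem map_lambdaClass_of_lt {M : ℕ} (hM : 2 ≤ M)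
    (hgraded : ∀ (n : ℕ) (a : K0Deg k n), ∃ b : K0Deg k n,
      f (DirectSum.of (K0Deg k) n a) = DirectSum.of (K0Deg k) n b)
    (hpos : ∀ s ∈ simpleClasses k, f s ∈ AddSubmonoid.closure (simpleClasses k))
    (hfix : ∀ i < M + 1, f (lambdaClass k i) = lambdaClass k i ∧ f (symClass k i) = symClass k i) :
    f (lambdaClass k (M + 1)) = lambdaClass k (M + 1) := by
  obtain ⟨b, hb⟩ := hgraded (M + 1) (signCls k (M + 1))
  obtain ⟨b', hb'⟩ := hgraded (M + 1) (trivCls k (M + 1))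
  have hk := of_trivCls_add_sub_zsmul (N := M + 1) M.succ_pos hfix hb hb'
  obtain ⟨e, he⟩ : ∃ e, signCls k (M + 1) = e := ⟨_, rfl⟩
  obtain ⟨h, hh⟩ : ∃ h, trivCls k (M + 1) = h := ⟨_, rfl⟩
  obtain ⟨E, hE⟩ : ∃ E, mulHom M 1 (signCls k M) (signCls k 1) = E := ⟨_, rfl⟩
  obtain ⟨H, hH⟩ : ∃ H, mulHom M 1 (trivCls k M) (trivCls k 1) = H := ⟨_, rfl⟩
  obtain ⟨d, rfl⟩ : ∃ d, b = e + d := ⟨b - e, by abel⟩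
  have e1 : f (DirectSum.of (K0Deg k) (M + 1) E) = DirectSum.of (K0Deg k) (M + 1) E := by
    rw [← hE, of_signCls_mul, map_mul, (hfix M (by omega)).1, (hfix 1 (by omega)).1]
  have e2 : f (DirectSum.of (K0Deg k) (M + 1) H) = DirectSum.of (K0Deg k) (M + 1) H := by
    rw [← hH, of_trivCls_mul, map_mul, (hfix M (by omega)).2, (hfix 1 (by omega)).2]
  have e3 : f (DirectSum.of (K0Deg k) (M + 1) (E - e)) =
      DirectSum.of (K0Deg k) (M + 1) (E - (e + d)) := by
    rw [map_sub, map_sub, map_sub, e1, ← hb, ← he]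
  have e4 : f (DirectSum.of (K0Deg k) (M + 1) (H - h)) =
      DirectSum.of (K0Deg k) (M + 1) (H - b') := by
    rw [map_sub, map_sub, map_sub, e2, ← hb', ← hh]
  have pe : IsEffective e := ⟨_, he.symm⟩
  have ph : IsEffective h := ⟨_, hh.symm⟩
  have pEe : IsEffective (E - e) := by rw [← hE, ← he]; exact isEffective_signCls_mul_sub M 1
  have pHh : IsEffective (H - h) := by rw [← hH, ← hh]; exact isEffective_trivCls_mul_sub M 1
  have pE : IsEffective E := by simpa using pEe.add pe
  have pH : IsEffective H := by simpa using pHh.add ph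
  have p1 : IsEffective (e + d) := IsEffective.of_map hpos ⟨_, rfl⟩ hb
  have p2 : IsEffective (E - (e + d)) := pEe.of_map hpos e3
  have p3 : IsEffective b' := IsEffective.of_map hpos ⟨_, rfl⟩ hb'
  have p4 : IsEffective (H - b') := pHh.of_map hpos e4
  have c1 := charPair_signCls_trivCls (k := k) (N := M + 1) (by omega)
  have c2 := charPair_signCls_trivCls_mul (k := k) hM
  have c3 := charPair_signCls_mul_trivCls (k := k) hM
  rw [he, hh] at c1
  rw [he, hH] at c2
  rw [hE, hh] at c3
  rw [he, hh, add_sub_cancel_left] at hk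
  suffices hd : d = 0 by
    change f (DirectSum.of (K0Deg k) (M + 1) (signCls k (M + 1))) =
      DirectSum.of (K0Deg k) (M + 1) (signCls k (M + 1))
    rw [hb, hd, add_zero, he]
  -- The parity of the degree `M + 1` decides whether the trivial class is moved by `d` or by `-d`.
  rcases Nat.even_or_odd M with hpar | hpar
  · obtain rfl : b' = h + d := by
      rw [hpar.add_one.neg_one_pow, neg_one_smul, add_neg_eq_zero, sub_eq_iff_eq_add'] at hk
      exact hk
    rcases hM.eq_or_lt with rfl | hM'
    -- Degree `3`: here `E` and `H` are not disjoint. Instead, `d` and its complement in `E - e` are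
    -- effective and `E - e` has self-pairing `1`, so one of the two is zero.
    · have pd := isEffective_of_charPair_inner pe ph p1 p3 c1
      have hs : E - e = H - h := by
        rw [← hE, ← he, ← hH, ← hh]; exact signCls_mul_sub_eq_trivCls_mul_sub
      have hself : charPair (charHom k _ (d + (E - (e + d))))
          (charHom k _ (d + (E - (e + d)))) = 1 := by
        have c4 := charPair_signCls_mul_trivCls_mul_two (k := k)
        rw [hE, hH] at c4
        have hs' : d + (E - (e + d)) = E - e := by abel
        rw [hs']
        -- Only the second argument becomes `H - h`, so the self-pairing expands into the known
        -- pairings of `E`, `e` with `H`, `h`.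
        nth_rewrite 2 [hs]
        rw [map_sub, map_sub, charPair_sub_left, charPair_sub_right, charPair_sub_right,
          c1, c2, c3, c4]
        ring
      rcases eq_zero_or_of_charPair_self_eq_one pd p2 hself with hd | hq
      · exact hd
      · exfalso
        rw [sub_eq_zero] at hq
        have hq' : H = h + d := by
          have : d = E - e := by rw [hq]; abel
          rw [this, hs]; abel
        refine not_map_three_eq_mul hgraded hpos (fun i hi => (hfix i hi).1)
          (fun i hi => (hfix i hi).2) ?_ ?_
        · rw [← of_signCls_mul, hE, hq]; exact hb
        · rw [← of_trivCls_mul, hH, hq']; exact hb'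
    · have c4 := charPair_signCls_mul_trivCls_mul (k := k) hM'
      rw [hE, hH] at c4
      exact eq_zero_of_charPair_outer pe ph pE pH pEe pHh p1 p2 p3 p4 c4
  · obtain rfl : b' = h - d := by
      rw [hpar.add_one.neg_one_pow, one_smul] at hk
      rw [← sub_eq_zero, ← hk]; abel
    exact eq_zero_of_charPair_cross pe ph pE pH p1 p2 p3 p4 c2 c3

theorem map_lambdaClass_and_symClass (hgraded : ∀ (n : ℕ) (a : K0Deg k n), ∃ b : K0Deg k n,
      f (DirectSum.of (K0Deg k) n a) = DirectSum.of (K0Deg k) n b)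
    (hx : f (xClass k) = xClass k) (hlambda : f (lambdaClass k 2) = lambdaClass k 2)
    (hpos : ∀ s ∈ simpleClasses k, f s ∈ AddSubmonoid.closure (simpleClasses k)) (N : ℕ) :
    f (lambdaClass k N) = lambdaClass k N ∧ f (symClass k N) = symClass k N := by
  induction N using Nat.strong_induction_on with
  | _ N ih =>
    have hl : f (lambdaClass k N) = lambdaClass k N := by
      match N, ih with
      | 0, _ => rw [lambdaClass_zero, map_one]
      | 1, _ => rw [lambdaClass_one, hx]
      | 2, _ => exact hlambda
      | M + 3, ih => exact map_lambdaClass_of_lt (by omega) hgraded hpos ih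
    refine ⟨hl, ?_⟩
    rcases N.eq_zero_or_pos with rfl | hN
    · rw [symClass_zero, map_one]
    · have h := map_symClass_sub hN ih
      rwa [hl, sub_self, smul_zero, add_zero, sub_eq_zero] at h

end Endomorphisms

end FreeTensor

end

/-- Let `f` be a graded ring endomorphism of the Grothendieck ring `K₀(𝒯_k)` of the free tensor
category that fixes `x` and `λ²x` and sends the class of each simple object to a linear combination,
with non-negative integer coefficients, of classes of simple objects. Then `f` is the identity. -/
theorem mainTheorem3 (k : Type u) [Field k] [CharZero k]
    (f : FreeTensor.TensorK0 k →+* FreeTensor.TensorK0 k)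
    (hgraded : ∀ (n : ℕ) (a : FreeTensor.K0Deg k n), ∃ b : FreeTensor.K0Deg k n,
      f (DirectSum.of (FreeTensor.K0Deg k) n a) = DirectSum.of (FreeTensor.K0Deg k) n b)
    (hx : f (FreeTensor.xClass k) = FreeTensor.xClass k)
    (hlambda : f (FreeTensor.lambdaClass k 2) = FreeTensor.lambdaClass k 2)
    (hpos : ∀ s ∈ FreeTensor.simpleClasses k,
      f s ∈ AddSubmonoid.closure (FreeTensor.simpleClasses k)) :
    f = RingHom.id (FreeTensor.TensorK0 k) := by
  -- The elements fixed by `f` form a subring, which contains the generators `[SymⁿX]`.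
  have h := FreeTensor.eq_top_of_trivial_mem (RingHom.eqLocus f (RingHom.id _)) fun n =>
    (FreeTensor.map_lambdaClass_and_symClass hgraded hx hlambda hpos n).2
  refine RingHom.ext fun y => ?_
  have hy : y ∈ RingHom.eqLocus f (RingHom.id _) := h ▸ Subring.mem_top y
  exact hy
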